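/- **Conventions.** All categories are small. For a set $C$, let $\mathsf S(C)$ be the strict symmetric monoidal category whose objects are the finite sequences $c_1\otimes\cdots\otimes c_n$ of elements of $C$ ($n\ge 0$), whose morphisms $c_1\otimes\cdots\otimes c_n\to c'_1\otimes\cdots\otimes c'_n$ are the permutations $\sigma\in S_n$ with $c'_{\sigma(i)}=c_i$ for all $i$ (there are none between sequences of different lengths), with concatenation of sequences and block sums of permutations as tensor product, and with block permutations as braiding. A map $g\colon C\to C'$ induces $g_*\colon\mathsf S(C)\to\mathsf S(C')$ entry by entry. A *network model* is a pair $(C,F)$ of a set $C$ and a lax symmetric monoidal functor $(F,\Phi,\phi)\colon\mathsf S(C)\to\mathsf{Cat}$, where $\mathsf{Cat}$ carries the cartesian product. A morphism $(C,F)\to(C',F')$ is a pair $(g,\mathfrak g)$ of a map $g\colon C\to C'$ and a monoidal natural transformation $\mathfrak g\colon F\Rightarrow F'\circ g_*$; the composite $(g',\mathfrak g')\circ(g,\mathfrak g)$ is $g'\circ g$ with the components $\mathfrak g'_{g_*x}\circ\mathfrak g_x$. This gives the category $\mathsf{NetMod}$. Let $\mathsf{SSMC}$ be the category of strict symmetric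 monoidal categories and strict symmetric monoidal functors. For a network model $F$, the strict symmetric monoidal category $\int F$ has as objects the pairs $(c,x)$ with $c\in\mathsf S(C)$ and $x\in F(c)$, as morphisms $(c,x)\to(d,y)$ the pairs $(f,a)$ with $f\colon c\to d$ in $\mathsf S(C)$ and $a\colon F(f)(x)\to y$ in $F(d)$, composition $(f',a')\circ(f,a)=(f'\circ f,\,a'\circ F(f')(a))$, tensor products $(c,x)\otimes(d,y)=(c\otimes d,\Phi(x,y))$ and $(f,a)\otimes(f',a')=(f\otimes f',\Phi(a,a'))$, the unit $(I,\phi)$, and the braidings $(B,1)$, with $B$ the braiding of $\mathsf S(C)$. A morphism $(g,\mathfrak g)\colon(C,F)\to(C',F')$ induces the strict symmetric monoidal functor $\widehat G\colon\int F\to\int F'$ with $\widehat G(c,x)=(g_*c,\mathfrak g_c(x))$ and $\widehat G(f,a)=(g_*f,\mathfrak g_d(a))$ for $(f,a)\colon(c,x)\to(d,y)$. $\mathsf{Op}$ is the category of typed (coloured) symmetric operads: an operad $O$ has a set of types, sets $O(t_1,\dots,t_n;t)$ of operations, identities $1_t\in O(t;t)$, associative and unital composition, and maps $O(t_1,\dots,t_n;t)\to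 O(t_{\sigma(1)},\dots,t_{\sigma(n)};t)$ for $\sigma\in S_n$, which are compatible with products of permutations and with composition (equivariance). A morphism is a map of types together with maps of operations which preserve composition, identities and the permutation actions. For a strict symmetric monoidal category $\mathsf C$, let $\mathrm{Op}(\mathsf C)$ have the objects of $\mathsf C$ as types, the morphisms $c_1\otimes\cdots\otimes c_n\to c$ as operations $\mathrm{Op}(\mathsf C)(c_1,\dots,c_n;c)$, the composition $f\circ(g_1\otimes\cdots\otimes g_n)$, the identity morphisms as identities, and the permutation action by precomposition with the symmetries of $\mathsf C$. For a strict symmetric monoidal functor $G\colon\mathsf C\to\mathsf D$, let $\mathrm{Op}(G)$ be $c\mapsto G(c)$ on types and $f\mapsto G(f)$ on operations. **Theorem.** Every $\mathrm{Op}(\mathsf C)$ is a typed operad and every $\mathrm{Op}(G)$ is a morphism of operads, and there is a unique functor $$\mathrm O\colon\mathsf{NetMod}\to\mathsf{Op}$$ which sends each network model $F\colon\mathsf S(C)\to\mathsf{Cat}$ to its network operad $\mathrm O_F=\mathrm{Op}(\int F)$ and each morphism $(g,\mathfrak g)$ of network models to $\mathrm{Op}(\widehat G)$. Moreover, $F\mapsto\int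 F$, $(g,\mathfrak g)\mapsto\widehat G$ is a functor $\int\colon\mathsf{NetMod}\to\mathsf{SSMC}$, the assignments $\mathsf C\mapsto\mathrm{Op}(\mathsf C)$, $G\mapsto\mathrm{Op}(G)$ form a functor $\mathrm{Op}\colon\mathsf{SSMC}\to\mathsf{Op}$, and $\mathrm O=\mathrm{Op}\circ\int$. -/

import Mathlib

open CategoryTheory MonoidalCategory

universe v u

/-- The block sum `σ + τ` of two bijections. -/
def blockSum {a a' b b' : ℕ} (σ : Fin a ≃ Fin a') (τ : Fin b ≃ Fin b') :
    Fin (a + b) ≃ Fin (a' + b') :=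
  finSumFinEquiv.symm.trans ((Equiv.sumCongr σ τ).trans finSumFinEquiv)

/-- The block permutation which moves the first `a` elements behind the last `b`. -/
def blockSwap (a b : ℕ) : Fin (a + b) ≃ Fin (b + a) :=
  finSumFinEquiv.symm.trans ((Equiv.sumComm _ _).trans finSumFinEquiv)

section Blocks

variable {a a' b b' c c' : ℕ}

@[simp] theorem blockSum_castAdd (σ : Fin a ≃ Fin a') (τ : Fin b ≃ Fin b') (i : Fin a) :
    blockSum σ τ (Fin.castAdd b i) = Fin.castAdd b' (σ i) := by
  simp [blockSum]

@[simp] theorem blockSum_natAdd (σ : Fin a ≃ Fin a') (τ : Fin b ≃ Fin b') (i : Fin b) :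
    blockSum σ τ (Fin.natAdd a i) = Fin.natAdd a' (τ i) := by
  simp [blockSum]

@[simp] theorem blockSwap_castAdd (a b : ℕ) (i : Fin a) :
    blockSwap a b (Fin.castAdd b i) = Fin.natAdd b i := by
  simp [blockSwap]

@[simp] theorem blockSwap_natAdd (a b : ℕ) (i : Fin b) :
    blockSwap a b (Fin.natAdd a i) = Fin.castAdd a i := by
  simp [blockSwap]

theorem blockSwap_blockSwap (i : Fin (a + b)) : blockSwap b a (blockSwap a b i) = i := by
  induction i using Fin.addCases <;> simp

theorem blockSum_refl (i : Fin (a + b)) :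
    blockSum (Equiv.refl (Fin a)) (Equiv.refl (Fin b)) i = i := by
  induction i using Fin.addCases <;> simp

theorem blockSum_trans {a'' b'' : ℕ} (σ : Fin a ≃ Fin a') (τ : Fin b ≃ Fin b')
    (σ' : Fin a' ≃ Fin a'') (τ' : Fin b' ≃ Fin b'') (i : Fin (a + b)) :
    blockSum σ' τ' (blockSum σ τ i) = blockSum (σ.trans σ') (τ.trans τ') i := by
  induction i using Fin.addCases <;> simp

theorem blockSum_assoc (σ : Fin a ≃ Fin a') (τ : Fin b ≃ Fin b') (ρ : Fin c ≃ Fin c')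
    (i : Fin (a + b + c)) :
    Fin.cast (Nat.add_assoc _ _ _) (blockSum (blockSum σ τ) ρ i) =
      blockSum σ (blockSum τ ρ) (Fin.cast (Nat.add_assoc _ _ _) i) := by
  induction i using Fin.addCases with
  | left i =>
    induction i using Fin.addCases with
    | left i =>
      have h : Fin.cast (Nat.add_assoc a b c) (Fin.castAdd c (Fin.castAdd b i)) =
        Fin.castAdd (b + c) i := rfl
      rw [h]; ext; simp
    | right i =>
      have h : Fin.cast (Nat.add_assoc a b c) (Fin.castAdd c (Fin.natAdd a i)) =
        Fin.natAdd a (Fin.castAdd c i) := rfl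
      rw [h]; ext; simp
  | right i =>
    have h : Fin.cast (Nat.add_assoc a b c) (Fin.natAdd (a + b) i) =
      Fin.natAdd a (Fin.natAdd b i) := by ext; simp [Nat.add_assoc]
    rw [h]; ext; simp [Nat.add_assoc]

theorem zero_blockSum (τ : Fin b ≃ Fin b') (i : Fin (0 + b)) :
    Fin.cast (Nat.zero_add _) (blockSum (Equiv.refl (Fin 0)) τ i) =
      τ (Fin.cast (Nat.zero_add _) i) := by
  induction i using Fin.addCases with
  | left i => exact i.elim0
  | right i =>
    have h (n : ℕ) (i : Fin n) : Fin.cast (Nat.zero_add n) (Fin.natAdd 0 i) = i := by ext; simp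
    rw [blockSum_natAdd, h, h]

theorem blockSum_zero (σ : Fin a ≃ Fin a') (i : Fin (a + 0)) :
    Fin.cast (Nat.add_zero _) (blockSum σ (Equiv.refl (Fin 0)) i) =
      σ (Fin.cast (Nat.add_zero _) i) := by
  induction i using Fin.addCases with
  | right i => exact i.elim0
  | left i =>
    have h (n : ℕ) (i : Fin n) : Fin.cast (Nat.add_zero n) (Fin.castAdd 0 i) = i := rfl
    rw [blockSum_castAdd, h, h]

theorem blockSum_cast_val (h : a = a') (h' : b = b') (i : Fin (a + b)) :
    (blockSum (finCongr h) (finCongr h') i : ℕ) = i := by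
  subst h h'
  induction i using Fin.addCases <;> simp

theorem blockSwap_natural (σ : Fin a ≃ Fin a') (τ : Fin b ≃ Fin b') (i : Fin (a + b)) :
    blockSwap a' b' (blockSum σ τ i) = blockSum τ σ (blockSwap a b i) := by
  induction i using Fin.addCases <;> simp

theorem blockSwap_hexagon (i : Fin (a + b + c)) :
    (blockSwap a (b + c) (Fin.cast (Nat.add_assoc _ _ _) i) : ℕ) =
      blockSum (Equiv.refl (Fin b)) (blockSwap a c)
        (Fin.cast (Nat.add_assoc _ _ _) (blockSum (blockSwap a b) (Equiv.refl (Fin c)) i)) := by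
  induction i using Fin.addCases with
  | left i =>
    induction i using Fin.addCases with
    | left i =>
      have h : Fin.cast (Nat.add_assoc a b c) (Fin.castAdd c (Fin.castAdd b i)) =
        Fin.castAdd (b + c) i := rfl
      have h' : Fin.cast (Nat.add_assoc b a c) (Fin.castAdd c (Fin.natAdd b i)) =
        Fin.natAdd b (Fin.castAdd c i) := rfl
      simp [h, h', Nat.add_assoc]
    | right i =>
      have h : Fin.cast (Nat.add_assoc a b c) (Fin.castAdd c (Fin.natAdd a i)) =
        Fin.natAdd a (Fin.castAdd c i) := rfl
      have h' : Fin.cast (Nat.add_assoc b a c) (Fin.castAdd c (Fin.castAdd a i)) =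
        Fin.castAdd (a + c) i := rfl
      simp [h, h']
  | right i =>
    have h : Fin.cast (Nat.add_assoc a b c) (Fin.natAdd (a + b) i) =
      Fin.natAdd a (Fin.natAdd b i) := by ext; simp [Nat.add_assoc]
    have h' : Fin.cast (Nat.add_assoc b a c) (Fin.natAdd (b + a) i) =
      Fin.natAdd b (Fin.natAdd a i) := by ext; simp [Nat.add_assoc]
    simp [h, h']

theorem blockSwap_hexagon' (i : Fin (a + (b + c))) :
    (blockSwap (a + b) c (Fin.cast (Nat.add_assoc _ _ _).symm i) : ℕ) =
      blockSum (blockSwap a c) (Equiv.refl (Fin b))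
        (Fin.cast (Nat.add_assoc _ _ _).symm (blockSum (Equiv.refl (Fin a)) (blockSwap b c) i)) := by
  induction i using Fin.addCases with
  | left i =>
    have h : Fin.cast (Nat.add_assoc a b c).symm (Fin.castAdd (b + c) i) =
      Fin.castAdd c (Fin.castAdd b i) := rfl
    have h' : Fin.cast (Nat.add_assoc a c b).symm (Fin.castAdd (c + b) i) =
      Fin.castAdd b (Fin.castAdd c i) := rfl
    simp [h, h']
  | right i =>
    induction i using Fin.addCases with
    | left i =>
      have h : Fin.cast (Nat.add_assoc a b c).symm (Fin.natAdd a (Fin.castAdd c i)) =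
        Fin.castAdd c (Fin.natAdd a i) := rfl
      have h' : Fin.cast (Nat.add_assoc a c b).symm (Fin.natAdd a (Fin.natAdd c i)) =
        Fin.natAdd (a + c) i := by ext; simp [Nat.add_assoc]
      simp [h, h']
      omega
    | right i =>
      have h : Fin.cast (Nat.add_assoc a b c).symm (Fin.natAdd a (Fin.natAdd b i)) =
        Fin.natAdd (a + b) i := by ext; simp [Nat.add_assoc]
      have h' : Fin.cast (Nat.add_assoc a c b).symm (Fin.natAdd a (Fin.castAdd b i)) =
        Fin.castAdd b (Fin.natAdd a i) := rfl
      simp [h, h']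

variable {C : Type u}

theorem append_blockSum (s : Fin a → C) (s' : Fin a' → C) (t : Fin b → C) (t' : Fin b' → C)
    (σ : Fin a ≃ Fin a') (τ : Fin b ≃ Fin b') (hσ : ∀ i, s' (σ i) = s i) (hτ : ∀ i, t' (τ i) = t i)
    (i : Fin (a + b)) : Fin.append s' t' (blockSum σ τ i) = Fin.append s t i := by
  induction i using Fin.addCases <;> simp [hσ, hτ]

theorem append_blockSwap (s : Fin a → C) (t : Fin b → C) (i : Fin (a + b)) :
    Fin.append t s (blockSwap a b i) = Fin.append s t i := by
  induction i using Fin.addCases <;> simp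

end Blocks

/-- Finite sequences `c₁ ⊗ ⋯ ⊗ cₙ` of elements of `C`: the objects of `S(C)`. -/
structure ColorSeq (C : Type u) : Type u where
  len : ℕ
  color : Fin len → C

namespace ColorSeq

variable {C : Type u}

theorem ext_of_color {s t : ColorSeq C} (h : s.len = t.len)
    (h' : ∀ i, t.color (Fin.cast h i) = s.color i) : s = t := by
  obtain ⟨m, a⟩ := s
  obtain ⟨n, b⟩ := t
  obtain rfl : m = n := h
  congr
  funext i
  exact (h' i).symm

/-- A morphism of `S(C)` is a permutation which matches the colors. -/
@[ext]
structure Hom (s t : ColorSeq C) : Type where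
  toEquiv : Fin s.len ≃ Fin t.len
  color_eq : ∀ i, t.color (toEquiv i) = s.color i

instance : Category.{0} (ColorSeq C) where
  Hom := Hom
  id s := ⟨Equiv.refl _, fun _ => rfl⟩
  comp f g := ⟨f.toEquiv.trans g.toEquiv, fun i => by
    rw [Equiv.trans_apply, g.color_eq, f.color_eq]⟩

theorem hom_ext {s t : ColorSeq C} {f g : s ⟶ t} (h : ∀ i, f.toEquiv i = g.toEquiv i) : f = g :=
  Hom.ext (Equiv.ext h)

@[simp] theorem id_toEquiv (s : ColorSeq C) : Hom.toEquiv (𝟙 s) = Equiv.refl _ := rfl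

@[simp] theorem comp_toEquiv {r s t : ColorSeq C} (f : r ⟶ s) (g : s ⟶ t) :
    Hom.toEquiv (f ≫ g) = f.toEquiv.trans g.toEquiv := rfl

/-- The identity permutation as an isomorphism between sequences which agree entry by entry. -/
def castIso {s t : ColorSeq C} (h : s.len = t.len)
    (h' : ∀ i, t.color (Fin.cast h i) = s.color i) : s ≅ t where
  hom := ⟨finCongr h, h'⟩
  inv := ⟨finCongr h.symm, fun i => (h' (Fin.cast h.symm i)).symm⟩

theorem castIso_hom {s t : ColorSeq C} (h : s.len = t.len)
    (h' : ∀ i, t.color (Fin.cast h i) = s.color i) :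
    (castIso h h').hom = eqToHom (ext_of_color h h') := by
  obtain rfl := ext_of_color h h'
  exact hom_ext fun i => rfl

/-- Concatenation of sequences is the tensor product of `S(C)`, block sum of permutations its
action on morphisms, and the empty sequence its unit. -/
instance : MonoidalCategoryStruct (ColorSeq C) where
  tensorObj s t := ⟨s.len + t.len, Fin.append s.color t.color⟩
  tensorHom σ τ := ⟨blockSum σ.toEquiv τ.toEquiv,
    append_blockSum _ _ _ _ _ _ σ.color_eq τ.color_eq⟩
  whiskerLeft _ _ _ τ := ⟨blockSum (Equiv.refl _) τ.toEquiv,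
    append_blockSum _ _ _ _ _ _ (fun _ => rfl) τ.color_eq⟩
  whiskerRight σ _ := ⟨blockSum σ.toEquiv (Equiv.refl _),
    append_blockSum _ _ _ _ _ _ σ.color_eq (fun _ => rfl)⟩
  tensorUnit := ⟨0, Fin.elim0⟩
  associator _ _ _ := castIso (Nat.add_assoc _ _ _) fun i => by
    simp only [Fin.append_assoc, Function.comp]
  leftUnitor s := castIso (Nat.zero_add _) fun i => by
    simp only [Fin.elim0_append, Function.comp]
  rightUnitor s := castIso (Nat.add_zero _) fun i => by
    simp only [Fin.append_elim0, Function.comp]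

instance : MonoidalCategory (ColorSeq C) := MonoidalCategory.ofTensorHom
  (id_tensorHom_id := fun _ _ => hom_ext fun i => blockSum_refl i)
  (id_tensorHom := fun _ _ _ _ => rfl)
  (tensorHom_id := fun _ _ => rfl)
  (tensorHom_comp_tensorHom := fun _ _ _ _ => hom_ext fun i => blockSum_trans _ _ _ _ i)
  (associator_naturality := fun _ _ _ => hom_ext fun i => blockSum_assoc _ _ _ i)
  (leftUnitor_naturality := fun _ => hom_ext fun i => zero_blockSum _ i)
  (rightUnitor_naturality := fun _ => hom_ext fun i => blockSum_zero _ i)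
  (pentagon := fun _ _ _ _ => hom_ext fun i => Fin.ext <|
    (blockSum_cast_val rfl (Nat.add_assoc _ _ _) _).trans
      (blockSum_cast_val (Nat.add_assoc _ _ _) rfl i))
  (triangle := fun X Y => hom_ext fun i => Fin.ext <|
    (blockSum_cast_val (b := 0 + Y.len) rfl (Nat.zero_add _) _).trans
      (blockSum_cast_val (a := X.len + 0) (Nat.add_zero _) rfl i).symm)

/-- The braiding of `S(C)` is given by block permutations. -/
instance : SymmetricCategory (ColorSeq C) where
  braiding s t :=
    { hom := ⟨blockSwap s.len t.len, append_blockSwap _ _⟩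
      inv := ⟨blockSwap t.len s.len, append_blockSwap _ _⟩
      hom_inv_id := hom_ext fun i => blockSwap_blockSwap i
      inv_hom_id := hom_ext fun i => blockSwap_blockSwap i }
  braiding_naturality_left σ _ := hom_ext fun i => blockSwap_natural σ.toEquiv (Equiv.refl _) i
  braiding_naturality_right _ _ _ τ := hom_ext fun i => blockSwap_natural (Equiv.refl _) τ.toEquiv i
  hexagon_forward _ _ _ := hom_ext fun i => Fin.ext <| blockSwap_hexagon i
  hexagon_reverse _ _ _ := hom_ext fun i => Fin.ext <| blockSwap_hexagon' i
  symmetry _ _ := hom_ext fun i => blockSwap_blockSwap i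

/-- The functor `g_* : S(C) ⥤ S(C')` which applies `g : C → C'` to each entry. -/
def map {C' : Type u} (g : C → C') : ColorSeq C ⥤ ColorSeq C' where
  obj s := ⟨s.len, g ∘ s.color⟩
  map σ := ⟨σ.toEquiv, fun i => congrArg g (σ.color_eq i)⟩

theorem append_comp {C' : Type u} (g : C → C') {m n : ℕ} (s : Fin m → C) (t : Fin n → C)
    (i : Fin (m + n)) : Fin.append (g ∘ s) (g ∘ t) i = (g ∘ Fin.append s t) i := by
  induction i using Fin.addCases <;> simp

/-- The empty permutation, from the unit to the image of the unit. -/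
def mapUnit {C' : Type u} (g : C → C') :
    𝟙_ (ColorSeq C') ⟶ (map g).obj (𝟙_ (ColorSeq C)) :=
  ⟨Equiv.refl (Fin 0), fun i => i.elim0⟩

/-- The identity permutation, from `g_* s ⊗ g_* t` to `g_* (s ⊗ t)`. -/
def mapTensor {C' : Type u} (g : C → C') (s t : ColorSeq C) :
    (map g).obj s ⊗ (map g).obj t ⟶ (map g).obj (s ⊗ t) :=
  ⟨Equiv.refl (Fin (s.len + t.len)), fun i => (append_comp g s.color t.color i).symm⟩

/-- `g_*` preserves the tensor product strictly: its structure maps are identity permutations. -/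
instance {C' : Type u} (g : C → C') : (map g).LaxBraided where
  ε := mapUnit g
  μ := mapTensor g
  μ_natural_left _ _ := rfl
  μ_natural_right _ _ := rfl
  associativity X Y Z := hom_ext fun i => Fin.ext <|
    (congrArg Fin.val (blockSum_refl (a := X.len + Y.len) (b := Z.len) i)).trans
      (congrArg Fin.val (blockSum_refl (a := X.len) (b := Y.len + Z.len)
        (Fin.cast (Nat.add_assoc _ _ _) i))).symm
  left_unitality X := hom_ext fun i => Fin.ext <|
    (congrArg Fin.val (blockSum_refl (a := 0) (b := X.len) i)).symm
  right_unitality X := hom_ext fun i => Fin.ext <|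
    (congrArg Fin.val (blockSum_refl (a := X.len) (b := 0) i)).symm
  braided _ _ := hom_ext fun _ => rfl

end ColorSeq

/-- A (small) network model: a set `C` of colors with a lax symmetric monoidal functor
`S(C) ⥤ Cat`. -/
structure NetMod : Type (u + 1) where
  Color : Type u
  model : LaxBraidedFunctor (ColorSeq Color) Cat.{u, u}

namespace NetMod

/-- A morphism `(g, 𝔤)` of network models: a map of colors and a monoidal natural transformation
`𝔤 : F ⟶ g_* ⋙ F'`. -/
structure Hom (F F' : NetMod.{u}) : Type u where
  onColor : F.Color → F'.Color
  trans : F.model.toFunctor ⟶ ColorSeq.map onColor ⋙ F'.model.toFunctor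
  isMonoidal : NatTrans.IsMonoidal trans

attribute [instance] Hom.isMonoidal

open Functor.LaxMonoidal

section

variable {C C' C'' : Type u}

theorem unit_eq (F : ColorSeq C ⥤ Cat.{u, u}) [F.LaxMonoidal] :
    ε F = ε (ColorSeq.map (_root_.id : C → C) ⋙ F) := by
  have h : ε (ColorSeq.map (_root_.id : C → C)) = 𝟙 (𝟙_ (ColorSeq C)) := rfl
  exact ((congrArg (ε F ≫ F.map ·) h).trans
    ((congrArg (ε F ≫ ·) (F.map_id _)).trans (Category.comp_id _))).symm

theorem tensor_eq (F : ColorSeq C ⥤ Cat.{u, u}) [F.LaxMonoidal] (X Y : ColorSeq C) :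
    μ F X Y = μ (ColorSeq.map (_root_.id : C → C) ⋙ F) X Y := by
  have h : μ (ColorSeq.map (_root_.id : C → C)) X Y = 𝟙 (X ⊗ Y) := rfl
  exact ((congrArg (μ F X Y ≫ F.map ·) h).trans
    ((congrArg (μ F X Y ≫ ·) (F.map_id _)).trans (Category.comp_id _))).symm

theorem unit_comp_eq (F : ColorSeq C'' ⥤ Cat.{u, u}) [F.LaxMonoidal] (g : C → C') (g' : C' → C'') :
    ε (ColorSeq.map g ⋙ ColorSeq.map g' ⋙ F) = ε (ColorSeq.map (g' ∘ g) ⋙ F) := by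
  have h : ε (ColorSeq.map g') ≫ (ColorSeq.map g').map (ε (ColorSeq.map g)) =
    ε (ColorSeq.map (g' ∘ g)) := rfl
  refine Eq.trans ?_ (congrArg (ε F ≫ F.map ·) h)
  exact (Category.assoc _ _ _).trans (congrArg (ε F ≫ ·) (F.map_comp _ _).symm)

theorem tensor_comp_eq (F : ColorSeq C'' ⥤ Cat.{u, u}) [F.LaxMonoidal] (g : C → C')
    (g' : C' → C'') (X Y : ColorSeq C) :
    μ (ColorSeq.map g ⋙ ColorSeq.map g' ⋙ F) X Y = μ (ColorSeq.map (g' ∘ g) ⋙ F) X Y := by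
  have h : μ (ColorSeq.map g') ((ColorSeq.map g).obj X) ((ColorSeq.map g).obj Y) ≫
      (ColorSeq.map g').map (μ (ColorSeq.map g) X Y) = μ (ColorSeq.map (g' ∘ g)) X Y := rfl
  refine Eq.trans ?_ (congrArg (μ F _ _ ≫ F.map ·) h)
  exact (Category.assoc _ _ _).trans (congrArg (μ F _ _ ≫ ·) (F.map_comp _ _).symm)

end

/-- The composite `(g', 𝔤') ∘ (g, 𝔤)` has components `𝔤'_{g_* x} ∘ 𝔤_x`. -/
instance : Category.{u} NetMod.{u} where
  Hom := Hom
  id F :=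
    { onColor := _root_.id
      trans := 𝟙 F.model.toFunctor
      isMonoidal :=
        { unit := (Category.comp_id _).trans (unit_eq F.model.toFunctor)
          tensor := fun X Y => by
            refine (Category.comp_id _).trans ((tensor_eq F.model.toFunctor X Y).trans ?_)
            exact (Category.id_comp _).symm.trans (congrArg (· ≫ _) (id_tensorHom_id _ _).symm) } }
  comp {F F' F''} p q :=
    { onColor := q.onColor ∘ p.onColor
      trans := p.trans ≫ Functor.whiskerLeft (ColorSeq.map p.onColor) q.trans
      isMonoidal := by
        have h := NatTrans.IsMonoidal.comp p.trans
          (Functor.whiskerLeft (ColorSeq.map p.onColor) q.trans)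
        exact
          { unit := h.unit.trans (unit_comp_eq F''.model.toFunctor p.onColor q.onColor)
            tensor := fun X Y => (h.tensor X Y).trans (congrArg (_ ≫ ·)
              (tensor_comp_eq F''.model.toFunctor p.onColor q.onColor X Y)) } }
  id_comp p := by
    obtain ⟨g, t, h⟩ := p
    change Hom.mk g _ _ = Hom.mk g _ _
    congr 1
  comp_id p := by
    obtain ⟨g, t, h⟩ := p
    change Hom.mk g _ _ = Hom.mk g _ _
    congr 1
  assoc _ _ _ := rfl

end NetMod

namespace MonGroth

open Functor.LaxMonoidal

universe v₁ u₁ v₂ u₂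

variable {C : Type u₁} [Category.{v₁} C] (F : C ⥤ Cat.{v₂, u₂})

/-- The image of the object `x` of `F c` under `F f`. -/
def push {c d : C} (f : c ⟶ d) (x : F.obj c) : F.obj d := (F.map f).toFunctor.obj x

/-- The image of the morphism `a` of `F c` under `F f`. -/
def pushHom {c d : C} (f : c ⟶ d) {x y : F.obj c} (a : x ⟶ y) : push F f x ⟶ push F f y :=
  (F.map f).toFunctor.map a

theorem push_id {c : C} (x : F.obj c) : push F (𝟙 c) x = x := by simp [push]

theorem push_comp {c d e : C} (f : c ⟶ d) (g : d ⟶ e) (x : F.obj c) :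
    push F (f ≫ g) x = push F g (push F f x) := by simp [push]

theorem pushHom_comp {c d : C} (f : c ⟶ d) {x y z : F.obj c} (a : x ⟶ y) (b : y ⟶ z) :
    pushHom F f (a ≫ b) = pushHom F f a ≫ pushHom F f b :=
  (F.map f).toFunctor.map_comp a b

theorem pushHom_eqToHom {c d : C} (f : c ⟶ d) {x y : F.obj c} (h : x = y) :
    pushHom F f (eqToHom h) = eqToHom (by rw [h]) := by
  subst h
  exact (F.map f).toFunctor.map_id x

section Mk

variable {F}

/-- The morphism `(f, a) : (c, x) ⟶ (d, y)` of `∫ F`. -/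
def mk {c d : C} {x : F.obj c} {y : F.obj d} (f : c ⟶ d) (a : push F f x ⟶ y) :
    (⟨c, x⟩ : Grothendieck F) ⟶ ⟨d, y⟩ :=
  ⟨f, a⟩

theorem mk_comp {c d e : C} {x : F.obj c} {y : F.obj d} {z : F.obj e} (f : c ⟶ d)
    (a : push F f x ⟶ y) (g : d ⟶ e) (b : push F g y ⟶ z) :
    mk f a ≫ mk g b = mk (f ≫ g) (eqToHom (push_comp F f g x) ≫ pushHom F g a ≫ b) := rfl

theorem mk_id {c : C} (x : F.obj c) :
    𝟙 (⟨c, x⟩ : Grothendieck F) = mk (𝟙 c) (eqToHom (push_id F x)) := rfl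

theorem mk_congr {c d : C} {x : F.obj c} {y : F.obj d} {f g : c ⟶ d} {a : push F f x ⟶ y}
    {b : push F g x ⟶ y} (h : f = g) (h' : a = eqToHom (by rw [h]) ≫ b) : mk f a = mk g b := by
  subst h
  rw [h', eqToHom_refl, Category.id_comp]

/-- The isomorphism `(f, 1)` of `∫ F`, for an isomorphism `f` with `F f (x) = y`. -/
def isoMk {c d : C} {x : F.obj c} {y : F.obj d} (f : c ≅ d) (h : push F f.hom x = y) :
    (⟨c, x⟩ : Grothendieck F) ≅ ⟨d, y⟩ where
  hom := mk f.hom (eqToHom h)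
  inv := mk f.inv (eqToHom (by rw [← h, ← push_comp, f.hom_inv_id, push_id]))
  hom_inv_id := by
    rw [mk_comp, mk_id]
    exact mk_congr f.hom_inv_id (by simp [pushHom_eqToHom])
  inv_hom_id := by
    rw [mk_comp, mk_id]
    exact mk_congr f.inv_hom_id (by simp [pushHom_eqToHom])

theorem obj_eq {c d : C} {x : F.obj c} {y : F.obj d} (h : c = d) (h' : push F (eqToHom h) x = y) :
    (⟨c, x⟩ : Grothendieck F) = ⟨d, y⟩ := by
  subst h
  rw [← h', eqToHom_refl, push_id]

theorem mk_eqToHom {c d : C} {x : F.obj c} {y : F.obj d} {f : c ⟶ d} (h : c = d)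
    (hf : f = eqToHom h) (h' : push F f x = y) :
    mk f (eqToHom h') = eqToHom (obj_eq h (by rw [← hf, h'])) := by
  subst h hf
  obtain rfl := (push_id F x).symm.trans h'
  exact (mk_id x).symm

end Mk

variable [MonoidalCategory C] [F.LaxMonoidal]

/-- The object `Φ(x, y)` of `F (c ⊗ d)`, with `Φ` the laxator of `F`. -/
def pair {c d : C} (x : F.obj c) (y : F.obj d) : F.obj (c ⊗ d) :=
  (μ F c d).toFunctor.obj (x, y)

/-- The morphism `Φ(a, b)` of `F (c ⊗ d)`. -/
def pairHom {c d : C} {x x' : F.obj c} {y y' : F.obj d} (a : x ⟶ x') (b : y ⟶ y') :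
    pair F x y ⟶ pair F x' y' :=
  (μ F c d).toFunctor.map (X := (x, y)) (Y := (x', y')) (Prod.mkHom a b)

/-- The object `φ` of `F I`, given by the unit of the lax structure of `F`. -/
def unit : F.obj (𝟙_ C) := (ε F).toFunctor.obj ⟨⟨⟨⟩⟩⟩

theorem pairHom_comp {c d : C} {x x' x'' : F.obj c} {y y' y'' : F.obj d} (a : x ⟶ x') (b : y ⟶ y')
    (a' : x' ⟶ x'') (b' : y' ⟶ y'') :
    pairHom F (a ≫ a') (b ≫ b') = pairHom F a b ≫ pairHom F a' b' :=
  (μ F c d).toFunctor.map_comp (X := (x, y)) (Y := (x', y')) (Z := (x'', y''))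
    (Prod.mkHom a b) (Prod.mkHom a' b')

theorem pairHom_eqToHom {c d : C} {x x' : F.obj c} {y y' : F.obj d} (h : x = x') (h' : y = y') :
    pairHom F (eqToHom h) (eqToHom h') = eqToHom (by rw [h, h']) := by
  subst h h'
  exact (μ F c d).toFunctor.map_id (x, y)

theorem eqToHom_pairHom_left {c d : C} {x x' x'' : F.obj c} {y y' : F.obj d} (h : x = x')
    (a : x' ⟶ x'') (b : y ⟶ y') :
    pairHom F (eqToHom h ≫ a) b = eqToHom (by rw [h]) ≫ pairHom F a b := by
  subst h; simp

theorem eqToHom_pairHom_right {c d : C} {x x' : F.obj c} {y y' y'' : F.obj d} (h : y = y')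
    (a : x ⟶ x') (b : y' ⟶ y'') :
    pairHom F a (eqToHom h ≫ b) = eqToHom (by rw [h]) ≫ pairHom F a b := by
  subst h; simp

theorem push_pair {c c' d d' : C} (f : c ⟶ c') (g : d ⟶ d') (x : F.obj c) (y : F.obj d) :
    push F (f ⊗ₘ g) (pair F x y) = pair F (push F f x) (push F g y) :=
  (Functor.congr_obj (congrArg Cat.Hom.toFunctor (μ_natural F f g)) (x, y)).symm

theorem pushHom_pairHom {c c' d d' : C} (f : c ⟶ c') (g : d ⟶ d') {x x' : F.obj c} {y y' : F.obj d}
    (a : x ⟶ x') (b : y ⟶ y') :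
    pushHom F (f ⊗ₘ g) (pairHom F a b) = eqToHom (push_pair F f g x y) ≫
      pairHom F (pushHom F f a) (pushHom F g b) ≫ eqToHom (push_pair F f g x' y').symm :=
  Functor.congr_hom (congrArg Cat.Hom.toFunctor (μ_natural F f g).symm)
    (X := (x, y)) (Y := (x', y')) (Prod.mkHom a b)

theorem push_assoc {c d e : C} (x : F.obj c) (y : F.obj d) (z : F.obj e) :
    push F (α_ c d e).hom (pair F (pair F x y) z) = pair F x (pair F y z) :=
  Functor.congr_obj (congrArg Cat.Hom.toFunctor (associativity F c d e)) ((x, y), z)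

theorem pushHom_assoc {c d e : C} {x x' : F.obj c} {y y' : F.obj d} {z z' : F.obj e}
    (a : x ⟶ x') (b : y ⟶ y') (g : z ⟶ z') :
    pushHom F (α_ c d e).hom (pairHom F (pairHom F a b) g) = eqToHom (push_assoc F x y z) ≫
      pairHom F a (pairHom F b g) ≫ eqToHom (push_assoc F x' y' z').symm :=
  Functor.congr_hom (congrArg Cat.Hom.toFunctor (associativity F c d e))
    (X := ((x, y), z)) (Y := ((x', y'), z')) (Prod.mkHom (Prod.mkHom a b) g)

theorem push_left {c : C} (x : F.obj c) : push F (λ_ c).hom (pair F (unit F) x) = x :=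
  Functor.congr_obj (congrArg Cat.Hom.toFunctor (left_unitality F c).symm) (⟨⟨⟨⟩⟩⟩, x)

theorem push_right {c : C} (x : F.obj c) : push F (ρ_ c).hom (pair F x (unit F)) = x :=
  Functor.congr_obj (congrArg Cat.Hom.toFunctor (right_unitality F c).symm) (x, ⟨⟨⟨⟩⟩⟩)

theorem pushHom_left {c : C} {u : F.obj (𝟙_ C)} (h : u = unit F) {x x' : F.obj c} (a : x ⟶ x') :
    pushHom F (λ_ c).hom (pairHom F (eqToHom h) a) =
      eqToHom (by rw [h, push_left]) ≫ a ≫ eqToHom (push_left F x').symm := by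
  subst h
  have := Functor.congr_hom (congrArg Cat.Hom.toFunctor (left_unitality F c).symm)
    (X := (⟨⟨⟨⟩⟩⟩, x)) (Y := (⟨⟨⟨⟩⟩⟩, x')) (Prod.mkHom (𝟙 _) a)
  refine Eq.trans ?_ this
  refine congrArg (pushHom F (λ_ c).hom) ?_
  exact congrArg (fun t => pairHom F t a) ((ε F).toFunctor.map_id _).symm

theorem pushHom_right {c : C} {u : F.obj (𝟙_ C)} (h : u = unit F) {x x' : F.obj c} (a : x ⟶ x') :
    pushHom F (ρ_ c).hom (pairHom F a (eqToHom h)) =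
      eqToHom (by rw [h, push_right]) ≫ a ≫ eqToHom (push_right F x').symm := by
  subst h
  have := Functor.congr_hom (congrArg Cat.Hom.toFunctor (right_unitality F c).symm)
    (X := (x, ⟨⟨⟨⟩⟩⟩)) (Y := (x', ⟨⟨⟨⟩⟩⟩)) (Prod.mkHom a (𝟙 _))
  refine Eq.trans ?_ this
  refine congrArg (pushHom F (ρ_ c).hom) ?_
  exact congrArg (fun t => pairHom F a t) ((ε F).toFunctor.map_id _).symm

/-- The action of the tensor product of `∫ F` on morphisms,
`(f, a) ⊗ (g, b) = (f ⊗ g, Φ(a, b))`. -/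
def tensorHom {X Y X' Y' : Grothendieck F} (f : X ⟶ Y) (g : X' ⟶ Y') :
    (⟨X.base ⊗ X'.base, pair F X.fiber X'.fiber⟩ : Grothendieck F) ⟶
      ⟨Y.base ⊗ Y'.base, pair F Y.fiber Y'.fiber⟩ :=
  mk (f.base ⊗ₘ g.base)
    (eqToHom (push_pair F f.base g.base X.fiber X'.fiber) ≫ pairHom F f.fiber g.fiber)

/-- On objects, `(c, x) ⊗ (d, y) = (c ⊗ d, Φ(x, y))`; the unit is `(I, φ)`. -/
instance : MonoidalCategoryStruct (Grothendieck F) where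
  tensorObj X Y := ⟨X.base ⊗ Y.base, pair F X.fiber Y.fiber⟩
  tensorHom := tensorHom F
  whiskerLeft X _ _ f := tensorHom F (𝟙 X) f
  whiskerRight f X := tensorHom F f (𝟙 X)
  tensorUnit := ⟨𝟙_ C, unit F⟩
  associator X Y Z := isoMk (α_ X.base Y.base Z.base) (push_assoc F X.fiber Y.fiber Z.fiber)
  leftUnitor X := isoMk (λ_ X.base) (push_left F X.fiber)
  rightUnitor X := isoMk (ρ_ X.base) (push_right F X.fiber)

variable {F}

theorem mk_tensorHom {c d c' d' : C} {x : F.obj c} {y : F.obj d} {x' : F.obj c'} {y' : F.obj d'}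
    (f : c ⟶ d) (a : push F f x ⟶ y) (g : c' ⟶ d') (b : push F g x' ⟶ y') :
    tensorHom F (mk f a) (mk g b) =
      mk (f ⊗ₘ g) (eqToHom (push_pair F f g x x') ≫ pairHom F a b) := rfl

theorem tensorHom_comp {c d e c' d' e' : C} {x : F.obj c} {y : F.obj d} {z : F.obj e}
    {x' : F.obj c'} {y' : F.obj d'} {z' : F.obj e'} (f : c ⟶ d) (a : push F f x ⟶ y)
    (f' : c' ⟶ d') (a' : push F f' x' ⟶ y') (g : d ⟶ e) (b : push F g y ⟶ z)
    (g' : d' ⟶ e') (b' : push F g' y' ⟶ z') :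
    tensorHom F (mk f a) (mk f' a') ≫ tensorHom F (mk g b) (mk g' b') =
      tensorHom F (mk f a ≫ mk g b) (mk f' a' ≫ mk g' b') := by
  simp only [mk_comp, mk_tensorHom]
  refine mk_congr (by simp) ?_
  simp [pushHom_comp, pushHom_eqToHom, pushHom_pairHom, pairHom_comp, pairHom_eqToHom]

theorem associator_naturality {c d c' d' c'' d'' : C} {x : F.obj c} {y : F.obj d}
    {x' : F.obj c'} {y' : F.obj d'} {x'' : F.obj c''} {y'' : F.obj d''} (f : c ⟶ d)
    (a : push F f x ⟶ y) (f' : c' ⟶ d') (a' : push F f' x' ⟶ y') (f'' : c'' ⟶ d'')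
    (a'' : push F f'' x'' ⟶ y'') :
    tensorHom F (tensorHom F (mk f a) (mk f' a')) (mk f'' a'') ≫
        mk (α_ d d' d'').hom (eqToHom (push_assoc F y y' y'')) =
      mk (α_ c c' c'').hom (eqToHom (push_assoc F x x' x'')) ≫
        tensorHom F (mk f a) (tensorHom F (mk f' a') (mk f'' a'')) := by
  simp only [mk_tensorHom, mk_comp]
  refine mk_congr (by simp) ?_
  simp [pushHom_comp, pushHom_eqToHom, pushHom_assoc, eqToHom_pairHom_left, eqToHom_pairHom_right]

theorem leftUnitor_naturality {c d : C} {x : F.obj c} {y : F.obj d} (f : c ⟶ d)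
    (a : push F f x ⟶ y) :
    tensorHom F (mk (𝟙 (𝟙_ C)) (eqToHom (push_id F (unit F)))) (mk f a) ≫
        mk (λ_ d).hom (eqToHom (push_left F y)) =
      mk (λ_ c).hom (eqToHom (push_left F x)) ≫ mk f a := by
  simp only [mk_tensorHom, mk_comp]
  refine mk_congr (by simp) ?_
  simp [pushHom_comp, pushHom_eqToHom, pushHom_left]

theorem rightUnitor_naturality {c d : C} {x : F.obj c} {y : F.obj d} (f : c ⟶ d)
    (a : push F f x ⟶ y) :
    tensorHom F (mk f a) (mk (𝟙 (𝟙_ C)) (eqToHom (push_id F (unit F)))) ≫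
        mk (ρ_ d).hom (eqToHom (push_right F y)) =
      mk (ρ_ c).hom (eqToHom (push_right F x)) ≫ mk f a := by
  simp only [mk_tensorHom, mk_comp]
  refine mk_congr (by simp) ?_
  simp [pushHom_comp, pushHom_eqToHom, pushHom_right]

instance : MonoidalCategory (Grothendieck F) := MonoidalCategory.ofTensorHom
  (id_tensorHom_id := fun X Y => by
    change tensorHom F (mk (𝟙 X.base) (eqToHom (push_id F X.fiber)))
      (mk (𝟙 Y.base) (eqToHom (push_id F Y.fiber))) = mk (𝟙 _) (eqToHom (push_id F _))
    rw [mk_tensorHom]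
    exact mk_congr (by simp) (by simp [pairHom_eqToHom]))
  (id_tensorHom := fun _ _ _ _ => rfl)
  (tensorHom_id := fun _ _ => rfl)
  (tensorHom_comp_tensorHom := fun f f' g g' =>
    tensorHom_comp f.base f.fiber f'.base f'.fiber g.base g.fiber g'.base g'.fiber)
  (associator_naturality := fun f f' f'' =>
    associator_naturality f.base f.fiber f'.base f'.fiber f''.base f''.fiber)
  (leftUnitor_naturality := fun f => leftUnitor_naturality f.base f.fiber)
  (rightUnitor_naturality := fun f => rightUnitor_naturality f.base f.fiber)
  (pentagon := fun W X Y Z => by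
    change tensorHom F (mk (α_ W.base X.base Y.base).hom
          (eqToHom (push_assoc F W.fiber X.fiber Y.fiber)))
          (mk (𝟙 Z.base) (eqToHom (push_id F Z.fiber))) ≫
        mk (α_ W.base (X.base ⊗ Y.base) Z.base).hom (eqToHom (push_assoc F _ _ _)) ≫
        tensorHom F (mk (𝟙 W.base) (eqToHom (push_id F W.fiber)))
          (mk (α_ X.base Y.base Z.base).hom (eqToHom (push_assoc F X.fiber Y.fiber Z.fiber))) =
      mk (α_ (W.base ⊗ X.base) Y.base Z.base).hom (eqToHom (push_assoc F _ _ _)) ≫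
        mk (α_ W.base X.base (Y.base ⊗ Z.base)).hom (eqToHom (push_assoc F _ _ _))
    simp only [mk_tensorHom, mk_comp]
    exact mk_congr (by simp) (by simp [pushHom_eqToHom, pairHom_eqToHom]))
  (triangle := fun X Y => by
    change mk (α_ X.base (𝟙_ C) Y.base).hom (eqToHom (push_assoc F _ _ _)) ≫
        tensorHom F (mk (𝟙 X.base) (eqToHom (push_id F X.fiber)))
          (mk (λ_ Y.base).hom (eqToHom (push_left F Y.fiber))) =
      tensorHom F (mk (ρ_ X.base).hom (eqToHom (push_right F X.fiber)))
        (mk (𝟙 Y.base) (eqToHom (push_id F Y.fiber)))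
    simp only [mk_tensorHom, mk_comp]
    exact mk_congr (by simp) (by simp [pushHom_eqToHom, pairHom_eqToHom]))

end MonGroth

/-- A monoidal category is strict if its associators and unitors are identities. -/
class IsStrictMonoidal (C : Type*) [Category* C] [MonoidalCategory C] : Prop where
  tensor_assoc : ∀ X Y Z : C, (X ⊗ Y) ⊗ Z = X ⊗ (Y ⊗ Z)
  unit_tensor : ∀ X : C, 𝟙_ C ⊗ X = X
  tensor_unit : ∀ X : C, X ⊗ 𝟙_ C = X
  associator_hom : ∀ X Y Z : C, (α_ X Y Z).hom = eqToHom (tensor_assoc X Y Z)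
  leftUnitor_hom : ∀ X : C, (λ_ X).hom = eqToHom (unit_tensor X)
  rightUnitor_hom : ∀ X : C, (ρ_ X).hom = eqToHom (tensor_unit X)

instance (C : Type u) : IsStrictMonoidal (ColorSeq C) where
  tensor_assoc _ _ _ := ColorSeq.ext_of_color (Nat.add_assoc _ _ _) fun i =>
    (congrFun (Fin.append_assoc _ _ _) i).symm
  unit_tensor _ := ColorSeq.ext_of_color (Nat.zero_add _) fun i =>
    (congrFun (Fin.elim0_append _) i).symm
  tensor_unit _ := ColorSeq.ext_of_color (Nat.add_zero _) fun i =>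
    (congrFun (Fin.append_elim0 _) i).symm
  associator_hom _ _ _ := ColorSeq.castIso_hom _ _
  leftUnitor_hom _ := ColorSeq.castIso_hom _ _
  rightUnitor_hom _ := ColorSeq.castIso_hom _ _

/-- A functor between strict symmetric monoidal categories is strict symmetric monoidal if it
preserves unit, tensor products and braidings on the nose. -/
structure IsStrictSymmetric {C D : Type*} [Category* C] [Category* D] [MonoidalCategory C]
    [MonoidalCategory D] [SymmetricCategory C] [SymmetricCategory D] (G : C ⥤ D) : Prop where
  obj_unit : G.obj (𝟙_ C) = 𝟙_ D
  obj_tensor : ∀ X Y : C, G.obj (X ⊗ Y) = G.obj X ⊗ G.obj Y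
  map_tensor : ∀ {X Y X' Y' : C} (f : X ⟶ Y) (g : X' ⟶ Y'),
    G.map (f ⊗ₘ g) = eqToHom (obj_tensor X X') ≫ (G.map f ⊗ₘ G.map g) ≫
      eqToHom (obj_tensor Y Y').symm
  map_braiding : ∀ X Y : C, G.map (β_ X Y).hom =
    eqToHom (obj_tensor X Y) ≫ (β_ (G.obj X) (G.obj Y)).hom ≫ eqToHom (obj_tensor Y X).symm

namespace IsStrictSymmetric

theorem id (C : Type*) [Category* C] [MonoidalCategory C] [SymmetricCategory C] :
    IsStrictSymmetric (𝟭 C) where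
  obj_unit := rfl
  obj_tensor _ _ := rfl
  map_tensor _ _ := by simp
  map_braiding _ _ := by simp

theorem comp {C D E : Type*} [Category* C] [Category* D] [Category* E] [MonoidalCategory C]
    [MonoidalCategory D] [MonoidalCategory E] [SymmetricCategory C] [SymmetricCategory D]
    [SymmetricCategory E] {G : C ⥤ D} {H : D ⥤ E} (hG : IsStrictSymmetric G)
    (hH : IsStrictSymmetric H) : IsStrictSymmetric (G ⋙ H) where
  obj_unit := (congrArg H.obj hG.obj_unit).trans hH.obj_unit
  obj_tensor X Y := (congrArg H.obj (hG.obj_tensor X Y)).trans (hH.obj_tensor _ _)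
  map_tensor f g := by
    simp [hG.map_tensor, hH.map_tensor, eqToHom_map]
  map_braiding X Y := by
    simp [hG.map_braiding, hH.map_braiding, eqToHom_map]

end IsStrictSymmetric

/-- Small strict symmetric monoidal categories. -/
structure SSMC : Type (u + 1) where
  carrier : Type u
  [category : Category.{u} carrier]
  [monoidal : MonoidalCategory carrier]
  [symmetric : SymmetricCategory carrier]
  [strict : IsStrictMonoidal carrier]

namespace SSMC

attribute [instance] category monoidal symmetric strict

/-- Strict symmetric monoidal functors. -/
@[ext]
structure Hom (C D : SSMC.{u}) : Type u where
  functor : C.carrier ⥤ D.carrier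
  isStrict : IsStrictSymmetric functor

instance : Category.{u} SSMC.{u} where
  Hom := Hom
  id C := ⟨𝟭 C.carrier, IsStrictSymmetric.id _⟩
  comp G H := ⟨G.functor ⋙ H.functor, G.isStrict.comp H.isStrict⟩

end SSMC

namespace MonGroth

universe v₁ u₁ v₂ u₂

variable {C : Type u₁} [Category.{v₁} C] [MonoidalCategory C] [SymmetricCategory C]
  (F : C ⥤ Cat.{v₂, u₂}) [F.LaxBraided]

theorem push_braid {c d : C} (x : F.obj c) (y : F.obj d) :
    push F (β_ c d).hom (pair F x y) = pair F y x :=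
  Functor.congr_obj (congrArg Cat.Hom.toFunctor (Functor.LaxBraided.braided (F := F) c d)) (x, y)

theorem pushHom_braid {c d : C} {x x' : F.obj c} {y y' : F.obj d} (a : x ⟶ x') (b : y ⟶ y') :
    pushHom F (β_ c d).hom (pairHom F a b) = eqToHom (push_braid F x y) ≫ pairHom F b a ≫
      eqToHom (push_braid F x' y').symm :=
  Functor.congr_hom (congrArg Cat.Hom.toFunctor (Functor.LaxBraided.braided (F := F) c d))
    (X := (x, y)) (Y := (x', y')) (Prod.mkHom a b)

variable {F}

theorem braiding_naturality {c d c' d' : C} {x : F.obj c} {y : F.obj d}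
    {x' : F.obj c'} {y' : F.obj d'} (f : c ⟶ d) (a : push F f x ⟶ y)
    (f' : c' ⟶ d') (a' : push F f' x' ⟶ y') :
    tensorHom F (mk f a) (mk f' a') ≫ mk (β_ d d').hom (eqToHom (push_braid F y y')) =
      mk (β_ c c').hom (eqToHom (push_braid F x x')) ≫ tensorHom F (mk f' a') (mk f a) := by
  simp only [mk_tensorHom, mk_comp]
  exact mk_congr (by simp) (by simp [pushHom_comp, pushHom_eqToHom, pushHom_braid])

/-- The braiding of `∫ F` is `(B, 1)`, with `B` the braiding of `C`. -/
instance : SymmetricCategory (Grothendieck F) where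
  braiding X Y := isoMk (β_ X.base Y.base) (push_braid F X.fiber Y.fiber)
  braiding_naturality_left f Z :=
    braiding_naturality f.base f.fiber (𝟙 Z.base) (eqToHom (push_id F Z.fiber))
  braiding_naturality_right X _ _ f :=
    braiding_naturality (𝟙 X.base) (eqToHom (push_id F X.fiber)) f.base f.fiber
  hexagon_forward X Y Z := by
    change mk (α_ X.base Y.base Z.base).hom (eqToHom (push_assoc F _ _ _)) ≫
        mk (β_ X.base (Y.base ⊗ Z.base)).hom
          (eqToHom (push_braid F X.fiber (pair F Y.fiber Z.fiber))) ≫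
        mk (α_ Y.base Z.base X.base).hom (eqToHom (push_assoc F _ _ _)) =
      tensorHom F (mk (β_ X.base Y.base).hom (eqToHom (push_braid F X.fiber Y.fiber)))
          (mk (𝟙 Z.base) (eqToHom (push_id F Z.fiber))) ≫
        mk (α_ Y.base X.base Z.base).hom (eqToHom (push_assoc F _ _ _)) ≫
        tensorHom F (mk (𝟙 Y.base) (eqToHom (push_id F Y.fiber)))
          (mk (β_ X.base Z.base).hom (eqToHom (push_braid F X.fiber Z.fiber)))
    simp only [mk_tensorHom, mk_comp]
    exact mk_congr (by simp) (by simp [pushHom_eqToHom, pairHom_eqToHom])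
  hexagon_reverse X Y Z := by
    change mk (α_ X.base Y.base Z.base).inv (eqToHom _) ≫
        mk (β_ (X.base ⊗ Y.base) Z.base).hom
          (eqToHom (push_braid F (pair F X.fiber Y.fiber) Z.fiber)) ≫
        mk (α_ Z.base X.base Y.base).inv (eqToHom _) =
      tensorHom F (mk (𝟙 X.base) (eqToHom (push_id F X.fiber)))
          (mk (β_ Y.base Z.base).hom (eqToHom (push_braid F Y.fiber Z.fiber))) ≫
        mk (α_ X.base Z.base Y.base).inv (eqToHom _) ≫
        tensorHom F (mk (β_ X.base Z.base).hom (eqToHom (push_braid F X.fiber Z.fiber)))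
          (mk (𝟙 Y.base) (eqToHom (push_id F Y.fiber)))
    simp only [mk_tensorHom, mk_comp]
    exact mk_congr (by simp) (by simp [pushHom_eqToHom, pairHom_eqToHom])
  symmetry X Y := by
    change mk (β_ X.base Y.base).hom (eqToHom (push_braid F X.fiber Y.fiber)) ≫
      mk (β_ Y.base X.base).hom (eqToHom (push_braid F Y.fiber X.fiber)) =
      mk (𝟙 (X.base ⊗ Y.base)) (eqToHom (push_id F _))
    simp only [mk_comp]
    exact mk_congr (by simp) (by simp [pushHom_eqToHom])

instance [IsStrictMonoidal C] : IsStrictMonoidal (Grothendieck F) where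
  tensor_assoc X Y Z := obj_eq (IsStrictMonoidal.tensor_assoc _ _ _) (by
    rw [← IsStrictMonoidal.associator_hom]; exact push_assoc F _ _ _)
  unit_tensor X := obj_eq (IsStrictMonoidal.unit_tensor _) (by
    rw [← IsStrictMonoidal.leftUnitor_hom]; exact push_left F _)
  tensor_unit X := obj_eq (IsStrictMonoidal.tensor_unit _) (by
    rw [← IsStrictMonoidal.rightUnitor_hom]; exact push_right F _)
  associator_hom X Y Z := mk_eqToHom _ (IsStrictMonoidal.associator_hom _ _ _) _
  leftUnitor_hom X := mk_eqToHom _ (IsStrictMonoidal.leftUnitor_hom _) _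
  rightUnitor_hom X := mk_eqToHom _ (IsStrictMonoidal.rightUnitor_hom _) _

end MonGroth

namespace NetMod

/-- The strict symmetric monoidal category `∫ F` of a network model. -/
def integral (F : NetMod.{u}) : SSMC.{u} where
  carrier := Grothendieck F.model.toFunctor

end NetMod

namespace MonGroth

open Functor.LaxMonoidal

universe v₁ u₁ v₂ u₂ v₃ u₃

variable {C : Type u₁} [Category.{v₁} C] {C' : Type u₃} [Category.{v₃} C']
  {F : C ⥤ Cat.{v₂, u₂}} {F' : C' ⥤ Cat.{v₂, u₂}} {G : C ⥤ C'} (g : F ⟶ G ⋙ F')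

/-- The object `𝔤_c x` of `F' (G c)`. -/
def app {c : C} (x : F.obj c) : F'.obj (G.obj c) := (g.app c).toFunctor.obj x

/-- The morphism `𝔤_c a` of `F' (G c)`. -/
def appHom {c : C} {x y : F.obj c} (a : x ⟶ y) : app g x ⟶ app g y := (g.app c).toFunctor.map a

theorem appHom_comp {c : C} {x y z : F.obj c} (a : x ⟶ y) (b : y ⟶ z) :
    appHom g (a ≫ b) = appHom g a ≫ appHom g b := (g.app c).toFunctor.map_comp a b

theorem appHom_eqToHom {c : C} {x y : F.obj c} (h : x = y) :
    appHom g (eqToHom h) = eqToHom (by rw [h]) := by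
  subst h
  exact (g.app c).toFunctor.map_id x

theorem push_app {c d : C} (f : c ⟶ d) (x : F.obj c) :
    push F' (G.map f) (app g x) = app g (push F f x) :=
  (Functor.congr_obj (congrArg Cat.Hom.toFunctor (g.naturality f)) x).symm

theorem pushHom_app {c d : C} (f : c ⟶ d) {x y : F.obj c} (a : x ⟶ y) :
    pushHom F' (G.map f) (appHom g a) =
      eqToHom (push_app g f x) ≫ appHom g (pushHom F f a) ≫ eqToHom (push_app g f y).symm :=
  Functor.congr_hom (congrArg Cat.Hom.toFunctor (g.naturality f).symm) a

/-- The image `(G f, 𝔤_d a)` of `(f, a) : (c, x) ⟶ (d, y)`. -/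
def hatMap {c d : C} {x : F.obj c} {y : F.obj d} (f : c ⟶ d) (a : push F f x ⟶ y) :
    (⟨G.obj c, app g x⟩ : Grothendieck F') ⟶ ⟨G.obj d, app g y⟩ :=
  mk (G.map f) (eqToHom (push_app g f x) ≫ appHom g a)

theorem hatMap_id {c : C} (x : F.obj c) :
    hatMap g (𝟙 c) (eqToHom (push_id F x)) = 𝟙 (⟨G.obj c, app g x⟩ : Grothendieck F') := by
  rw [hatMap, mk_id]
  exact mk_congr (G.map_id c) (by simp [appHom_eqToHom])

theorem hatMap_comp {c d e : C} {x : F.obj c} {y : F.obj d} {z : F.obj e} (f : c ⟶ d)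
    (a : push F f x ⟶ y) (f' : d ⟶ e) (b : push F f' y ⟶ z) :
    hatMap g (f ≫ f') (eqToHom (push_comp F f f' x) ≫ pushHom F f' a ≫ b) =
      hatMap g f a ≫ hatMap g f' b := by
  simp only [hatMap, mk_comp]
  exact mk_congr (G.map_comp _ _) (by
    simp [appHom_comp, appHom_eqToHom, pushHom_comp, pushHom_eqToHom, pushHom_app])

/-- The functor `Ĝ : ∫ F ⥤ ∫ F'` of a pair `(G, 𝔤)`, with `Ĝ (c, x) = (G c, 𝔤_c x)` and
`Ĝ (f, a) = (G f, 𝔤_d a)` for `(f, a) : (c, x) ⟶ (d, y)`. -/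
def hat : Grothendieck F ⥤ Grothendieck F' where
  obj X := ⟨G.obj X.base, app g X.fiber⟩
  map f := hatMap g f.base f.fiber
  map_id X := hatMap_id g X.fiber
  map_comp p q := hatMap_comp g p.base p.fiber q.base q.fiber

variable [MonoidalCategory C] [MonoidalCategory C'] [F.LaxMonoidal] [F'.LaxMonoidal]
  [G.LaxMonoidal] [NatTrans.IsMonoidal g]

theorem push_tensorator {c d : C} (x : F.obj c) (y : F.obj d) :
    push F' (μ G c d) (pair F' (app g x) (app g y)) = app g (pair F x y) :=
  (Functor.congr_obj (congrArg Cat.Hom.toFunctor (NatTrans.IsMonoidal.tensor (τ := g) c d))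
    (x, y)).symm

theorem pushHom_tensorator {c d : C} {x x' : F.obj c} {y y' : F.obj d} (a : x ⟶ x') (b : y ⟶ y') :
    pushHom F' (μ G c d) (pairHom F' (appHom g a) (appHom g b)) =
      eqToHom (push_tensorator g x y) ≫ appHom g (pairHom F a b) ≫
        eqToHom (push_tensorator g x' y').symm :=
  Functor.congr_hom (congrArg Cat.Hom.toFunctor
    (NatTrans.IsMonoidal.tensor (τ := g) c d).symm) (X := (x, y)) (Y := (x', y')) (Prod.mkHom a b)

theorem push_unitor : push F' (ε G) (unit F') = app g (unit F) :=
  (Functor.congr_obj (congrArg Cat.Hom.toFunctor (NatTrans.IsMonoidal.unit (τ := g)))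
    ⟨⟨⟨⟩⟩⟩).symm

theorem hatMap_tensor {c d c' d' : C} {x : F.obj c} {y : F.obj d} {x' : F.obj c'} {y' : F.obj d'}
    (f : c ⟶ d) (a : push F f x ⟶ y) (f' : c' ⟶ d') (a' : push F f' x' ⟶ y') :
    mk (μ G c c') (eqToHom (push_tensorator g x x')) ≫
        hatMap g (f ⊗ₘ f') (eqToHom (push_pair F f f' x x') ≫ pairHom F a a') =
      tensorHom F' (hatMap g f a) (hatMap g f' a') ≫
        mk (μ G d d') (eqToHom (push_tensorator g y y')) := by
  simp only [hatMap, mk_tensorHom, mk_comp]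
  exact mk_congr (by simp) (by
    simp [pushHom_comp, pushHom_eqToHom, appHom_comp, appHom_eqToHom, eqToHom_pairHom_left,
      eqToHom_pairHom_right, pushHom_tensorator])

end MonGroth

namespace MonGroth

universe v₁ u₁ v₂ u₂ v₃ u₃

variable {C : Type u₁} [Category.{v₁} C] {C' : Type u₃} [Category.{v₃} C']
  {F : C ⥤ Cat.{v₂, u₂}} {F' : C' ⥤ Cat.{v₂, u₂}} {G : C ⥤ C'} (g : F ⟶ G ⋙ F')
  [MonoidalCategory C] [MonoidalCategory C'] [SymmetricCategory C] [SymmetricCategory C']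
  [F.LaxBraided] [F'.LaxBraided] [G.LaxBraided] [NatTrans.IsMonoidal g]

open Functor.LaxMonoidal

theorem hatMap_braid {c d : C} (x : F.obj c) (y : F.obj d) :
    mk (μ G c d) (eqToHom (push_tensorator g x y)) ≫
        hatMap g (β_ c d).hom (eqToHom (push_braid F x y)) =
      mk (β_ (G.obj c) (G.obj d)).hom (eqToHom (push_braid F' (app g x) (app g y))) ≫
        mk (μ G d c) (eqToHom (push_tensorator g y x)) := by
  simp only [hatMap, mk_comp]
  exact mk_congr (Functor.LaxBraided.braided c d) (by simp [pushHom_eqToHom, appHom_eqToHom])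

/-- If the structure maps of `G` are identities, `Ĝ` is strict symmetric monoidal. -/
theorem hat_isStrict (h₀ : 𝟙_ C' = G.obj (𝟙_ C)) (hε : ε G = eqToHom h₀)
    (h : ∀ c d : C, G.obj c ⊗ G.obj d = G.obj (c ⊗ d)) (hμ : ∀ c d, μ G c d = eqToHom (h c d)) :
    IsStrictSymmetric (hat g) := by
  have h₁ (X Y : Grothendieck F) : (hat g).obj X ⊗ (hat g).obj Y = (hat g).obj (X ⊗ Y) :=
    obj_eq (h X.base Y.base) ((congrArg (fun t => push F' t
      (pair F' (app g X.fiber) (app g Y.fiber))) (hμ X.base Y.base).symm).trans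
        (push_tensorator g X.fiber Y.fiber))
  have h₂ (X Y : Grothendieck F) : mk (μ G X.base Y.base)
      (eqToHom (push_tensorator g X.fiber Y.fiber)) = eqToHom (h₁ X Y) :=
    mk_eqToHom _ (hμ X.base Y.base) _
  exact
    { obj_unit := (obj_eq h₀ (by rw [← hε]; exact push_unitor g)).symm
      obj_tensor := fun X Y => (h₁ X Y).symm
      map_tensor := fun {X Y X' Y'} f f' => by
        have h₃ : eqToHom (h₁ X X') ≫ (hat g).map (f ⊗ₘ f') =
            ((hat g).map f ⊗ₘ (hat g).map f') ≫ eqToHom (h₁ Y Y') := by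
          rw [← h₂ X X', ← h₂ Y Y']
          exact hatMap_tensor g f.base f.fiber f'.base f'.fiber
        rw [← h₃, eqToHom_trans_assoc, eqToHom_refl, Category.id_comp]
      map_braiding := fun X Y => by
        have h₃ : eqToHom (h₁ X Y) ≫ (hat g).map (β_ X Y).hom =
            (β_ ((hat g).obj X) ((hat g).obj Y)).hom ≫ eqToHom (h₁ Y X) := by
          rw [← h₂ X Y, ← h₂ Y X]
          exact hatMap_braid g X.fiber Y.fiber
        rw [← h₃, eqToHom_trans_assoc, eqToHom_refl, Category.id_comp] }

end MonGroth

namespace NetMod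

open MonGroth

theorem mapUnit_eq {C C' : Type u} (g : C → C') : ∃ h : 𝟙_ (ColorSeq C') =
    (ColorSeq.map g).obj (𝟙_ (ColorSeq C)), Functor.LaxMonoidal.ε (ColorSeq.map g) = eqToHom h :=
  ⟨_, ColorSeq.castIso_hom (s := 𝟙_ (ColorSeq C')) (t := (ColorSeq.map g).obj (𝟙_ (ColorSeq C)))
    rfl fun i => i.elim0⟩

theorem mapTensor_eq {C C' : Type u} (g : C → C') (s t : ColorSeq C) :
    ∃ h : (ColorSeq.map g).obj s ⊗ (ColorSeq.map g).obj t = (ColorSeq.map g).obj (s ⊗ t),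
      Functor.LaxMonoidal.μ (ColorSeq.map g) s t = eqToHom h :=
  ⟨_, ColorSeq.castIso_hom (s := (ColorSeq.map g).obj s ⊗ (ColorSeq.map g).obj t)
    (t := (ColorSeq.map g).obj (s ⊗ t)) rfl
    fun i => (ColorSeq.append_comp g s.color t.color i).symm⟩

/-- The strict symmetric monoidal functor `Ĝ : ∫ F ⥤ ∫ F'` of a morphism `(g, 𝔤)` of network
models, given by `(c, x) ↦ (g_* c, 𝔤_c x)` on objects. -/
def integralMap {F F' : NetMod.{u}} (p : F ⟶ F') : integral F ⟶ integral F' where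
  functor := hat (Hom.trans p)
  isStrict := hat_isStrict _ (mapUnit_eq _).1 (mapUnit_eq _).2
    (fun s t => (mapTensor_eq _ s t).1) (fun s t => (mapTensor_eq _ s t).2)

end NetMod

section BlockIndices

theorem sigma_castSucc {n : ℕ} (k : Fin (n + 1) → ℕ) (x : (i : Fin n) × Fin (k i.castSucc)) :
    finSigmaFinEquiv (n := k) ⟨x.1.castSucc, x.2⟩ =
      Fin.cast (Fin.sum_univ_castSucc k).symm
        (Fin.castAdd (k (Fin.last n)) (finSigmaFinEquiv (n := fun i => k i.castSucc) x)) := by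
  ext; simp [finSigmaFinEquiv_apply]

theorem sigma_last {n : ℕ} (k : Fin (n + 1) → ℕ) (j : Fin (k (Fin.last n))) :
    finSigmaFinEquiv (n := k) ⟨Fin.last n, j⟩ =
      Fin.cast (Fin.sum_univ_castSucc k).symm
        (Fin.natAdd (∑ i : Fin n, k i.castSucc) j) := by
  ext; simp [finSigmaFinEquiv_apply]; rfl

theorem ofFn_sigma {α : Type*} {n : ℕ} (k : Fin n → ℕ) (f : (i : Fin n) × Fin (k i) → α) :
    List.ofFn (fun l => f (finSigmaFinEquiv.symm l)) =
      (List.ofFn fun i => List.ofFn fun j => f ⟨i, j⟩).flatten := by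
  induction n with
  | zero => simp
  | succ n ih =>
    rw [List.ofFn_succ' (fun i => List.ofFn fun j => f ⟨i, j⟩), List.concat_eq_append,
      List.flatten_append, List.flatten_singleton,
      ← ih (fun i => k i.castSucc) (fun x => f ⟨x.1.castSucc, x.2⟩),
      List.ofFn_congr (Fin.sum_univ_castSucc k), List.ofFn_add]
    congr 1
    · congr 1
      funext l
      obtain ⟨x, rfl⟩ := (finSigmaFinEquiv (n := fun i => k i.castSucc)).surjective l
      rw [Equiv.symm_apply_apply]
      refine congrArg f ((Equiv.symm_apply_eq _).2 ?_)
      rw [sigma_castSucc]; rfl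
    · congr 1
      funext l
      refine congrArg f ((Equiv.symm_apply_eq _).2 ?_)
      rw [sigma_last]

end BlockIndices

namespace ColorSeq

variable {T : Type u}

/-- The sequence of length one with entry `c`. -/
def single (c : T) : ColorSeq T := ⟨1, fun _ => c⟩

/-- The concatenation of the sequences `s 0, …, s (n - 1)`, in this order. -/
def concat {n : ℕ} (s : Fin n → ColorSeq T) : ColorSeq T where
  len := ∑ i, (s i).len
  color l := (s (finSigmaFinEquiv.symm l).1).color (finSigmaFinEquiv.symm l).2

/-- The position in a concatenation, as a pair of a block and a position in this block. -/
def split {n : ℕ} (s : Fin n → ColorSeq T) :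
    Fin (concat s).len ≃ ((i : Fin n) × Fin (s i).len) :=
  finSigmaFinEquiv.symm

theorem color_concat {n : ℕ} (s : Fin n → ColorSeq T) (i : Fin n) (j : Fin (s i).len) :
    (concat s).color ((split s).symm ⟨i, j⟩) = (s i).color j :=
  congrArg (fun x : (i : Fin n) × Fin (s i).len => (s x.1).color x.2)
    ((split s).apply_symm_apply ⟨i, j⟩)

theorem eq_of_ofFn {s t : ColorSeq T} (h : List.ofFn s.color = List.ofFn t.color) : s = t := by
  obtain ⟨m, a⟩ := s
  obtain ⟨n, b⟩ := t
  have h' : (⟨m, a⟩ : (n : ℕ) × (Fin n → T)) = ⟨n, b⟩ := List.ofFn_inj'.1 h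
  cases h'
  rfl

theorem ofFn_concat {n : ℕ} (s : Fin n → ColorSeq T) :
    List.ofFn (concat s).color = (List.ofFn fun i => List.ofFn (s i).color).flatten :=
  ofFn_sigma (fun i => (s i).len) fun x => (s x.1).color x.2

theorem concat_one (s : ColorSeq T) : (concat fun _ : Fin 1 => s) = s :=
  eq_of_ofFn (by simp [ofFn_concat])

theorem concat_single (t : ColorSeq T) : (concat fun i => single (t.color i)) = t :=
  eq_of_ofFn (by
    rw [ofFn_concat, show (fun i => List.ofFn (single (t.color i)).color) =
      (fun c => [c]) ∘ t.color from funext fun i => by simp [single], ← List.map_ofFn]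
    rw [← List.flatMap_def]
    simp)

theorem concat_concat {n : ℕ} (s : Fin n → ColorSeq T)
    (r : (x : (i : Fin n) × Fin (s i).len) → ColorSeq T) :
    (concat fun l => r (split s l)) = concat fun i => concat fun j => r ⟨i, j⟩ :=
  eq_of_ofFn (by
    refine (ofFn_concat _).trans ((congrArg List.flatten (ofFn_sigma (fun i => (s i).len)
      fun x => List.ofFn (r x).color)).trans ?_)
    rw [ofFn_concat, List.flatten_flatten, List.map_ofFn]
    simp only [ofFn_concat, Function.comp_def])

/-- The permutation `σ` as a morphism `(t_{σ 0}, …, t_{σ (n - 1)}) ⟶ (t_0, …, t_{n - 1})`. -/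
def permHom (t : ColorSeq T) (σ : Equiv.Perm (Fin t.len)) :
    (⟨t.len, t.color ∘ σ⟩ : ColorSeq T) ⟶ t :=
  ⟨σ, fun _ => rfl⟩

/-- The permutation which permutes the blocks of a concatenation by `σ`. -/
def blockPerm {n : ℕ} (s : Fin n → ColorSeq T) (σ : Equiv.Perm (Fin n)) :
    concat (fun i => s (σ i)) ⟶ concat s :=
  ⟨(split _).trans ((Equiv.sigmaCongrLeft (β := fun i => Fin (s i).len) σ).trans (split s).symm),
    fun _ => color_concat s _ _⟩

/-- The permutation which permutes the entries of the `i`-th block of a concatenation by `τ i`. -/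
def blocksMap {n : ℕ} {s s' : Fin n → ColorSeq T} (τ : ∀ i, s i ⟶ s' i) : concat s ⟶ concat s' :=
  ⟨(split s).trans ((Equiv.sigmaCongrRight fun i => (τ i).toEquiv).trans (split s').symm),
    fun _ => (color_concat s' _ _).trans ((τ _).color_eq _)⟩

end ColorSeq

/-- The data of a typed operad: types, operations `O(t₁, …, tₙ; c)` of each arity, the action of
permutations, identities, and composition. A morphism `σ : s ⟶ t` is a permutation with
`s = (t_{σ 1}, …, t_{σ n})`, so `act σ` is the map `O(t₁, …, tₙ; c) → O(t_{σ 1}, …, t_{σ n}; c)`. -/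
structure OperadStruct : Type (u + 1) where
  Typ : Type u
  Ops : ColorSeq Typ → Typ → Type u
  act : ∀ {s t : ColorSeq Typ} {c : Typ}, (s ⟶ t) → Ops t c → Ops s c
  one : ∀ c : Typ, Ops (ColorSeq.single c) c
  comp : ∀ {t : ColorSeq Typ} {c : Typ}, Ops t c → ∀ {s : Fin t.len → ColorSeq Typ},
    (∀ i, Ops (s i) (t.color i)) → Ops (ColorSeq.concat s) c

namespace OperadStruct

/-- The axioms of a typed operad. Equal sequences of types are identified along `eqToHom`. -/
structure IsOperad (O : OperadStruct.{u}) : Prop where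
  act_id : ∀ {t c} (f : O.Ops t c), O.act (𝟙 t) f = f
  act_comp : ∀ {r s t c} (σ : r ⟶ s) (τ : s ⟶ t) (f : O.Ops t c),
    O.act (σ ≫ τ) f = O.act σ (O.act τ f)
  one_comp : ∀ {t c} (f : O.Ops t c),
    O.comp (O.one c) (fun _ => f) = O.act (eqToHom (ColorSeq.concat_one t)) f
  comp_one : ∀ {t c} (f : O.Ops t c),
    O.comp f (fun i => O.one (t.color i)) = O.act (eqToHom (ColorSeq.concat_single t)) f
  comp_assoc : ∀ {t : ColorSeq O.Typ} {c} (f : O.Ops t c) {s : Fin t.len → ColorSeq O.Typ}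
    (g : ∀ i, O.Ops (s i) (t.color i)) {r : (x : (i : Fin t.len) × Fin (s i).len) → ColorSeq O.Typ}
    (h : ∀ x, O.Ops (r x) ((s x.1).color x.2)),
    O.comp (O.comp f g) (fun l => h (ColorSeq.split s l)) =
      O.act (eqToHom (ColorSeq.concat_concat s r))
        (O.comp f fun i => O.comp (g i) fun j => h ⟨i, j⟩)
  act_comp_left : ∀ {t : ColorSeq O.Typ} {c} (f : O.Ops t c) (σ : Equiv.Perm (Fin t.len))
    {s : Fin t.len → ColorSeq O.Typ} (g : ∀ i, O.Ops (s i) (t.color i)),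
    O.comp (O.act (ColorSeq.permHom t σ) f) (fun i => g (σ i)) =
      O.act (ColorSeq.blockPerm s σ) (O.comp f g)
  act_comp_right : ∀ {t : ColorSeq O.Typ} {c} (f : O.Ops t c) {s s' : Fin t.len → ColorSeq O.Typ}
    (τ : ∀ i, s i ⟶ s' i) (g : ∀ i, O.Ops (s' i) (t.color i)),
    O.comp f (fun i => O.act (τ i) (g i)) = O.act (ColorSeq.blocksMap τ) (O.comp f g)

/-- A map of types together with maps of operations. -/
@[ext]
structure Hom (O P : OperadStruct.{u}) : Type u where
  onTyp : O.Typ → P.Typ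
  onOps : ∀ {t : ColorSeq O.Typ} {c : O.Typ}, O.Ops t c →
    P.Ops ((ColorSeq.map onTyp).obj t) (onTyp c)

/-- The axioms of an operad morphism. -/
structure Hom.IsMorphism {O P : OperadStruct.{u}} (φ : Hom O P) : Prop where
  map_act : ∀ {s t c} (σ : s ⟶ t) (f : O.Ops t c),
    φ.onOps (O.act σ f) = P.act ((ColorSeq.map φ.onTyp).map σ) (φ.onOps f)
  map_one : ∀ c, φ.onOps (O.one c) = P.one (φ.onTyp c)
  map_comp : ∀ {t : ColorSeq O.Typ} {c} (f : O.Ops t c) {s : Fin t.len → ColorSeq O.Typ}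
    (g : ∀ i, O.Ops (s i) (t.color i)),
    φ.onOps (O.comp f g) = P.comp (φ.onOps f) fun i => φ.onOps (g i)

end OperadStruct

/-- Typed symmetric operads. -/
structure Operad : Type (u + 1) extends OperadStruct.{u} where
  isOperad : toOperadStruct.IsOperad

namespace Operad

/-- Morphisms of typed operads. -/
@[ext]
structure Hom (O P : Operad.{u}) : Type u extends
    OperadStruct.Hom O.toOperadStruct P.toOperadStruct where
  isMorphism : toHom.IsMorphism

instance : Category.{u} Operad.{u} where
  Hom := Hom
  id O := ⟨⟨id, fun f => f⟩, ⟨fun _ _ => rfl, fun _ => rfl, fun _ _ _ => rfl⟩⟩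
  comp φ ψ := ⟨⟨ψ.onTyp ∘ φ.onTyp, fun f => ψ.onOps (φ.onOps f)⟩,
    ⟨fun σ f => (congrArg ψ.onOps (φ.isMorphism.map_act σ f)).trans (ψ.isMorphism.map_act _ _),
      fun c => (congrArg ψ.onOps (φ.isMorphism.map_one c)).trans (ψ.isMorphism.map_one _),
      fun f _ g => (congrArg ψ.onOps (φ.isMorphism.map_comp f g)).trans
        (ψ.isMorphism.map_comp _ _)⟩⟩

end Operad

namespace SSMC

variable {C : Type u} [Category.{v} C] [MonoidalCategory C]

/-- The tensor product `t 0 ⊗ (t 1 ⊗ (⋯ ⊗ 𝟙))`. -/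
def tensorFam : ∀ {n : ℕ}, (Fin n → C) → C
  | 0, _ => 𝟙_ C
  | _ + 1, t => t 0 ⊗ tensorFam fun i => t i.succ

/-- The tensor product of a family of morphisms. -/
def tensorFamHom : ∀ {n : ℕ} {s t : Fin n → C}, (∀ i, s i ⟶ t i) → (tensorFam s ⟶ tensorFam t)
  | 0, _, _, _ => 𝟙 (𝟙_ C)
  | _ + 1, _, _, f => f 0 ⊗ₘ tensorFamHom fun i => f i.succ

theorem tensorFam_eq_foldr {n : ℕ} (t : Fin n → C) :
    tensorFam t = (List.ofFn t).foldr (fun X Y => X ⊗ Y) (𝟙_ C) := by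
  induction n with
  | zero => simp [tensorFam]
  | succ n ih => simp [tensorFam, List.ofFn_succ, ih]

theorem foldr_tensor [IsStrictMonoidal C] (l : List C) (X : C) :
    l.foldr (fun X Y => X ⊗ Y) X = l.foldr (fun X Y => X ⊗ Y) (𝟙_ C) ⊗ X := by
  induction l with
  | nil => exact (IsStrictMonoidal.unit_tensor X).symm
  | cons Y l ih => rw [List.foldr_cons, ih, List.foldr_cons, IsStrictMonoidal.tensor_assoc]

theorem foldr_flatten [IsStrictMonoidal C] (l : List (List C)) :
    l.flatten.foldr (fun X Y => X ⊗ Y) (𝟙_ C) =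
      (l.map fun m => m.foldr (fun X Y => X ⊗ Y) (𝟙_ C)).foldr (fun X Y => X ⊗ Y) (𝟙_ C) := by
  induction l with
  | nil => rfl
  | cons m l ih => rw [List.flatten_cons, List.foldr_append, ih, foldr_tensor]; rfl

theorem tensorFam_concat [IsStrictMonoidal C] {n : ℕ} (s : Fin n → ColorSeq C) :
    tensorFam (ColorSeq.concat s).color = tensorFam fun i => tensorFam (s i).color := by
  rw [tensorFam_eq_foldr, ColorSeq.ofFn_concat, foldr_flatten, List.map_ofFn, tensorFam_eq_foldr]
  simp only [Function.comp_def, ← tensorFam_eq_foldr]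

theorem tensorFam_single [IsStrictMonoidal C] (c : C) :
    tensorFam (ColorSeq.single c).color = c :=
  IsStrictMonoidal.tensor_unit c

/-- The braiding which moves a first factor `t i` to its place in `t 0 ⊗ (t 1 ⊗ ⋯)`. -/
def insertFactor [BraidedCategory C] : ∀ {n : ℕ} (t : Fin (n + 1) → C) (i : Fin (n + 1)),
    t i ⊗ tensorFam (fun j => t (i.succAbove j)) ⟶ tensorFam t
  | _, t, ⟨0, _⟩ => t 0 ◁ eqToHom (congrArg tensorFam (funext fun j =>
      congrArg t (Fin.succAbove_zero_apply j)))
  | n + 1, t, ⟨k + 1, h⟩ =>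
    (α_ (t ⟨k + 1, h⟩) (t 0) (tensorFam fun j : Fin n =>
        t (Fin.succAbove ⟨k + 1, h⟩ j.succ))).inv ≫
      (β_ (t ⟨k + 1, h⟩) (t 0)).hom ▷ _ ≫ (α_ _ _ _).hom ≫
      t 0 ◁ (t ⟨k + 1, h⟩ ◁ eqToHom (congrArg tensorFam (funext fun j =>
        congrArg t (Fin.succ_succAbove_succ ⟨k, Nat.lt_of_succ_lt_succ h⟩ j))) ≫
        insertFactor (fun j => t j.succ) ⟨k, Nat.lt_of_succ_lt_succ h⟩)

/-- The permutation induced by `σ` on the indices other than the first one. -/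
def restPerm {n : ℕ} (σ : Equiv.Perm (Fin (n + 1))) : Equiv.Perm (Fin n) :=
  Equiv.removeNone ((finSuccEquiv' 0).symm.trans (σ.trans (finSuccEquiv' (σ 0))))

theorem succAbove_restPerm {n : ℕ} (σ : Equiv.Perm (Fin (n + 1))) (j : Fin n) :
    (σ 0).succAbove (restPerm σ j) = σ j.succ := by
  have h : some (restPerm σ j) = finSuccEquiv' (σ 0) (σ j.succ) := by
    have h₁ : some (restPerm σ j) = ((finSuccEquiv' 0).symm.trans
        (σ.trans (finSuccEquiv' (σ 0)))) (some j) :=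
      Equiv.removeNone_some _ (Option.isSome_iff_exists.1 (by
        rw [Option.isSome_iff_ne_none]
        intro h
        have h₂ : ((finSuccEquiv' 0).symm.trans (σ.trans (finSuccEquiv' (σ 0)))) none = none := by
          simp
        exact Option.some_ne_none j (Equiv.injective _ (h.trans h₂.symm))))
    simpa using h₁
  have := congrArg (finSuccEquiv' (σ 0)).symm h
  simpa using this

/-- The morphism `t (σ 0) ⊗ (t (σ 1) ⊗ ⋯) ⟶ t 0 ⊗ (t 1 ⊗ ⋯)` which permutes the tensor factors
by means of the braiding. -/
def permFactors [BraidedCategory C] : ∀ {n : ℕ} (σ : Equiv.Perm (Fin n)) (t : Fin n → C),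
    tensorFam (t ∘ σ) ⟶ tensorFam t
  | 0, _, _ => 𝟙 (𝟙_ C)
  | _ + 1, σ, t =>
    t (σ 0) ◁ (eqToHom (congrArg tensorFam (funext fun j =>
        (congrArg t (succAbove_restPerm σ j)).symm)) ≫
      permFactors (restPerm σ) fun j => t ((σ 0).succAbove j)) ≫ insertFactor t (σ 0)

theorem tensorFam_congr {m n : ℕ} (h : m = n) {s : Fin m → C} {t : Fin n → C}
    (h' : ∀ i, s i = t (Fin.cast h i)) : tensorFam s = tensorFam t := by
  subst h
  exact congrArg tensorFam (funext h')

theorem len_eq {T : Type*} {s t : ColorSeq T} (σ : s ⟶ t) : s.len = t.len :=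
  Fin.equiv_iff_eq.1 ⟨σ.toEquiv⟩

/-- The action of the morphisms of `S(C)` by permutation of tensor factors. -/
def permTensor [BraidedCategory C] {s t : ColorSeq C} (σ : s ⟶ t) :
    tensorFam s.color ⟶ tensorFam t.color :=
  eqToHom (tensorFam_congr (len_eq σ) fun i => (σ.color_eq i).symm) ≫
    permFactors ((finCongr (len_eq σ)).symm.trans σ.toEquiv) t.color

/-- The data of the endomorphism operad `Op(C)`: its types are the objects of `C`, its operations
are the morphisms `c₁ ⊗ ⋯ ⊗ cₙ ⟶ c`, permutations act by the braiding, and composition is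
`f ∘ (g₁ ⊗ ⋯ ⊗ gₙ)`. -/
def endoStruct (C : SSMC.{u}) : OperadStruct.{u} where
  Typ := C.carrier
  Ops t c := tensorFam t.color ⟶ c
  act σ f := permTensor σ ≫ f
  one c := eqToHom (tensorFam_single c)
  comp f s g := eqToHom (tensorFam_concat s) ≫ tensorFamHom g ≫ f

theorem obj_tensorFam {D : Type*} [Category* D] [MonoidalCategory D] [SymmetricCategory C]
    [SymmetricCategory D] {G : C ⥤ D} (hG : IsStrictSymmetric G) {n : ℕ} (t : Fin n → C) :
    tensorFam (G.obj ∘ t) = G.obj (tensorFam t) := by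
  induction n with
  | zero => exact hG.obj_unit.symm
  | succ n ih =>
    exact (congrArg (G.obj (t 0) ⊗ ·) (ih fun i => t i.succ)).trans (hG.obj_tensor _ _).symm

/-- A strict symmetric monoidal functor `G` acts on the types and operations of the endomorphism
operads by `c ↦ G c` and `f ↦ G f`. -/
def endoMap {C D : SSMC.{u}} (G : C ⟶ D) : OperadStruct.Hom (endoStruct C) (endoStruct D) where
  onTyp := (Hom.functor G).obj
  onOps {t _} f := eqToHom (obj_tensorFam (Hom.isStrict G) t.color) ≫ (Hom.functor G).map f

end SSMC

/-- The assignments `obj` on objects and `map` on morphisms are those of the functor `K`. -/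
def IsGivenBy {A B : Type*} [Category* A] [Category* B] (K : A ⥤ B) (obj : A → B)
    (map : ∀ {X Y : A}, (X ⟶ Y) → (obj X ⟶ obj Y)) : Prop :=
  ∃ h : ∀ X, K.obj X = obj X,
    ∀ {X Y : A} (f : X ⟶ Y), K.map f = eqToHom (h X) ≫ map f ≫ eqToHom (h Y).symm

/-! Everything except the operad axioms for `Op(C)` and the axioms for `Op(G)` is formal. The
components of composite network morphisms make `Ĝ` functorial, a strict functor sends `f` to `G f`
up to an identity cast, and a functor is determined by its values on objects and morphisms. Hence
`∫` and `Op` are functors, their composite has the prescribed values, and any functor with these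
values equals it.

The substance is coherence for permutations. The permutation action is defined by recursion: permute
all factors but the first, then braid the first one into its place. The first task is to show that
this respects products of permutations (`permAlong_mul`). Adjacent transpositions generate the
symmetric group, and those that fix the first index reduce to fewer factors. For the transposition
of the first two indices one has to insert two factors in either order; the two results agree up to
one braiding (`insertAt_insertAt`), by Yang–Baxter and symmetry.

So `tensorFunctor C : S(C) ⥤ C` is a functor. The second task is to show that it is strict symmetric
monoidal (`isStrictSymmetric_tensorFunctor`). The morphisms of `S(C)` are generated by
transpositions of the first two entries under composition and extension by a fixed first entry
(`hom_induction`), and the hexagons reduce the braidings to those of single entries.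

The same generation shows that a strict symmetric monoidal functor on `S(D)` is determined by its
values on single entries (`mk_map_eq_mk_map`), the uniqueness half of freeness. This replaces direct
calculations with block permutations. For equivariance in the outer operation, two functors `S(S(C))
⥤ C` are compared: concatenate and then tensor, or tensor each block and then tensor the results.
They agree on single blocks, hence everywhere (`mk_permTensor_blockPerm`). Likewise `Op(G)`
preserves the actions because two functors `S(C) ⥤ D` agree on single entries
(`map_permTensor_comp`).

Strictness produces many `eqToHom`. Morphisms are therefore compared as objects of the arrow
category, where these casts disappear and the tensor product makes the arrows a monoid. -/

namespace SSMC

/-! ### Inserting factors into a tensor product by braidings. -/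

section Permutations

variable {C : Type u} [Category.{v} C] [MonoidalCategory C]

theorem tensorFamHom_id {n : ℕ} (s : Fin n → C) : tensorFamHom (fun i => 𝟙 (s i)) = 𝟙 _ := by
  induction n with
  | zero => rfl
  | succ n ih => exact (congrArg (_ ⊗ₘ ·) (ih _)).trans (id_tensorHom_id _ _)

variable [SymmetricCategory C]

theorem insertFactor_zero {n : ℕ} (t : Fin (n + 1) → C) :
    insertFactor t 0 = t 0 ◁ eqToHom (congrArg tensorFam (funext fun j =>
      congrArg t (Fin.succAbove_zero_apply j))) := by
  cases n <;> rfl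

theorem insertFactor_succ {n : ℕ} (t : Fin (n + 2) → C) (k : Fin (n + 1)) :
    insertFactor t k.succ = (α_ (t k.succ) (t 0) (tensorFam fun j : Fin n =>
        t (Fin.succAbove k.succ j.succ))).inv ≫
      (β_ (t k.succ) (t 0)).hom ▷ _ ≫ (α_ _ _ _).hom ≫
      t 0 ◁ (t k.succ ◁ eqToHom (congrArg tensorFam (funext fun j =>
        congrArg t (Fin.succ_succAbove_succ k j))) ≫ insertFactor (fun j => t j.succ) k) := rfl

/-- The braiding which moves a first factor `c = t i` to its place among the factors `t`, where
`u` is the family of the remaining factors. -/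
def insertAt {n : ℕ} (t : Fin (n + 1) → C) (i : Fin (n + 1)) {c : C} {u : Fin n → C}
    (hc : c = t i) (hu : ∀ j, u j = t (i.succAbove j)) : c ⊗ tensorFam u ⟶ tensorFam t :=
  (eqToHom hc ⊗ₘ eqToHom (congrArg tensorFam (funext hu))) ≫ insertFactor t i

theorem insertAt_zero {n : ℕ} (t : Fin (n + 1) → C) {c : C} {u : Fin n → C}
    (hc : c = t 0) (hu : ∀ j, u j = t (Fin.succAbove 0 j)) :
    insertAt t 0 hc hu =
      (eqToHom hc ⊗ₘ eqToHom (congrArg tensorFam (funext fun j => by rw [hu]; simp)) :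
        c ⊗ tensorFam u ⟶ t 0 ⊗ tensorFam fun j => t j.succ) := by
  obtain rfl := hc
  rw [insertAt, insertFactor_zero, ← id_tensorHom]
  refine (tensorHom_comp_tensorHom _ _ _ _).trans ?_
  rw [eqToHom_trans, Category.comp_id]

theorem insertAt_succ {n : ℕ} (t : Fin (n + 2) → C) (k : Fin (n + 1)) {c : C}
    {u : Fin (n + 1) → C} (hc : c = t k.succ) (hu : ∀ j, u j = t (k.succ.succAbove j)) :
    insertAt t k.succ hc hu =
      ((α_ c (u 0) (tensorFam fun j => u j.succ)).inv ≫ (β_ c (u 0)).hom ▷ _ ≫ (α_ _ _ _).hom ≫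
        (eqToHom ((hu 0).trans (congrArg t (Fin.succ_succAbove_zero k))) ⊗ₘ
          insertAt (fun j => t j.succ) k hc fun j => (hu j.succ).trans
            (congrArg t (Fin.succ_succAbove_succ k j))) :
        c ⊗ u 0 ⊗ tensorFam (fun j => u j.succ) ⟶ t 0 ⊗ tensorFam fun j => t j.succ) := by
  obtain rfl := hc
  obtain rfl : u = _ := funext hu
  have h : insertAt t k.succ rfl hu = insertFactor t k.succ := by simp [insertAt]
  rw [h, insertFactor_succ]
  simp only [insertAt, eqToHom_refl, id_tensorHom]
  rw [← id_tensorHom (t 0), ← eqToHom_refl (t 0) rfl]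
  rfl

/-- The factors `c` and `d` are exchanged and exchanged back: `β_ c d` and `β_ d w`, with `w = c`,
cancel by symmetry. -/
theorem insert_zero_step {c d w z x x' y y' : C} (e : c = w) (e' : w = z) (e₁ : x = x')
    (e₂ : y = y') (f : d ⊗ x ⟶ y) (f' : d ⊗ x' ⟶ y')
    (h : f ≫ eqToHom e₂ = d ◁ eqToHom e₁ ≫ f') :
    (α_ c d x).inv ≫ (β_ c d).hom ▷ x ≫ (α_ d c x).hom ≫ d ◁ (eqToHom e ⊗ₘ eqToHom e₁) ≫
      (α_ d w x').inv ≫ (β_ d w).hom ▷ x' ≫ (α_ w d x').hom ≫ (eqToHom e' ⊗ₘ f') =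
      c ◁ f ≫ (eqToHom (e.trans e') ⊗ₘ eqToHom e₂) := by
  subst e e' e₁ e₂
  obtain rfl : f = f' := by simpa using h
  simp [← comp_whiskerRight_assoc]

/-- Here `d` ends in front, so each side moves `c` past `d` exactly once and the two sides differ
only by casts. -/
theorem insert_succ_zero_step {c d v z x x' y y' : C} (e : d = v) (e' : v = z) (e₁ : x = x')
    (e₂ : y' = y) (f : c ⊗ x' ⟶ y) (f' : c ⊗ x ⟶ y') (h : f' ≫ eqToHom e₂ = c ◁ eqToHom e₁ ≫ f) :
    (α_ c d x).inv ≫ (β_ c d).hom ▷ x ≫ (α_ d c x).hom ≫ d ◁ f' ≫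
      (eqToHom (e.trans e') ⊗ₘ eqToHom e₂) =
      c ◁ (eqToHom e ⊗ₘ eqToHom e₁) ≫ (α_ c v x').inv ≫ (β_ c v).hom ▷ x' ≫ (α_ v c x').hom ≫
        (eqToHom e' ⊗ₘ f) := by
  subst e e' e₁ e₂
  obtain rfl : f' = f := by simpa using h
  simp

theorem insertAt_zero_insertAt {n : ℕ} {t : Fin (n + 2) → C} {u u' : Fin (n + 1) → C}
    {w : Fin n → C} {c d : C} {j : Fin (n + 1)}
    (hc : c = t 0) (hu : ∀ k, u k = t (Fin.succAbove 0 k)) (hd : d = u j)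
    (hw : ∀ k, w k = u (j.succAbove k))
    (hd' : d = t j.succ) (hu' : ∀ k, u' k = t (j.succ.succAbove k)) (hc' : c = u' 0)
    (hw' : ∀ k, w k = u' (Fin.succAbove 0 k)) :
    (α_ c d (tensorFam w)).inv ≫ (β_ c d).hom ▷ _ ≫ (α_ d c _).hom ≫
      d ◁ insertAt u' 0 hc' hw' ≫ insertAt t j.succ hd' hu' =
      c ◁ insertAt u j hd hw ≫ insertAt t 0 hc hu := by
  obtain rfl : w = fun k => u' k.succ := funext fun k => by rw [hw']; simp
  obtain rfl : u = fun k => t k.succ := funext fun k => by rw [hu]; simp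
  rw [insertAt_zero, insertAt_zero, insertAt_succ]
  exact insert_zero_step _ _ rfl rfl _ _ (by simp)

theorem insertAt_succ_insertAt_zero {n : ℕ} {t : Fin (n + 2) → C} {u u' : Fin (n + 1) → C}
    {w : Fin n → C} {c d : C} {i : Fin (n + 1)}
    (hc : c = t i.succ) (hu : ∀ k, u k = t (i.succ.succAbove k)) (hd : d = u 0)
    (hw : ∀ k, w k = u (Fin.succAbove 0 k))
    (hd' : d = t 0) (hu' : ∀ k, u' k = t (Fin.succAbove 0 k)) (hc' : c = u' i)
    (hw' : ∀ k, w k = u' (i.succAbove k)) :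
    (α_ c d (tensorFam w)).inv ≫ (β_ c d).hom ▷ _ ≫ (α_ d c _).hom ≫
      d ◁ insertAt u' i hc' hw' ≫ insertAt t 0 hd' hu' =
      c ◁ insertAt u 0 hd hw ≫ insertAt t i.succ hc hu := by
  obtain rfl : w = fun k => u k.succ := funext fun k => by rw [hw]; simp
  obtain rfl : u' = fun k => t k.succ := funext fun k => by rw [hu']; simp
  rw [insertAt_zero, insertAt_zero, insertAt_succ]
  exact insert_succ_zero_step _ _ rfl rfl _ _ (by simp)

/-- Both `c` and `d` have to pass the leading factor `w`. Yang–Baxter lets them be exchanged after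
passing it instead of before, and behind `w` the hypothesis `h` applies. -/
theorem insert_step {c d w w₁ w₂ w₃ x y y' z : C} (e₁ : w = w₁) (e₂ : w = w₂) (e₃ : w₁ = w₃)
    (e₄ : w₂ = w₃) (f : d ⊗ x ⟶ y) (g : c ⊗ y ⟶ z) (f' : c ⊗ x ⟶ y') (g' : d ⊗ y' ⟶ z)
    (h : (α_ c d x).inv ≫ (β_ c d).hom ▷ x ≫ (α_ d c x).hom ≫ d ◁ f' ≫ g' = c ◁ f ≫ g) :
    (α_ c d (w ⊗ x)).inv ≫ (β_ c d).hom ▷ (w ⊗ x) ≫ (α_ d c (w ⊗ x)).hom ≫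
      d ◁ ((α_ c w x).inv ≫ (β_ c w).hom ▷ x ≫ (α_ w c x).hom ≫ (eqToHom e₂ ⊗ₘ f')) ≫
        (α_ d w₂ y').inv ≫ (β_ d w₂).hom ▷ y' ≫ (α_ w₂ d y').hom ≫ (eqToHom e₄ ⊗ₘ g') =
      c ◁ ((α_ d w x).inv ≫ (β_ d w).hom ▷ x ≫ (α_ w d x).hom ≫ (eqToHom e₁ ⊗ₘ f)) ≫
        (α_ c w₁ y).inv ≫ (β_ c w₁).hom ▷ y ≫ (α_ w₁ c y).hom ≫ (eqToHom e₃ ⊗ₘ g) := by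
  subst e₁ e₂ e₃
  simp only [eqToHom_refl, id_tensorHom]
  -- Moving `a` past `w` commutes with a morphism `k` that acts behind both.
  have h₁ (a b : C) {p q : C} (k : b ⊗ p ⟶ q) : a ◁ (w ◁ k) ≫ (α_ a w q).inv ≫
      (β_ a w).hom ▷ q ≫ (α_ w a q).hom = (α_ a w (b ⊗ p)).inv ≫ (β_ a w).hom ▷ (b ⊗ p) ≫
        (α_ w a (b ⊗ p)).hom ≫ w ◁ (a ◁ k) := by
    rw [associator_inv_naturality_right_assoc, whisker_exchange_assoc]
    simp
  have yb : (α_ c d (w ⊗ x)).inv ≫ (β_ c d).hom ▷ (w ⊗ x) ≫ (α_ d c (w ⊗ x)).hom ≫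
      d ◁ ((α_ c w x).inv ≫ (β_ c w).hom ▷ x ≫ (α_ w c x).hom) ≫
        (α_ d w (c ⊗ x)).inv ≫ (β_ d w).hom ▷ (c ⊗ x) ≫ (α_ w d (c ⊗ x)).hom =
      c ◁ ((α_ d w x).inv ≫ (β_ d w).hom ▷ x ≫ (α_ w d x).hom) ≫
        (α_ c w (d ⊗ x)).inv ≫ (β_ c w).hom ▷ (d ⊗ x) ≫ (α_ w c (d ⊗ x)).hom ≫
          w ◁ ((α_ c d x).inv ≫ (β_ c d).hom ▷ x ≫ (α_ d c x).hom) := by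
    calc _ = 𝟙 _ ⊗≫ ((β_ c d).hom ▷ w ⊗≫ d ◁ (β_ c w).hom ⊗≫ (β_ d w).hom ▷ c) ▷ x ⊗≫ 𝟙 _ := by
          monoidal
      _ = _ := by
          rw [BraidedCategory.yang_baxter']
          monoidal
  simp only [MonoidalCategory.whiskerLeft_comp, Category.assoc] at yb ⊢
  rw [reassoc_of% (h₁ d c f'), reassoc_of% (h₁ c d f), ← MonoidalCategory.whiskerLeft_comp w _ g,
    ← h, reassoc_of% yb]
  simp only [MonoidalCategory.whiskerLeft_comp]

/-- The factors `c` and `d` go to the places `i` and `i'`; `j` is the place of `d` once `i` is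
deleted, and `j'` that of `c` once `i'` is deleted. If neither goes to the front, the first
remaining factor is split off by `insert_step`. Families and places are variables tied by equations,
so that the induction hypothesis applies to tails without transport. -/
theorem insertAt_insertAt : ∀ {n : ℕ} {t : Fin (n + 2) → C} {u u' : Fin (n + 1) → C}
    {w : Fin n → C} {c d : C} {i i' : Fin (n + 2)} {j j' : Fin (n + 1)}
    (_ : i.succAbove j = i') (_ : i'.succAbove j' = i)
    (hc : c = t i) (hu : ∀ k, u k = t (i.succAbove k)) (hd : d = u j)
    (hw : ∀ k, w k = u (j.succAbove k))
    (hd' : d = t i') (hu' : ∀ k, u' k = t (i'.succAbove k)) (hc' : c = u' j')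
    (hw' : ∀ k, w k = u' (j'.succAbove k)),
    (α_ c d (tensorFam w)).inv ≫ (β_ c d).hom ▷ _ ≫ (α_ d c _).hom ≫
      d ◁ insertAt u' j' hc' hw' ≫ insertAt t i' hd' hu' =
      c ◁ insertAt u j hd hw ≫ insertAt t i hc hu := by
  intro n
  induction n with
  | zero =>
    intro t u u' w c d i i' j j' hi hi' hc hu hd hw hd' hu' hc' hw'
    obtain rfl : j = 0 := Fin.fin_one_eq_zero j
    obtain rfl : j' = 0 := Fin.fin_one_eq_zero j'
    induction i using Fin.cases with
    | zero =>
      obtain rfl : i' = Fin.succ 0 := by rw [← hi]; simp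
      exact insertAt_zero_insertAt hc hu hd hw hd' hu' hc' hw'
    | succ i =>
      obtain rfl : i = 0 := Fin.fin_one_eq_zero i
      obtain rfl : i' = 0 := by rw [← hi]; simp
      exact insertAt_succ_insertAt_zero hc hu hd hw hd' hu' hc' hw'
  | succ n ih =>
  intro t u u' w c d i i' j j' hi hi' hc hu hd hw hd' hu' hc' hw'
  induction i using Fin.cases with
  | zero =>
    obtain rfl : i' = j.succ := by rw [← hi]; simp
    obtain rfl : j' = 0 := Fin.succAbove_right_injective (hi'.trans (by simp))
    exact insertAt_zero_insertAt hc hu hd hw hd' hu' hc' hw'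
  | succ i =>
  induction j using Fin.cases with
  | zero =>
    obtain rfl : i' = 0 := by rw [← hi]; simp
    obtain rfl : j' = i := Fin.succAbove_right_injective (hi'.trans (by simp))
    exact insertAt_succ_insertAt_zero hc hu hd hw hd' hu' hc' hw'
  | succ j =>
  obtain ⟨k, rfl⟩ : ∃ k : Fin (n + 2), i' = k.succ := ⟨i.succAbove j, by
    rw [← hi, Fin.succ_succAbove_succ]⟩
  induction j' using Fin.cases with
  -- Impossible: `k.succ.succAbove 0` is `0`, which is not a successor.
  | zero => simp [eq_comm] at hi'
  | succ j' =>
  rw [Fin.succ_succAbove_succ, Fin.succ_inj] at hi hi'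
  simp only [insertAt_succ]
  exact insert_step (((hw 0).trans (by simp))) (((hw' 0).trans (by simp))) _ _ _ _ _ _
    (@ih (fun k => t k.succ) (fun k => u k.succ) (fun k => u' k.succ) (fun k => w k.succ)
    c d i k j j' hi hi' hc (fun k => by rw [hu, Fin.succ_succAbove_succ]) hd
    (fun k => by rw [hw, Fin.succ_succAbove_succ]) hd'
    (fun k => by rw [hu', Fin.succ_succAbove_succ]) hc'
    (fun k => by rw [hw', Fin.succ_succAbove_succ]))

end Permutations

end SSMC

/-! ### Compatibility of the permutation action with products of permutations. -/

namespace SSMC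

section Permutations

variable {C : Type u} [Category.{v} C] [MonoidalCategory C] [SymmetricCategory C]

theorem insertAt_cast {n : ℕ} {t : Fin (n + 1) → C} {i : Fin (n + 1)} {c c' : C} {u : Fin n → C}
    (e : c' = c) (hc : c = t i) (hu : ∀ j, u j = t (i.succAbove j)) :
    eqToHom e ▷ _ ≫ insertAt t i hc hu = insertAt t i (e.trans hc) hu := by
  subst e
  simp

/-- The permutation of tensor factors along `σ`, between families matched by `σ`. -/
def permAlong {n : ℕ} {s t : Fin n → C} (σ : Equiv.Perm (Fin n)) (h : ∀ i, t (σ i) = s i) :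
    tensorFam s ⟶ tensorFam t :=
  eqToHom (congrArg tensorFam (funext fun i => (h i).symm)) ≫ permFactors σ t

theorem permAlong_cast {n : ℕ} {s s' t : Fin n → C} {σ σ' : Equiv.Perm (Fin n)} (hσ : σ' = σ)
    (e : ∀ i, s' i = s i) (h : ∀ i, t (σ i) = s i) (h' : ∀ i, t (σ' i) = s' i) :
    permAlong σ' h' = eqToHom (congrArg tensorFam (funext e)) ≫ permAlong σ h := by
  subst hσ
  obtain rfl : s' = s := funext e
  simp

/-- The recursion of `permFactors`, for any description of the place, the residual permutation and
the remaining family. Injectivity of `succAbove` forces `σ'` to be `restPerm σ`, so callers may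
supply the most convenient form. -/
theorem permAlong_succ {n : ℕ} {s t : Fin (n + 1) → C} (σ : Equiv.Perm (Fin (n + 1)))
    (h : ∀ i, t (σ i) = s i) {i : Fin (n + 1)} {σ' : Equiv.Perm (Fin n)} {u : Fin n → C}
    (hi : σ 0 = i) (hσ : ∀ j, i.succAbove (σ' j) = σ j.succ)
    (hu : ∀ j, u j = t (i.succAbove j)) (hs : ∀ j, u (σ' j) = s j.succ) (hc : s 0 = t i) :
    permAlong σ h = (s 0 ◁ permAlong (s := fun j => s j.succ) σ' hs ≫ insertAt t i hc hu :
        s 0 ⊗ tensorFam (fun j => s j.succ) ⟶ tensorFam t) := by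
  subst hi
  obtain rfl : s = t ∘ σ := funext fun i => (h i).symm
  obtain rfl : u = _ := funext hu
  obtain rfl : σ' = restPerm σ := Equiv.ext fun j =>
    Fin.succAbove_right_injective ((hσ j).trans (succAbove_restPerm σ j).symm)
  simp only [permAlong, insertAt, eqToHom_refl, Category.id_comp, id_tensorHom_id]
  rfl

theorem permAlong_one {n : ℕ} {s t : Fin n → C} (h : ∀ i, t ((1 : Equiv.Perm (Fin n)) i) = s i) :
    permAlong 1 h = eqToHom (congrArg tensorFam (funext fun i => (h i).symm)) := by
  induction n with
  | zero => exact Category.comp_id _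
  | succ n ih =>
    obtain rfl : s = t := funext fun i => (h i).symm
    have h₁ : ∀ j, (fun j : Fin n => s j.succ) ((1 : Equiv.Perm (Fin n)) j) = s j.succ :=
      fun _ => rfl
    have h₂ : ∀ j : Fin n, s j.succ = s (Fin.succAbove 0 j) := fun _ => by simp
    rw [permAlong_succ (i := 0) (σ' := 1) (u := fun j => s j.succ) 1 h rfl (fun j => by simp)
      h₂ h₁ rfl, ih, insertAt_zero]
    exact (congrArg₂ (· ≫ ·) (whiskerLeft_id _ _) (id_tensorHom_id _ _)).trans (Category.comp_id _)

omit [SymmetricCategory C] in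
theorem fixed_zero_step {r s x y y' z u t : C} (e : r = s) (e' : s = u) (e₁ : y = y') (p : x ⟶ y)
    (q : y' ⟶ z) (pq : x ⟶ z)
    (h : pq = p ≫ eqToHom e₁ ≫ q) (f : s ⊗ z ⟶ t) (f' : r ⊗ z ⟶ t) (hf : eqToHom e ▷ z ≫ f = f') :
    r ◁ pq ≫ f' = (r ◁ p ≫ (eqToHom e ⊗ₘ eqToHom e₁)) ≫ s ◁ q ≫ f := by
  subst e e₁ h hf
  simp

/-- As `τ` fixes `0`, both `σ` and `σ * τ` insert their first factor at `σ 0`, and the residual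
permutation of `σ * τ` is `restPerm σ * τ'`. Only the statement `ih` about tails is left. -/
theorem permAlong_fixed_zero {n : ℕ} {r s t : Fin (n + 1) → C} {σ τ : Equiv.Perm (Fin (n + 1))}
    {τ' : Equiv.Perm (Fin n)} (h₀ : τ 0 = 0) (h₁ : ∀ j, τ j.succ = (τ' j).succ)
    (hτ : ∀ i, s (τ i) = r i) (hσ : ∀ i, t (σ i) = s i) (h : ∀ i, t ((σ * τ) i) = r i)
    (ih : ∀ {r s t : Fin n → C} {σ τ : Equiv.Perm (Fin n)}
      (hτ : ∀ i, s (τ i) = r i) (hσ : ∀ i, t (σ i) = s i) (h : ∀ i, t ((σ * τ) i) = r i),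
      permAlong (σ * τ) h = permAlong τ hτ ≫ permAlong σ hσ) :
    permAlong (σ * τ) h = permAlong τ hτ ≫ permAlong σ hσ := by
  have e : ∀ j, (restPerm σ * τ') j = restPerm σ (τ' j) := fun _ => rfl
  have e' : ∀ j, (σ * τ) j = σ (τ j) := fun _ => rfl
  have h₂ : ∀ j : Fin n, s j.succ = s (Fin.succAbove 0 j) := fun _ => by simp
  rw [permAlong_succ (i := 0) (σ' := τ') (u := fun j => s j.succ) τ hτ h₀ (fun j => by simp [h₁])
      h₂ (fun j => by rw [← h₁, hτ]) (by rw [← hτ, h₀]), insertAt_zero,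
    permAlong_succ (σ' := restPerm σ) (u := fun j => t ((σ 0).succAbove j)) σ hσ rfl
      (fun j => succAbove_restPerm σ j) (fun j => rfl)
      (fun j => by rw [succAbove_restPerm, hσ]) (hσ 0).symm,
    permAlong_succ (i := σ 0) (σ' := restPerm σ * τ') (u := fun j => t ((σ 0).succAbove j)) (σ * τ)
      h (by rw [e', h₀]) (fun j => by rw [e, e', h₁, succAbove_restPerm]) (fun j => rfl)
      (fun j => by rw [e, succAbove_restPerm, ← h₁, ← e', h]) (by rw [← h, e', h₀])]
  refine fixed_zero_step _ (hσ 0).symm rfl _ _ _ ?_ _ _ (insertAt_cast _ _ _)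
  rw [eqToHom_refl, Category.id_comp]
  exact ih _ _ _

/-- The first factor is inserted at place `1`, that is, past one factor, and the residual
permutation is the identity. -/
theorem permAlong_swap {n : ℕ} {r s : Fin (n + 2) → C}
    (h : ∀ i, s (Equiv.swap 0 1 i) = r i) (e₀ : r 0 = s 1) (e₁ : r 1 = s 0)
    (e : ∀ j : Fin n, r j.succ.succ = s j.succ.succ) :
    permAlong (Equiv.swap 0 1) h =
      ((α_ (r 0) (r 1) (tensorFam fun j => r j.succ.succ)).inv ≫ (β_ (r 0) (r 1)).hom ▷ _ ≫
        (α_ (r 1) (r 0) _).hom ≫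
          (eqToHom e₁ ⊗ₘ (eqToHom e₀ ⊗ₘ eqToHom (congrArg tensorFam (funext e)))) :
        r 0 ⊗ r 1 ⊗ tensorFam (fun j => r j.succ.succ) ⟶
          s 0 ⊗ s 1 ⊗ tensorFam fun j => s j.succ.succ) := by
  have h₁ : ∀ j : Fin (n + 1), r j.succ = s (Fin.succAbove (Fin.succ 0) j) := fun j => by
    induction j using Fin.cases with
    | zero => simpa using e₁
    | succ j => simpa using e j
  have e₀' : r 0 = s (Fin.succ 0) := e₀
  have h₂ : ∀ j, (fun j => r j.succ) ((1 : Equiv.Perm (Fin (n + 1))) j) = r j.succ := fun _ => rfl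
  rw [permAlong_succ (i := Fin.succ 0) (σ' := 1) (u := fun j => r j.succ) (Equiv.swap 0 1) h
    (by simp) (fun j => ?_) h₁ h₂ e₀', insertAt_succ, insertAt_zero]
  · exact (congrArg (r 0 ◁ · ≫ _) (permAlong_one h₂)).trans
      ((congrArg (· ≫ _) (whiskerLeft_id _ _)).trans (Category.id_comp _))
  · induction j using Fin.cases with
    | zero => simp
    | succ j => 
      rw [Equiv.swap_apply_of_ne_of_ne (by simp) (by simp [Fin.ext_iff])]
      simp

/-- The exchange law `h` turns the insertions on the right into those on the left at the price of a
braiding `β_ r₁ r₀`. Naturality moves it in front of `p`, where it cancels `β_ r₀ r₁`. -/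
theorem swap_step {r₀ r₁ s₀ s₁ x y z u u' t : C} (e₀ : r₀ = s₁) (e₁ : r₁ = s₀) (e : x = y)
    (p : y ⟶ z) (p' : x ⟶ z) (hp : p' = eqToHom e ≫ p) (f : s₁ ⊗ z ⟶ u) (g : s₀ ⊗ u ⟶ t)
    (f₁ : r₀ ⊗ z ⟶ u) (g₁ : r₁ ⊗ u ⟶ t) (hf : eqToHom e₀ ▷ z ≫ f = f₁)
    (hg : eqToHom e₁ ▷ u ≫ g = g₁) (f' : r₁ ⊗ z ⟶ u') (g' : r₀ ⊗ u' ⟶ t)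
    (h : (α_ r₁ r₀ z).inv ≫ (β_ r₁ r₀).hom ▷ z ≫ (α_ r₀ r₁ z).hom ≫ r₀ ◁ f' ≫ g' =
      r₁ ◁ f₁ ≫ g₁) :
    r₀ ◁ (r₁ ◁ p' ≫ f') ≫ g' = ((α_ r₀ r₁ x).inv ≫ (β_ r₀ r₁).hom ▷ x ≫ (α_ r₁ r₀ x).hom ≫
      (eqToHom e₁ ⊗ₘ (eqToHom e₀ ⊗ₘ eqToHom e))) ≫ s₀ ◁ (s₁ ◁ p ≫ f) ≫ g := by
  subst e₀ e₁ e hp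
  obtain rfl : f = f₁ := by simpa using hf
  obtain rfl : g = g₁ := by simpa using hg
  simp only [eqToHom_refl, id_tensorHom_id, Category.comp_id, Category.id_comp,
    MonoidalCategory.whiskerLeft_comp, Category.assoc, ← h]
  have h₁ : r₁ ◁ r₀ ◁ p ≫ (α_ r₁ r₀ z).inv ≫ (β_ r₁ r₀).hom ▷ z ≫ (α_ r₀ r₁ z).hom =
      (α_ r₁ r₀ x).inv ≫ (β_ r₁ r₀).hom ▷ x ≫ (α_ r₀ r₁ x).hom ≫ r₀ ◁ r₁ ◁ p := by
    rw [associator_inv_naturality_right_assoc, whisker_exchange_assoc]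
    simp
  rw [reassoc_of% h₁]
  simp [← comp_whiskerRight_assoc]

/-- Both sides enumerate, in increasing order, the indices other than `i` and `i'`. -/
theorem succAbove_succAbove_eq {n : ℕ} {i i' : Fin (n + 2)} {j j' : Fin (n + 1)}
    (h : i.succAbove j = i') (h' : i'.succAbove j' = i) (k : Fin n) :
    i'.succAbove (j'.succAbove k) = i.succAbove (j.succAbove k) := by
  subst h
  obtain rfl : j' = j.predAbove i :=
    Fin.succAbove_right_injective (h'.trans (Fin.succAbove_succAbove_predAbove i j).symm)
  exact Fin.succAbove_succAbove_succAbove_predAbove i j k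

/-- `σ` and `σ * swap 0 1` use the same two places for the first two factors, in opposite order, and
treat the other factors alike. Unfolding two insertions on each side leaves `insertAt_insertAt`. -/
theorem permAlong_mul_swap {n : ℕ} {r s t : Fin (n + 2) → C} {σ : Equiv.Perm (Fin (n + 2))}
    (hτ : ∀ i, s (Equiv.swap 0 1 i) = r i) (hσ : ∀ i, t (σ i) = s i)
    (h : ∀ i, t ((σ * Equiv.swap 0 1 : Equiv.Perm (Fin (n + 2))) i) = r i) :
    permAlong (σ * Equiv.swap 0 1) h = permAlong (Equiv.swap 0 1) hτ ≫ permAlong σ hσ := by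
  have e : ∀ j, (σ * Equiv.swap 0 1 : Equiv.Perm (Fin (n + 2))) j = σ (Equiv.swap 0 1 j) :=
    fun _ => rfl
  have e₀ : r 0 = s 1 := by rw [← hτ]; simp
  have e₁ : r 1 = s 0 := by rw [← hτ]; simp
  have e₂ : ∀ j : Fin n, Equiv.swap (0 : Fin (n + 2)) 1 j.succ.succ = j.succ.succ := fun j => by
    rw [Equiv.swap_apply_of_ne_of_ne (by simp) (by simp [Fin.ext_iff])]
  have e₃ : ∀ j : Fin n, r j.succ.succ = s j.succ.succ := fun j => by rw [← hτ, e₂]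
  set ρ := σ * Equiv.swap 0 1 with hρ
  have i₀ : ρ 0 = σ 1 := by simp [hρ]
  have i₁ : ρ 1 = σ 0 := by simp [hρ]
  have i₂ : ∀ j : Fin n, ρ j.succ.succ = σ j.succ.succ := fun j => by rw [hρ, e, e₂]
  have i₃ : (σ 0).succAbove (restPerm σ 0) = ρ 0 := by rw [succAbove_restPerm, i₀]; rfl
  have i₄ : (ρ 0).succAbove (restPerm ρ 0) = σ 0 := by rw [succAbove_restPerm, ← i₁]; rfl
  -- After two deletions the residual permutation of `ρ` is that of `σ`, so both sides can be
  -- unfolded with `restPerm (restPerm σ)`.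
  have i₅ : ∀ j, (restPerm ρ 0).succAbove (restPerm (restPerm σ) j) = restPerm ρ j.succ := by
    intro j
    refine Fin.succAbove_right_injective (p := ρ 0) ?_
    rw [succAbove_restPerm, succAbove_succAbove_eq i₃ i₄, succAbove_restPerm, succAbove_restPerm, i₂]
  have u₁ : ∀ j, t ((σ 0).succAbove (restPerm σ j)) = s j.succ := fun j => by
    rw [succAbove_restPerm, hσ]
  have u₂ : ∀ j, t ((ρ 0).succAbove (restPerm ρ j)) = r j.succ := fun j => by
    rw [succAbove_restPerm, h]
  have w₁ : ∀ j : Fin n, t ((σ 0).succAbove ((restPerm σ 0).succAbove (restPerm (restPerm σ) j))) =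
    s j.succ.succ := fun j => by rw [succAbove_restPerm, u₁]
  have w₂ : ∀ j : Fin n, t ((σ 0).succAbove ((restPerm σ 0).succAbove (restPerm (restPerm σ) j))) =
    r j.succ.succ := fun j => by rw [w₁, e₃]
  have w₃ : ∀ j : Fin n, t ((σ 0).succAbove ((restPerm σ 0).succAbove j)) =
    t ((ρ 0).succAbove ((restPerm ρ 0).succAbove j)) := fun j => by
    rw [succAbove_succAbove_eq i₃ i₄]
  rw [permAlong_swap hτ e₀ e₁ e₃,
    permAlong_succ (u := fun j => t ((σ 0).succAbove j)) σ hσ rfl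
      (fun j => succAbove_restPerm σ j) (fun j => rfl) u₁ (hσ 0).symm,
    permAlong_succ (s := fun j => s j.succ) (u := fun j => t ((σ 0).succAbove ((restPerm σ 0).succAbove j)))
      (restPerm σ) u₁ rfl (fun j => succAbove_restPerm _ j) (fun j => rfl) w₁ (u₁ 0).symm,
    permAlong_succ (u := fun j => t ((ρ 0).succAbove j)) ρ h rfl
      (fun j => succAbove_restPerm ρ j) (fun j => rfl) u₂ (h 0).symm,
    permAlong_succ (s := fun j => r j.succ) (u := fun j => t ((σ 0).succAbove ((restPerm σ 0).succAbove j)))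
      (restPerm ρ) u₂ (σ' := restPerm (restPerm σ)) rfl i₅ w₃ w₂ (u₂ 0).symm]
  refine swap_step e₀ e₁ _ _ _ (permAlong_cast rfl e₃ _ _) _ _ _ _ (insertAt_cast _ _ _)
    (insertAt_cast _ _ _) _ _ ?_
  exact insertAt_insertAt i₃ i₄ _ _ _ _ _ _ _ _

/-- For fixed `n`, the permutations `τ` for which this holds with every `σ` are closed under
products, so adjacent transpositions suffice. The one of `0` and `1` is `permAlong_mul_swap`; every
other one fixes `0` and reduces to `n - 1` factors. -/
theorem permAlong_mul {n : ℕ} {r s t : Fin n → C} {σ τ : Equiv.Perm (Fin n)}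
      (hτ : ∀ i, s (τ i) = r i) (hσ : ∀ i, t (σ i) = s i) (h : ∀ i, t ((σ * τ) i) = r i) :
      permAlong (σ * τ) h = permAlong τ hτ ≫ permAlong σ hσ := by
  induction n with
  | zero =>
    obtain rfl : r = t := Subsingleton.elim _ _
    obtain rfl : r = s := Subsingleton.elim _ _
    change 𝟙 (𝟙_ C) ≫ 𝟙 (𝟙_ C) = (𝟙 (𝟙_ C) ≫ 𝟙 (𝟙_ C)) ≫ 𝟙 (𝟙_ C) ≫ 𝟙 (𝟙_ C)
    simp
  | succ n ih =>
  -- Generation as a monoid, so that no case for inverses arises.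
  have hτ₀ : τ ∈ Submonoid.closure (Set.range fun i : Fin n => Equiv.swap i.castSucc i.succ) := by
    rw [Equiv.Perm.mclosure_swap_castSucc_succ]; trivial
  induction hτ₀ using Submonoid.closure_induction generalizing r s t σ with
  | one =>
    rw [permAlong_one, permAlong_cast (mul_one σ) (fun i => (hτ i).symm) hσ]
    rfl
  | mul τ τ' _ _ h₁ h₂ =>
    have e₁ : ∀ i, (s ∘ τ) (τ' i) = r i := hτ
    have e₂ : ∀ i, s (τ i) = (s ∘ τ) i := fun _ => rfl
    have e₃ : ∀ i, t ((σ * τ) i) = (s ∘ τ) i := fun i => hσ _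
    rw [h₂ e₁ e₂ hτ, Category.assoc, ← h₁ e₂ hσ e₃, ← h₂ e₁ e₃ h]
    rfl
  | mem τ hτ₁ =>
    obtain ⟨i, rfl⟩ := hτ₁
    cases n with
    | zero => exact i.elim0
    | succ n =>
    induction i using Fin.cases with
    | zero => exact permAlong_mul_swap hτ hσ h
    | succ i =>
      exact permAlong_fixed_zero (τ' := Equiv.swap i.castSucc i.succ)
        (Equiv.swap_apply_of_ne_of_ne (by simp [Fin.ext_iff]) (by simp [Fin.ext_iff]))
        (fun j => by
          simp only [Fin.castSucc_succ, Equiv.swap_apply_def, Fin.succ_inj]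
          split_ifs <;> rfl) hτ hσ h (fun a b c => ih a b c)

end Permutations

end SSMC

/-! ### Generators of the morphisms of `S(D)`. -/

namespace ColorSeq

variable {D : Type u}

/-- The sequence with first entry `c` and remaining entries `s`. -/
def cons (c : D) (s : ColorSeq D) : ColorSeq D := ⟨s.len + 1, Fin.cons c s.color⟩

/-- The extension of a bijection by a fixed first element. -/
def extendZero {m n : ℕ} (e : Fin m ≃ Fin n) : Fin (m + 1) ≃ Fin (n + 1) :=
  (finSuccEquiv m).trans (e.optionCongr.trans (finSuccEquiv n).symm)

theorem extendZero_zero {m n : ℕ} (e : Fin m ≃ Fin n) : extendZero e 0 = 0 := by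
  simp [extendZero]

theorem extendZero_succ {m n : ℕ} (e : Fin m ≃ Fin n) (i : Fin m) :
    extendZero e i.succ = (e i).succ := by
  simp [extendZero]

theorem cons_extendZero {m n : ℕ} {a : Fin m → D} {b : Fin n → D} {e : Fin m ≃ Fin n} (c : D)
    (h : ∀ i, b (e i) = a i) (i : Fin (m + 1)) :
    (Fin.cons c b : Fin (n + 1) → D) (extendZero e i) = (Fin.cons c a : Fin (m + 1) → D) i := by
  induction i using Fin.cases with
  | zero => simp [extendZero_zero]
  | succ i => simp [extendZero_succ, h]

theorem swap_zero_one_succ_succ {n : ℕ} (i : Fin n) :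
    Equiv.swap (0 : Fin (n + 2)) 1 i.succ.succ = i.succ.succ :=
  Equiv.swap_apply_of_ne_of_ne (by simp) (by simp [Fin.ext_iff])

theorem swap_succ_succ {n : ℕ} (i : Fin n) :
    Equiv.swap i.succ.castSucc i.succ.succ = extendZero (Equiv.swap i.castSucc i.succ) := by
  ext1 j
  induction j using Fin.cases with
  | zero =>
    rw [extendZero_zero, Equiv.swap_apply_of_ne_of_ne] <;> simp [Fin.ext_iff]
  | succ j =>
    rw [extendZero_succ]
    simp only [Fin.castSucc_succ, Equiv.swap_apply_def, Fin.succ_inj]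
    split_ifs <;> rfl

theorem cons_cons_swap {n : ℕ} (c d : D) (a : Fin n → D) (i : Fin (n + 2)) :
    (Fin.cons d (Fin.cons c a : Fin (n + 1) → D) : Fin (n + 2) → D) (Equiv.swap 0 1 i) =
      (Fin.cons c (Fin.cons d a : Fin (n + 1) → D) : Fin (n + 2) → D) i := by
  induction i using Fin.cases with
  | zero => rw [Equiv.swap_apply_left]; rfl
  | succ i =>
    induction i using Fin.cases with
    | zero => exact congrArg _ (Equiv.swap_apply_right 0 1)
    | succ i => rw [swap_zero_one_succ_succ]; rfl

/-- The extension of a permutation by a fixed first entry. -/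
def consMap (c : D) {s t : ColorSeq D} (f : s ⟶ t) : cons c s ⟶ cons c t :=
  ⟨extendZero f.toEquiv, cons_extendZero c f.color_eq⟩

/-- The transposition of the first two entries. -/
def swapMap (c d : D) (s : ColorSeq D) : cons c (cons d s) ⟶ cons d (cons c s) :=
  ⟨(Equiv.swap 0 1 : Equiv.Perm (Fin (s.len + 2))), cons_cons_swap c d s.color⟩

/-- The morphisms of `S(D)` are generated by the transpositions of the first two entries under
composition and extension by a fixed first entry. -/
theorem hom_induction {P : ∀ {s t : ColorSeq D}, (s ⟶ t) → Prop} (id : ∀ s, P (𝟙 s))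
    (comp : ∀ {r s t} (f : r ⟶ s) (g : s ⟶ t), P f → P g → P (f ≫ g))
    (cons : ∀ c {s t} (f : s ⟶ t), P f → P (consMap c f))
    (swap : ∀ c d s, P (swapMap c d s)) {s t : ColorSeq D} (f : s ⟶ t) : P f := by
  obtain ⟨n, a⟩ := s
  obtain ⟨m, b⟩ := t
  obtain rfl : n = m := SSMC.len_eq f
  obtain ⟨σ, h⟩ := f
  change Equiv.Perm (Fin n) at σ
  induction n with
  | zero =>
    obtain rfl : a = b := Subsingleton.elim _ _
    obtain rfl : σ = 1 := Subsingleton.elim _ _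
    exact id _
  | succ n ih =>
  have hσ : σ ∈ Submonoid.closure (Set.range fun i : Fin n => Equiv.swap i.castSucc i.succ) := by
    rw [Equiv.Perm.mclosure_swap_castSucc_succ]; trivial
  induction hσ using Submonoid.closure_induction generalizing a b with
  | one =>
    obtain rfl : b = a := funext h
    exact id _
  -- The product acts by `τ` first, through the intermediate sequence `b ∘ σ`.
  | mul σ τ _ _ h₁ h₂ =>
    exact comp (r := ⟨n + 1, a⟩) (s := ⟨n + 1, b ∘ σ⟩) (t := ⟨n + 1, b⟩) _ _
      (h₂ a (b ∘ σ) h) (h₁ (b ∘ σ) b fun _ => rfl)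
  | mem σ hσ =>
    obtain ⟨i, rfl⟩ := hσ
    cases n with
    | zero => exact i.elim0
    | succ n =>
    induction i using Fin.cases with
    | zero =>
      obtain ⟨c, b, rfl⟩ : ∃ c b', b = Fin.cons c b' := ⟨_, _, (Fin.cons_self_tail b).symm⟩
      obtain ⟨d, b, rfl⟩ : ∃ d b', b = Fin.cons d b' := ⟨_, _, (Fin.cons_self_tail b).symm⟩
      -- The source is determined by the target and the permutation.
      obtain rfl : a = Fin.cons d (Fin.cons c b) := funext fun i =>
        (h i).symm.trans ((swapMap d c ⟨n, b⟩).color_eq i)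
      exact swap d c ⟨n, b⟩
    | succ i =>
      obtain ⟨c, b, rfl⟩ : ∃ c b', b = Fin.cons c b' := ⟨_, _, (Fin.cons_self_tail b).symm⟩
      obtain ⟨d, a, rfl⟩ : ∃ d a', a = Fin.cons d a' := ⟨_, _, (Fin.cons_self_tail a).symm⟩
      have h₁ : ∀ j : Fin (n + 2), (Fin.cons c b : Fin (n + 2) → D)
          (extendZero (Equiv.swap i.castSucc i.succ) j) = (Fin.cons d a : Fin (n + 2) → D) j :=
        fun j => (congrArg (fun e : Equiv.Perm (Fin (n + 2)) => (Fin.cons c b : Fin (n + 2) → D)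
          (e j)) (swap_succ_succ i)).symm.trans (h j)
      -- The transposition fixes `0`, so the first entries agree and the morphism is a `consMap`.
      obtain rfl : c = d := by simpa [extendZero_zero] using h₁ 0
      have h₂ : ∀ j, b (Equiv.swap i.castSucc i.succ j) = a j := fun j => by
        simpa [extendZero_succ] using h₁ j.succ
      have := cons c _ (ih a b (Equiv.swap i.castSucc i.succ) h₂)
      have e : (⟨Equiv.swap i.succ.castSucc i.succ.succ, h⟩ :
          (⟨n + 2, Fin.cons c a⟩ : ColorSeq D) ⟶ ⟨n + 2, Fin.cons c b⟩) =
          consMap c (s := ⟨n + 1, a⟩) (t := ⟨n + 1, b⟩) ⟨Equiv.swap i.castSucc i.succ, h₂⟩ :=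
        Hom.ext (swap_succ_succ i)
      exact e ▸ this

end ColorSeq

/-! ### The tensor functor on sequences and naturality of the permutation action. -/

namespace SSMC

variable {C : Type u} [Category.{v} C] [MonoidalCategory C] [SymmetricCategory C]

theorem permTensor_id (s : ColorSeq C) : permTensor (𝟙 s) = 𝟙 _ :=
  permAlong_one (s := s.color) (t := s.color) fun _ => rfl

theorem permTensor_comp {r s t : ColorSeq C} (f : r ⟶ s) (g : s ⟶ t) :
    permTensor (f ≫ g) = permTensor f ≫ permTensor g := by
  obtain ⟨n, a⟩ := r
  obtain ⟨m, b⟩ := s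
  obtain ⟨k, c⟩ := t
  obtain rfl : n = m := len_eq f
  obtain rfl : n = k := len_eq g
  have f₁ : ∀ i, b (f.toEquiv i) = a i := f.color_eq
  have g₁ : ∀ i, c (g.toEquiv i) = b i := g.color_eq
  exact permAlong_mul (σ := g.toEquiv) (τ := f.toEquiv) f₁ g₁ fun i => (g₁ _).trans (f₁ i)

/-- The first factor is inserted at the front, which involves no braiding. Together with
`permTensor_swapMap` this evaluates the action on the generators of `ColorSeq.hom_induction`. -/
theorem permTensor_consMap (c : C) {s t : ColorSeq C} (f : s ⟶ t) :
    permTensor (ColorSeq.consMap c f) = c ◁ permTensor f := by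
  obtain ⟨n, a⟩ := s
  obtain ⟨m, b⟩ := t
  obtain rfl : n = m := len_eq f
  have h : ∀ j, b j = (Fin.cons c b : Fin (n + 1) → C) (Fin.succAbove 0 j) := fun j => by simp
  have f₁ : ∀ j, b (f.toEquiv j) = (Fin.cons c a : Fin (n + 1) → C) j.succ := f.color_eq
  have h₀ : (Fin.cons c a : Fin (n + 1) → C) 0 = (Fin.cons c b : Fin (n + 1) → C) 0 := rfl
  refine (permAlong_succ (s := Fin.cons c a) (t := Fin.cons c b) (i := 0) (σ' := f.toEquiv) (u := b)
    (ColorSeq.extendZero f.toEquiv) (ColorSeq.cons_extendZero c f.color_eq)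
    (ColorSeq.extendZero_zero _) (fun j => ?_) h f₁ h₀).trans ?_
  · rw [ColorSeq.extendZero_succ, Fin.succAbove_zero_apply]
  · rw [insertAt_zero]
    exact (congrArg (_ ≫ ·) (id_tensorHom_id _ _)).trans (Category.comp_id _)

theorem permTensor_swapMap (c d : C) (s : ColorSeq C) :
    permTensor (ColorSeq.swapMap c d s) = (α_ c d (tensorFam s.color)).inv ≫
      (β_ c d).hom ▷ tensorFam s.color ≫ (α_ d c (tensorFam s.color)).hom := by
  refine (permAlong_swap (r := Fin.cons c (Fin.cons d s.color))
    (s := Fin.cons d (Fin.cons c s.color)) (ColorSeq.cons_cons_swap c d s.color) rfl rfl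
    fun j => rfl).trans ?_
  refine congrArg (_ ≫ ·) (congrArg (_ ≫ ·) ?_)
  refine (congrArg (_ ≫ ·) ?_).trans (Category.comp_id _)
  exact (congrArg (_ ⊗ₘ ·) (id_tensorHom_id _ _)).trans (id_tensorHom_id _ _)

/-- The functor `S(C) ⥤ C` which tensors the entries of a sequence. -/
def tensorFunctor (C : Type u) [Category.{v} C] [MonoidalCategory C] [SymmetricCategory C] :
    ColorSeq C ⥤ C where
  obj s := tensorFam s.color
  map f := permTensor f
  map_id := permTensor_id
  map_comp := permTensor_comp

omit [SymmetricCategory C] in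
theorem tensorFamHom_reindex {m n : ℕ} {s t : Fin n → C} (g : ∀ i, s i ⟶ t i) {φ ψ : Fin m → Fin n}
    (h : φ = ψ) : tensorFamHom (fun j => g (φ j)) ≫ eqToHom (congrArg (tensorFam <| t ∘ ·) h) =
      eqToHom (congrArg (tensorFam <| s ∘ ·) h) ≫ tensorFamHom fun j => g (ψ j) := by
  subst h
  exact (Category.comp_id _).trans (Category.id_comp _).symm

omit [SymmetricCategory C] in
theorem insertFactor_zero_natural {n : ℕ} {s t : Fin (n + 1) → C} (g : ∀ i, s i ⟶ t i) :
    (g 0 ⊗ₘ tensorFamHom fun j => g (Fin.succAbove 0 j)) ≫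
        t 0 ◁ eqToHom (congrArg tensorFam (funext fun j =>
          congrArg t (Fin.succAbove_zero_apply j))) =
      s 0 ◁ eqToHom (congrArg tensorFam (funext fun j =>
        congrArg s (Fin.succAbove_zero_apply j))) ≫ (g 0 ⊗ₘ tensorFamHom fun j => g j.succ) := by
  rw [← id_tensorHom, ← id_tensorHom]
  refine (tensorHom_comp_tensorHom _ _ _ _).trans
    (Eq.trans ?_ (tensorHom_comp_tensorHom _ _ _ _).symm)
  rw [Category.comp_id, Category.id_comp]
  exact congrArg (g 0 ⊗ₘ ·) (tensorFamHom_reindex g (funext Fin.succAbove_zero_apply))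

omit [SymmetricCategory C] in
theorem perm_natural_step {a a' x x' y y' z z' t t' : C} (f : a ⟶ a') (p : x ⟶ x') (q : y ⟶ y')
    (r : z ⟶ z') (k : t ⟶ t') (e : x = y) (e' : x' = y') (i : y ⟶ z) (i' : y' ⟶ z')
    (j : a ⊗ z ⟶ t) {j' : a' ⊗ z' ⟶ t'} (h : p ≫ eqToHom e' = eqToHom e ≫ q)
    (h' : q ≫ i' = i ≫ r) (h'' : (f ⊗ₘ r) ≫ j' = j ≫ k) :
    (f ⊗ₘ p) ≫ a' ◁ (eqToHom e' ≫ i') ≫ j' = (a ◁ (eqToHom e ≫ i) ≫ j) ≫ k := by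
  subst e e'
  obtain rfl : p = q := by simpa using h
  rw [Category.assoc, ← h'', ← id_tensorHom, ← id_tensorHom, tensorHom_comp_tensorHom_assoc,
    tensorHom_comp_tensorHom_assoc]
  simp [h']

/-- Naturality of the associator and of the braiding handles the passage of `b` past `a`; `h'`
handles the factors behind `a`. -/
theorem insert_natural_step {a a' b b' x x' y y' z z' : C} (f : a ⟶ a') (g : b ⟶ b') (p : x ⟶ x')
    (q : y ⟶ y') (r : z ⟶ z') (e : x = y) (e' : x' = y') (i : b ⊗ y ⟶ z) (i' : b' ⊗ y' ⟶ z')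
    (h : p ≫ eqToHom e' = eqToHom e ≫ q) (h' : (g ⊗ₘ q) ≫ i' = i ≫ r) :
    (g ⊗ₘ (f ⊗ₘ p)) ≫ (α_ b' a' x').inv ≫ (β_ b' a').hom ▷ x' ≫ (α_ a' b' x').hom ≫
        a' ◁ (b' ◁ eqToHom e' ≫ i') =
      ((α_ b a x).inv ≫ (β_ b a).hom ▷ x ≫ (α_ a b x).hom ≫ a ◁ (b ◁ eqToHom e ≫ i)) ≫
        (f ⊗ₘ r) := by
  subst e e'
  obtain rfl : p = q := by simpa using h
  have h₁ : ((g ⊗ₘ f) ⊗ₘ p) ≫ (β_ b' a').hom ▷ x' = (β_ b a).hom ▷ x ≫ ((f ⊗ₘ g) ⊗ₘ p) := by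
    rw [← tensorHom_id, ← tensorHom_id, tensorHom_comp_tensorHom, tensorHom_comp_tensorHom,
      BraidedCategory.braiding_naturality, Category.id_comp, Category.comp_id]
  have h₂ : (f ⊗ₘ (g ⊗ₘ p)) ≫ a' ◁ i' = a ◁ i ≫ (f ⊗ₘ r) := by
    rw [← id_tensorHom, ← id_tensorHom, tensorHom_comp_tensorHom, tensorHom_comp_tensorHom,
      h', Category.id_comp, Category.comp_id]
  simp only [eqToHom_refl, MonoidalCategory.whiskerLeft_id, Category.id_comp, Category.assoc]
  rw [associator_inv_naturality_assoc, reassoc_of% h₁, associator_naturality_assoc, h₂]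

theorem insertFactor_natural {n : ℕ} {s t : Fin (n + 1) → C} (g : ∀ i, s i ⟶ t i)
    (i : Fin (n + 1)) : (g i ⊗ₘ tensorFamHom fun j => g (i.succAbove j)) ≫ insertFactor t i =
      insertFactor s i ≫ tensorFamHom g := by
  induction n with
  | zero =>
    obtain rfl : i = 0 := Fin.fin_one_eq_zero i
    rw [insertFactor_zero, insertFactor_zero]
    exact insertFactor_zero_natural _
  | succ n ih =>
  induction i using Fin.cases with
  | zero => 
    rw [insertFactor_zero, insertFactor_zero]
    exact insertFactor_zero_natural _
  | succ i =>
    rw [insertFactor_succ, insertFactor_succ]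
    exact insert_natural_step (g 0) (g i.succ) _ _ _ _ _ _ _
      (tensorFamHom_reindex g (funext (Fin.succ_succAbove_succ i))) (ih (fun j => g j.succ) i)

/-- Needed for equivariance in the outer operation, where a family of inner operations has to cross
a permutation. -/
theorem permFactors_natural {n : ℕ} {s t : Fin n → C} (g : ∀ i, s i ⟶ t i)
    (σ : Equiv.Perm (Fin n)) : tensorFamHom (fun i => g (σ i)) ≫ permFactors σ t =
      permFactors σ s ≫ tensorFamHom g := by
  induction n with
  | zero => rfl
  | succ n ih =>
    exact perm_natural_step (g (σ 0)) _ _ _ _ _ _ _ _ _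
      (tensorFamHom_reindex g (funext fun j => (succAbove_restPerm σ j).symm))
      (ih (fun j => g ((σ 0).succAbove j)) (restPerm σ)) (insertFactor_natural g (σ 0))

end SSMC

/-! ### Morphisms of a strict monoidal category up to identity casts. -/

namespace CategoryTheory.Arrow

variable {E : Type*} [Category* E]

theorem mk_eqToHom {X Y : E} (h : X = Y) : Arrow.mk (eqToHom h) = Arrow.mk (𝟙 X) := by
  subst h; rfl

theorem mk_eqToHom' {X Y : E} (h : X = Y) : Arrow.mk (eqToHom h) = Arrow.mk (𝟙 Y) := by
  subst h; rfl

/-- Equality of arrows is equality of morphisms up to `eqToHom` at both ends. It is compatible with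
composition, so composites can be compared factor by factor without tracking casts. -/
theorem mk_comp_congr {X Y Z X' Y' Z' : E} {f : X ⟶ Y} {g : Y ⟶ Z} {f' : X' ⟶ Y'}
    {g' : Y' ⟶ Z'} (hf : Arrow.mk f = Arrow.mk f') (hg : Arrow.mk g = Arrow.mk g') :
    Arrow.mk (f ≫ g) = Arrow.mk (f' ≫ g') := by
  obtain ⟨rfl, rfl, rfl⟩ := (Arrow.mk_eq_mk_iff _ _).1 hf
  obtain ⟨h, rfl, rfl⟩ := (Arrow.mk_eq_mk_iff _ _).1 hg
  simp

theorem mk_map_congr {E' : Type*} [Category* E'] (G : E ⥤ E') {X Y X' Y' : E} {f : X ⟶ Y}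
    {g : X' ⟶ Y'} (h : Arrow.mk f = Arrow.mk g) : Arrow.mk (G.map f) = Arrow.mk (G.map g) :=
  congrArg G.mapArrow.obj h

variable [MonoidalCategory E]

theorem mk_braiding_congr [BraidedCategory E] {X Y X' Y' : E} (h : X = X') (h' : Y = Y') :
    Arrow.mk (β_ X Y).hom = Arrow.mk (β_ X' Y').hom := by rw [h, h']

variable [IsStrictMonoidal E]

theorem mk_tensorHom_assoc {X Y X' Y' X'' Y'' : E} (f : X ⟶ Y) (g : X' ⟶ Y')
    (h : X'' ⟶ Y'') : Arrow.mk ((f ⊗ₘ g) ⊗ₘ h) = Arrow.mk (f ⊗ₘ (g ⊗ₘ h)) :=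
  (Arrow.mk_eq_mk_iff _ _).2 ⟨IsStrictMonoidal.tensor_assoc _ _ _,
    IsStrictMonoidal.tensor_assoc _ _ _, by
      rw [← IsStrictMonoidal.associator_hom, ← associator_naturality_assoc,
        IsStrictMonoidal.associator_hom]
      simp⟩

theorem mk_id_tensorHom {X Y : E} (f : X ⟶ Y) :
    Arrow.mk (𝟙 (𝟙_ E) ⊗ₘ f) = Arrow.mk f :=
  (Arrow.mk_eq_mk_iff _ _).2 ⟨IsStrictMonoidal.unit_tensor _, IsStrictMonoidal.unit_tensor _, by
      rw [← IsStrictMonoidal.leftUnitor_hom, id_tensorHom, ← leftUnitor_naturality_assoc,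
        IsStrictMonoidal.leftUnitor_hom]
      simp⟩

theorem mk_tensorHom_id {X Y : E} (f : X ⟶ Y) :
    Arrow.mk (f ⊗ₘ 𝟙 (𝟙_ E)) = Arrow.mk f :=
  (Arrow.mk_eq_mk_iff _ _).2 ⟨IsStrictMonoidal.tensor_unit _, IsStrictMonoidal.tensor_unit _, by
      rw [← IsStrictMonoidal.rightUnitor_hom, tensorHom_id, ← rightUnitor_naturality_assoc,
        IsStrictMonoidal.rightUnitor_hom]
      simp⟩

/-- The morphisms of a strict monoidal category form a monoid under the tensor product. -/
instance : Monoid (Arrow E) where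
  mul f g := Arrow.mk (f.hom ⊗ₘ g.hom)
  one := Arrow.mk (𝟙 (𝟙_ E))
  mul_assoc f g h := Arrow.mk_tensorHom_assoc f.hom g.hom h.hom
  one_mul f := Arrow.mk_id_tensorHom f.hom
  mul_one f := Arrow.mk_tensorHom_id f.hom

theorem mk_tensor {X Y X' Y' : E} (f : X ⟶ Y) (g : X' ⟶ Y') :
    Arrow.mk (f ⊗ₘ g) = Arrow.mk f * Arrow.mk g := rfl

theorem mk_id_tensor (X Y : E) :
    Arrow.mk (𝟙 (X ⊗ Y)) = Arrow.mk (𝟙 X) * Arrow.mk (𝟙 Y) := by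
  rw [← Arrow.mk_tensor, id_tensorHom_id]

theorem mk_whiskerLeft_eq_mul (X : E) {Y Z : E} (f : Y ⟶ Z) :
    Arrow.mk (X ◁ f) = Arrow.mk (𝟙 X) * Arrow.mk f := by rw [← Arrow.mk_tensor, id_tensorHom]

theorem mk_whiskerRight_eq_mul (X : E) {Y Z : E} (f : Y ⟶ Z) :
    Arrow.mk (f ▷ X) = Arrow.mk f * Arrow.mk (𝟙 X) := by rw [← Arrow.mk_tensor, tensorHom_id]

theorem mk_associator_hom (X Y Z : E) : Arrow.mk (α_ X Y Z).hom = Arrow.mk (𝟙 (X ⊗ Y ⊗ Z)) := by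
  rw [IsStrictMonoidal.associator_hom, mk_eqToHom']

theorem mk_associator_inv (X Y Z : E) : Arrow.mk (α_ X Y Z).inv = Arrow.mk (𝟙 (X ⊗ Y ⊗ Z)) := by
  have h : (α_ X Y Z).inv = eqToHom (IsStrictMonoidal.tensor_assoc X Y Z).symm := by
    rw [← cancel_epi (α_ X Y Z).hom, Iso.hom_inv_id, IsStrictMonoidal.associator_hom]
    simp
  rw [h, mk_eqToHom]

theorem mk_associator_inv_comp {X Y Z W : E} (f : (X ⊗ Y) ⊗ Z ⟶ W) :
    Arrow.mk ((α_ X Y Z).inv ≫ f) = Arrow.mk f := by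
  have h : (α_ X Y Z).inv = eqToHom (IsStrictMonoidal.tensor_assoc X Y Z).symm := by
    rw [← cancel_epi (α_ X Y Z).hom, Iso.hom_inv_id, IsStrictMonoidal.associator_hom]
    simp
  rw [h, arrow_mk_eqToHom_comp]

theorem mk_comp_associator_hom {X Y Z W : E} (f : W ⟶ (X ⊗ Y) ⊗ Z) :
    Arrow.mk (f ≫ (α_ X Y Z).hom) = Arrow.mk f := by
  rw [IsStrictMonoidal.associator_hom, arrow_mk_comp_eqToHom]

theorem mk_braiding_unit_left [BraidedCategory E] (X : E) :
    Arrow.mk (β_ (𝟙_ E) X).hom = Arrow.mk (𝟙 X) := by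
  have h : (ρ_ X).inv = eqToHom (IsStrictMonoidal.tensor_unit X).symm := by
    rw [← cancel_epi (ρ_ X).hom, Iso.hom_inv_id, IsStrictMonoidal.rightUnitor_hom]
    simp
  rw [braiding_tensorUnit_left, IsStrictMonoidal.leftUnitor_hom, h, arrow_mk_eqToHom_comp,
    mk_eqToHom]

/-- The tensor product of a family of morphisms is their product in the monoid of arrows. -/
theorem mk_tensorFamHom {n : ℕ} {s t : Fin n → E} (f : ∀ i, s i ⟶ t i) :
    Arrow.mk (SSMC.tensorFamHom f) = (List.ofFn fun i => Arrow.mk (f i)).prod := by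
  induction n with
  | zero => rw [List.ofFn_zero]; rfl
  | succ n ih => rw [List.ofFn_succ, List.prod_cons, ← ih]; rfl

end CategoryTheory.Arrow

/-! ### Strict symmetric monoidal functors in terms of arrows. -/

section StrictFunctors

variable {A E : Type*} [Category* A] [Category* E] [MonoidalCategory A] [MonoidalCategory E]

theorem obj_tensor_of_mk_map_tensor {G : A ⥤ E}
    (h : ∀ {X Y X' Y' : A} (f : X ⟶ Y) (g : X' ⟶ Y'),
      Arrow.mk (G.map (f ⊗ₘ g)) = Arrow.mk (G.map f ⊗ₘ G.map g)) (X Y : A) :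
    G.obj (X ⊗ Y) = G.obj X ⊗ G.obj Y :=
  congrArg Comma.left (h (𝟙 X) (𝟙 Y))

variable [SymmetricCategory A] [SymmetricCategory E]

theorem IsStrictSymmetric.of_mk {G : A ⥤ E} (h₀ : G.obj (𝟙_ A) = 𝟙_ E)
    (h : ∀ {X Y X' Y' : A} (f : X ⟶ Y) (g : X' ⟶ Y'),
      Arrow.mk (G.map (f ⊗ₘ g)) = Arrow.mk (G.map f ⊗ₘ G.map g))
    (h' : ∀ X Y : A, Arrow.mk (G.map (β_ X Y).hom) = Arrow.mk (β_ (G.obj X) (G.obj Y)).hom) :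
    IsStrictSymmetric G where
  obj_unit := h₀
  obj_tensor := obj_tensor_of_mk_map_tensor h
  map_tensor f g := ((Arrow.mk_eq_mk_iff _ _).1 (h f g)).2.2
  map_braiding X Y := ((Arrow.mk_eq_mk_iff _ _).1 (h' X Y)).2.2

theorem IsStrictSymmetric.mk_map_tensor {G : A ⥤ E} (hG : IsStrictSymmetric G) {X Y X' Y' : A}
    (f : X ⟶ Y) (g : X' ⟶ Y') : Arrow.mk (G.map (f ⊗ₘ g)) = Arrow.mk (G.map f ⊗ₘ G.map g) :=
  (Arrow.mk_eq_mk_iff _ _).2 ⟨_, hG.obj_tensor _ _, hG.map_tensor f g⟩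

theorem IsStrictSymmetric.mk_map_braiding {G : A ⥤ E} (hG : IsStrictSymmetric G) (X Y : A) :
    Arrow.mk (G.map (β_ X Y).hom) = Arrow.mk (β_ (G.obj X) (G.obj Y)).hom :=
  (Arrow.mk_eq_mk_iff _ _).2 ⟨_, hG.obj_tensor _ _, hG.map_braiding X Y⟩

variable [IsStrictMonoidal A] [IsStrictMonoidal E]

/-- By the hexagon, the braiding of `X ⊗ Y` with `Z` is composed of those of `X` and `Y` with `Z`,
up to associators, which are identities here. -/
theorem mk_map_braiding_tensor_left {G : A ⥤ E}
    (h : ∀ {X Y X' Y' : A} (f : X ⟶ Y) (g : X' ⟶ Y'),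
      Arrow.mk (G.map (f ⊗ₘ g)) = Arrow.mk (G.map f ⊗ₘ G.map g)) {X Y Z : A}
    (hX : Arrow.mk (G.map (β_ X Z).hom) = Arrow.mk (β_ (G.obj X) (G.obj Z)).hom)
    (hY : Arrow.mk (G.map (β_ Y Z).hom) = Arrow.mk (β_ (G.obj Y) (G.obj Z)).hom) :
    Arrow.mk (G.map (β_ (X ⊗ Y) Z).hom) = Arrow.mk (β_ (G.obj (X ⊗ Y)) (G.obj Z)).hom := by
  have ho := obj_tensor_of_mk_map_tensor h
  have hα (X Y Z : A) : Arrow.mk (G.map (α_ X Y Z).hom) =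
      Arrow.mk (α_ (G.obj X) (G.obj Y) (G.obj Z)).hom := by
    rw [Arrow.mk_map_congr G (Arrow.mk_associator_hom X Y Z), Arrow.mk_associator_hom, G.map_id,
      ho, ho]
  have hα' (X Y Z : A) : Arrow.mk (G.map (α_ X Y Z).inv) =
      Arrow.mk (α_ (G.obj X) (G.obj Y) (G.obj Z)).inv := by
    rw [Arrow.mk_map_congr G (Arrow.mk_associator_inv X Y Z), Arrow.mk_associator_inv, G.map_id,
      ho, ho]
  rw [Arrow.mk_braiding_congr (ho X Y) rfl, BraidedCategory.braiding_tensor_left_hom,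
    BraidedCategory.braiding_tensor_left_hom]
  simp only [G.map_comp]
  refine Arrow.mk_comp_congr (hα _ _ _) (Arrow.mk_comp_congr ?_ (Arrow.mk_comp_congr (hα' _ _ _)
    (Arrow.mk_comp_congr ?_ (hα _ _ _))))
  · rw [← id_tensorHom, h, Arrow.mk_whiskerLeft_eq_mul, Arrow.mk_tensor, hY, G.map_id]
  · rw [← tensorHom_id, h, Arrow.mk_whiskerRight_eq_mul, Arrow.mk_tensor, hX, G.map_id]

omit [IsStrictMonoidal A] [IsStrictMonoidal E] in
-- By symmetry the two braidings are inverse to each other, and functors preserve inverses.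
theorem mk_map_braiding_symm {G : A ⥤ E} {X Y : A} 
    (h : Arrow.mk (G.map (β_ X Y).hom) = Arrow.mk (β_ (G.obj X) (G.obj Y)).hom) :
    Arrow.mk (G.map (β_ Y X).hom) = Arrow.mk (β_ (G.obj Y) (G.obj X)).hom := by
  obtain ⟨h₁, h₂, h₃⟩ := (Arrow.mk_eq_mk_iff _ _).1 h
  refine (Arrow.mk_eq_mk_iff _ _).2 ⟨h₂, h₁, ?_⟩
  have : IsIso (G.map (β_ X Y).hom) := inferInstance
  rw [← cancel_epi (G.map (β_ X Y).hom), ← G.map_comp, SymmetricCategory.symmetry, h₃]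
  simp

omit [IsStrictMonoidal A] in
theorem IsStrictSymmetric.mk_map_tensorFamHom {G : A ⥤ E} (hG : IsStrictSymmetric G) {n : ℕ}
    {s t : Fin n → A} (f : ∀ i, s i ⟶ t i) : Arrow.mk (G.map (SSMC.tensorFamHom f)) =
      Arrow.mk (SSMC.tensorFamHom fun i => G.map (f i)) := by
  induction n with
  | zero =>
    change Arrow.mk (G.map (𝟙 (𝟙_ A))) = Arrow.mk (𝟙 (𝟙_ E))
    rw [G.map_id, hG.obj_unit]
  | succ n ih =>
    exact (hG.mk_map_tensor _ _).trans (congrArg (Arrow.mk (G.map (f 0)) * ·) (ih _))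

end StrictFunctors

/-! ### Uniqueness of strict symmetric monoidal functors on `S(D)`. -/

namespace ColorSeq

variable {D : Type u}

/-- Equal sequences may have lengths that are not definitionally equal, so permutations are compared
through their values in `ℕ`. -/
theorem mk_eq_mk {s t s' t' : ColorSeq D} {f : s ⟶ t} {g : s' ⟶ t'} (hs : s = s') (ht : t = t')
    (h : ∀ i : Fin s.len, (f.toEquiv i : ℕ) =
      g.toEquiv (Fin.cast (congrArg ColorSeq.len hs) i)) : Arrow.mk f = Arrow.mk g := by
  subst hs ht
  exact congrArg Arrow.mk (hom_ext fun i => Fin.ext (h i))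

theorem single_tensor (c : D) (s : ColorSeq D) : single c ⊗ s = cons c s :=
  eq_of_ofFn (by
    change List.ofFn (Fin.append (fun _ : Fin 1 => c) s.color) =
      List.ofFn (Fin.cons c s.color : Fin (s.len + 1) → D)
    rw [List.ofFn_fin_append, List.ofFn_cons]
    simp)

theorem cast_zero_eq_castAdd {n : ℕ} (h : n + 1 = 1 + n) :
    Fin.cast h 0 = Fin.castAdd n (0 : Fin 1) := rfl

theorem cast_succ_eq_natAdd {n : ℕ} (h : n + 1 = 1 + n) (i : Fin n) :
    Fin.cast h i.succ = Fin.natAdd 1 i := Fin.ext (by simp [Nat.add_comm])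

theorem extendZero_val {m n : ℕ} (e : Fin m ≃ Fin n) (h : m + 1 = 1 + m) (i : Fin (m + 1)) :
    (extendZero e i : ℕ) = blockSum (Equiv.refl (Fin 1)) e (Fin.cast h i) := by
  induction i using Fin.cases with
  | zero => rw [cast_zero_eq_castAdd, blockSum_castAdd, extendZero_zero]; rfl
  | succ i => 
    rw [cast_succ_eq_natAdd, blockSum_natAdd, extendZero_succ]
    simp [Nat.add_comm]

theorem swap_val {n : ℕ} (h : n + 2 = 1 + 1 + n) (i : Fin (n + 2)) :
    ((Equiv.swap 0 1 : Equiv.Perm (Fin (n + 2))) i : ℕ) = blockSum (blockSwap 1 1) (Equiv.refl (Fin n)) (Fin.cast h i) := by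
  induction i using Fin.cases with
  | zero => 
    rw [show Fin.cast h 0 = Fin.castAdd n (Fin.castAdd 1 0) from rfl, blockSum_castAdd,
      blockSwap_castAdd, Equiv.swap_apply_left]
    rfl
  | succ i =>
  induction i using Fin.cases with
  | zero =>
    rw [show Fin.cast h (Fin.succ 0) = Fin.castAdd n (Fin.natAdd 1 0) from rfl, blockSum_castAdd,
      blockSwap_natAdd]
    exact congrArg Fin.val (Equiv.swap_apply_right (0 : Fin (n + 2)) 1)
  | succ i =>
    rw [show Fin.cast h i.succ.succ = Fin.natAdd (1 + 1) i from
      Fin.ext (by simp; omega),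
      blockSum_natAdd, swap_zero_one_succ_succ]
    simp
    omega

/-- With `mk_swapMap`, this expresses the generators by tensor products and braidings, on which a
strict symmetric monoidal functor can be evaluated. -/
theorem mk_consMap (c : D) {s t : ColorSeq D} (f : s ⟶ t) :
    Arrow.mk (consMap c f) = Arrow.mk (𝟙 (single c) ⊗ₘ f) :=
  mk_eq_mk (single_tensor c s).symm (single_tensor c t).symm fun i => extendZero_val f.toEquiv _ i

theorem single_tensor_single_tensor (c d : D) (s : ColorSeq D) :
    (single c ⊗ single d) ⊗ s = cons c (cons d s) := by
  rw [IsStrictMonoidal.tensor_assoc, single_tensor, single_tensor]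

theorem mk_swapMap (c d : D) (s : ColorSeq D) :
    Arrow.mk (swapMap c d s) = Arrow.mk ((β_ (single c) (single d)).hom ⊗ₘ 𝟙 s) :=
  mk_eq_mk (single_tensor_single_tensor c d s).symm (single_tensor_single_tensor d c s).symm
    fun i => swap_val _ i

/-- Induction on the length of a sequence. -/
theorem cons_induction {P : ColorSeq D → Prop} (unit : P (𝟙_ (ColorSeq D)))
    (cons : ∀ c s, P s → P (cons c s)) (s : ColorSeq D) : P s := by
  obtain ⟨n, a⟩ := s
  induction n with
  | zero =>
    obtain rfl : a = Fin.elim0 := Subsingleton.elim _ _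
    exact unit
  | succ n ih =>
    obtain ⟨c, a, rfl⟩ : ∃ c b', a = Fin.cons c b' := ⟨_, _, (Fin.cons_self_tail a).symm⟩
    exact cons c ⟨n, a⟩ (ih a)

/-- Strict symmetric monoidal functors on `S(D)` are determined by their values on `D`. -/
theorem mk_map_eq_mk_map {E : Type*} [Category* E] [MonoidalCategory E] [SymmetricCategory E]
    [IsStrictMonoidal E] {G H : ColorSeq D ⥤ E} (hG : IsStrictSymmetric G)
    (hH : IsStrictSymmetric H) (h : ∀ c, G.obj (single c) = H.obj (single c)) {s t : ColorSeq D}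
    (f : s ⟶ t) : Arrow.mk (G.map f) = Arrow.mk (H.map f) := by
  have h' : ∀ s, G.obj s = H.obj s := fun s => by
    induction s using cons_induction with
    | unit => rw [hG.obj_unit, hH.obj_unit]
    | cons c s ih => rw [← single_tensor, hG.obj_tensor, hH.obj_tensor, ih, h]
  -- Objects agree by `h'`. Both functors preserve composites, tensor products and braidings, so
  -- agreement passes to all generators and their composites.
  induction f using hom_induction with
  | id s => rw [G.map_id, H.map_id, h']
  | comp f g hf hg =>
    rw [G.map_comp, H.map_comp]
    exact Arrow.mk_comp_congr hf hg
  | cons c f hf =>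
    rw [Arrow.mk_map_congr G (mk_consMap c f), Arrow.mk_map_congr H (mk_consMap c f),
      hG.mk_map_tensor, hH.mk_map_tensor, Arrow.mk_tensor, Arrow.mk_tensor, hf, G.map_id, H.map_id,
      h]
  | swap c d s =>
    rw [Arrow.mk_map_congr G (mk_swapMap c d s), Arrow.mk_map_congr H (mk_swapMap c d s),
      hG.mk_map_tensor, hH.mk_map_tensor, Arrow.mk_tensor, Arrow.mk_tensor, hG.mk_map_braiding,
      hH.mk_map_braiding, Arrow.mk_braiding_congr (h c) (h d), G.map_id, H.map_id, h']

end ColorSeq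

/-! ### The tensor functor is strict symmetric monoidal. -/

namespace SSMC

variable {C : Type u} [Category.{v} C] [MonoidalCategory C] [SymmetricCategory C]
  [IsStrictMonoidal C]

open ColorSeq

/-- Induction over the generators in `f`, with `g` arbitrary. Associativity in the monoid of arrows
treats tensoring with a single entry, and the interchange law `hcomp` treats composites. -/
theorem mk_tensorFunctor_tensor {s t s' t' : ColorSeq C} (f : s ⟶ t) (g : s' ⟶ t') :
    Arrow.mk ((tensorFunctor C).map (f ⊗ₘ g)) =
      Arrow.mk ((tensorFunctor C).map f ⊗ₘ (tensorFunctor C).map g) := by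
  have hc (c : C) {s t : ColorSeq C} (f : s ⟶ t) :
      Arrow.mk ((tensorFunctor C).map (𝟙 (single c) ⊗ₘ f)) =
        Arrow.mk (𝟙 c) * Arrow.mk ((tensorFunctor C).map f) := by
    rw [← Arrow.mk_map_congr _ (mk_consMap c f)]
    exact (congrArg Arrow.mk (permTensor_consMap c f)).trans (Arrow.mk_whiskerLeft_eq_mul _ _)
  have hs (c d : C) (s : ColorSeq C) :
      Arrow.mk ((tensorFunctor C).map ((β_ (single c) (single d)).hom ⊗ₘ 𝟙 s)) =
        Arrow.mk (β_ c d).hom * Arrow.mk (𝟙 ((tensorFunctor C).obj s)) := by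
    rw [← Arrow.mk_map_congr _ (mk_swapMap c d s)]
    exact (congrArg Arrow.mk (permTensor_swapMap c d s)).trans
      ((Arrow.mk_associator_inv_comp _).trans ((Arrow.mk_comp_associator_hom _).trans
        (Arrow.mk_whiskerRight_eq_mul _ _)))
  have hid (s : ColorSeq C) {s' t' : ColorSeq C} (g : s' ⟶ t') :
      Arrow.mk ((tensorFunctor C).map (𝟙 s ⊗ₘ g)) =
        Arrow.mk (𝟙 ((tensorFunctor C).obj s)) * Arrow.mk ((tensorFunctor C).map g) := by
    induction s using cons_induction with
    | unit =>
      rw [Arrow.mk_map_congr _ (Arrow.mk_id_tensorHom g)]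
      exact (one_mul _).symm
    | cons c s ih =>
      have e : Arrow.mk (𝟙 ((tensorFunctor C).obj (single c ⊗ s))) =
          Arrow.mk (𝟙 c) * Arrow.mk (𝟙 ((tensorFunctor C).obj s)) := by
        have := hc c (𝟙 s)
        rwa [id_tensorHom_id, CategoryTheory.Functor.map_id, CategoryTheory.Functor.map_id] at this
      rw [← single_tensor, ← id_tensorHom_id,
        Arrow.mk_map_congr _ (Arrow.mk_tensorHom_assoc (𝟙 (single c)) (𝟙 s) g), hc, ih, e,
        mul_assoc]
  have hid' (s s' : ColorSeq C) : Arrow.mk (𝟙 ((tensorFunctor C).obj (s ⊗ s'))) =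
      Arrow.mk (𝟙 ((tensorFunctor C).obj s)) * Arrow.mk (𝟙 ((tensorFunctor C).obj s')) := by
    have := hid s (𝟙 s')
    rwa [id_tensorHom_id, CategoryTheory.Functor.map_id, CategoryTheory.Functor.map_id] at this
  have hcomp {r s t r' s' t' : ColorSeq C} (f : r ⟶ s) (f' : s ⟶ t) (g : r' ⟶ s') (g' : s' ⟶ t')
      (h : Arrow.mk ((tensorFunctor C).map (f ⊗ₘ g)) =
        Arrow.mk ((tensorFunctor C).map f ⊗ₘ (tensorFunctor C).map g))
      (h' : Arrow.mk ((tensorFunctor C).map (f' ⊗ₘ g')) =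
        Arrow.mk ((tensorFunctor C).map f' ⊗ₘ (tensorFunctor C).map g')) :
      Arrow.mk ((tensorFunctor C).map ((f ≫ f') ⊗ₘ (g ≫ g'))) =
        Arrow.mk ((tensorFunctor C).map (f ≫ f') ⊗ₘ (tensorFunctor C).map (g ≫ g')) := by
    rw [← tensorHom_comp_tensorHom, Functor.map_comp, Functor.map_comp, Functor.map_comp,
      ← tensorHom_comp_tensorHom]
    exact Arrow.mk_comp_congr h h'
  induction f using hom_induction generalizing s' t' with
  | id s =>
    rw [CategoryTheory.Functor.map_id]
    exact hid s g
  -- Split as `(f ⊗ 1) ≫ (f' ⊗ g)`.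
  | comp f f' hf hf' => simpa using hcomp f f' (𝟙 s') g (hf _) (hf' _)
  | cons c f hf =>
    rw [Arrow.mk_tensor, Arrow.mk_map_congr _ (mk_consMap c f), hc, mul_assoc]
    refine (Arrow.mk_map_congr _ ((congrArg (· * Arrow.mk g) (mk_consMap c f)).trans
      (mul_assoc (Arrow.mk (𝟙 (single c))) (Arrow.mk f) (Arrow.mk g)))).trans ?_
    exact (hc c (f ⊗ₘ g)).trans (congrArg (Arrow.mk (𝟙 c) * ·) (hf g))
  | swap c d s =>
    have h : Arrow.mk ((tensorFunctor C).map (swapMap c d s ⊗ₘ 𝟙 s')) =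
        Arrow.mk ((tensorFunctor C).map (swapMap c d s) ⊗ₘ (tensorFunctor C).map (𝟙 s')) := by
      rw [Arrow.mk_tensor, Arrow.mk_map_congr _ (mk_swapMap c d s), hs, mul_assoc,
        CategoryTheory.Functor.map_id, ← hid', ← hs]
      refine Arrow.mk_map_congr _ ((congrArg (· * Arrow.mk (𝟙 s')) (mk_swapMap c d s)).trans
        ((mul_assoc (Arrow.mk (β_ (single c) (single d)).hom) (Arrow.mk (𝟙 s))
          (Arrow.mk (𝟙 s'))).trans ?_))
      rw [← Arrow.mk_id_tensor]; rfl
    -- Split as `(swap ⊗ 1) ≫ (1 ⊗ g)`, whose factors are covered by `h` and `hid`.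
    have := hcomp (swapMap c d s) (𝟙 _) (𝟙 s') g h (by
      rw [CategoryTheory.Functor.map_id]; exact hid _ g)
    rwa [Category.comp_id, Category.id_comp] at this

/-- Only the braidings remain. The hexagon shortens one argument at a time, down to the unit or to
two single entries, where the braiding is a transposition. -/
theorem isStrictSymmetric_tensorFunctor : IsStrictSymmetric (tensorFunctor C) := by
  have h₁ (c : C) : (tensorFunctor C).obj (single c) = c := tensorFam_single c
  have hs (c d : C) : Arrow.mk ((tensorFunctor C).map (β_ (single c) (single d)).hom) =
      Arrow.mk (β_ ((tensorFunctor C).obj (single c)) ((tensorFunctor C).obj (single d))).hom := by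
    -- Tensoring with the identity of the unit exhibits the braiding as a `swapMap` with empty tail.
    rw [← Arrow.mk_map_congr _ (Arrow.mk_tensorHom_id _), ← Arrow.mk_map_congr _ (mk_swapMap c d _),
      Arrow.mk_braiding_congr (h₁ c) (h₁ d)]
    exact (congrArg Arrow.mk (permTensor_swapMap c d _)).trans
      ((Arrow.mk_associator_inv_comp _).trans ((Arrow.mk_comp_associator_hom _).trans
        ((Arrow.mk_whiskerRight_eq_mul _ _).trans (mul_one _))))
  have hu (s : ColorSeq C) : Arrow.mk ((tensorFunctor C).map (β_ (𝟙_ (ColorSeq C)) s).hom) =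
      Arrow.mk (β_ ((tensorFunctor C).obj (𝟙_ (ColorSeq C))) ((tensorFunctor C).obj s)).hom := by
    rw [Arrow.mk_map_congr _ (Arrow.mk_braiding_unit_left s), CategoryTheory.Functor.map_id]
    exact (Arrow.mk_braiding_unit_left _).symm
  refine IsStrictSymmetric.of_mk rfl mk_tensorFunctor_tensor fun s t => ?_
  induction s using cons_induction with
  | unit => exact hu t
  | cons c s hc =>
    rw [← single_tensor]
    -- Symmetry moves `t` to the left argument, so that the same hexagon lemma serves to shorten
    -- `t`.
    refine mk_map_braiding_tensor_left mk_tensorFunctor_tensor (mk_map_braiding_symm ?_) hc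
    clear hc
    induction t using cons_induction with
    | unit => exact hu _
    | cons d t hd =>
      rw [← single_tensor]
      exact mk_map_braiding_tensor_left mk_tensorFunctor_tensor (hs d c) hd

end SSMC

/-! ### Concatenations and block permutations as tensor products in `S(D)`. -/

namespace ColorSeq

variable {D : Type u}

theorem concat_zero (s : Fin 0 → ColorSeq D) : concat s = 𝟙_ (ColorSeq D) :=
  eq_of_ofFn (by rw [ofFn_concat, List.ofFn_zero]; rfl)

theorem concat_succ {n : ℕ} (s : Fin (n + 1) → ColorSeq D) :
    concat s = s 0 ⊗ concat fun i => s i.succ :=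
  eq_of_ofFn (by
    refine Eq.trans ?_ (List.ofFn_fin_append _ _).symm
    rw [ofFn_concat, List.ofFn_succ, List.flatten_cons, ofFn_concat])

/-- This makes the results on `tensorFam` and `permTensor` available for the concatenations in the
operad axioms, with `S(D)` as the monoidal category. -/
theorem concat_eq_tensorFam {n : ℕ} (s : Fin n → ColorSeq D) : concat s = SSMC.tensorFam s := by
  induction n with
  | zero => exact concat_zero s
  | succ n ih => rw [concat_succ, ih]; rfl

theorem split_symm_zero_val {n : ℕ} (s : Fin (n + 1) → ColorSeq D) (j : Fin (s 0).len) :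
    ((split s).symm ⟨0, j⟩ : ℕ) = j := by
  change ((finSigmaFinEquiv (n := fun i => (s i).len) ⟨0, j⟩ : _) : ℕ) = j
  rw [finSigmaFinEquiv_apply]
  simp

theorem split_symm_succ_val {n : ℕ} (s : Fin (n + 1) → ColorSeq D) (i : Fin n)
    (j : Fin (s i.succ).len) : ((split s).symm ⟨i.succ, j⟩ : ℕ) =
      (s 0).len + (split fun i => s i.succ).symm ⟨i, j⟩ := by
  change ((finSigmaFinEquiv (n := fun i => (s i).len) ⟨i.succ, j⟩ : _) : ℕ) = (s 0).len +
    (finSigmaFinEquiv (n := fun i : Fin n => (s i.succ).len) ⟨i, j⟩ : _)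
  rw [finSigmaFinEquiv_apply, finSigmaFinEquiv_apply, ← Nat.add_assoc]
  congr 1
  exact Fin.sum_univ_succ (n := i) _

theorem split_symm_zero {n : ℕ} (s : Fin (n + 1) → ColorSeq D) (j : Fin (s 0).len)
    (h : (concat s).len = (s 0).len + (concat fun i => s i.succ).len) :
    Fin.cast h ((split s).symm ⟨0, j⟩) = Fin.castAdd _ j :=
  Fin.ext (split_symm_zero_val s j)

theorem split_symm_succ {n : ℕ} (s : Fin (n + 1) → ColorSeq D) (i : Fin n) (j : Fin (s i.succ).len)
    (h : (concat s).len = (s 0).len + (concat fun i => s i.succ).len) :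
    Fin.cast h ((split s).symm ⟨i.succ, j⟩) =
      Fin.natAdd _ ((split fun i => s i.succ).symm ⟨i, j⟩) :=
  Fin.ext (split_symm_succ_val s i j)

theorem forall_concat {n : ℕ} {s : Fin n → ColorSeq D} {P : Fin (concat s).len → Prop}
    (h : ∀ i j, P ((split s).symm ⟨i, j⟩)) (l : Fin (concat s).len) : P l := by
  obtain ⟨⟨i, j⟩, rfl⟩ := (split s).symm.surjective l
  exact h i j

theorem blocksMap_apply {n : ℕ} {s s' : Fin n → ColorSeq D} (τ : ∀ i, s i ⟶ s' i) (i : Fin n)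
    (j : Fin (s i).len) : (blocksMap τ).toEquiv ((split s).symm ⟨i, j⟩) =
      (split s').symm ⟨i, (τ i).toEquiv j⟩ :=
  congrArg (fun x => (split s').symm ((Equiv.sigmaCongrRight fun i => (τ i).toEquiv) x))
    ((split s).apply_symm_apply ⟨i, j⟩)

theorem mk_blocksMap {n : ℕ} {s s' : Fin n → ColorSeq D} (τ : ∀ i, s i ⟶ s' i) :
    Arrow.mk (blocksMap τ) = Arrow.mk (SSMC.tensorFamHom τ) := by
  induction n with
  | zero => exact mk_eq_mk (concat_zero s) (concat_zero s') (forall_concat fun i => i.elim0)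
  | succ n ih =>
    refine Eq.trans ?_ (congrArg (Arrow.mk (τ 0) * ·) (ih fun i => τ i.succ))
    refine mk_eq_mk (concat_succ s) (concat_succ s') (forall_concat fun i j => ?_)
    induction i using Fin.cases with
    | zero =>
      rw [split_symm_zero, blocksMap_apply]
      refine (congrArg Fin.val (split_symm_zero s' ((τ 0).toEquiv j)
        (congrArg ColorSeq.len (concat_succ s')))).trans ?_
      exact congrArg Fin.val (blockSum_castAdd _ _ _).symm
    | succ i =>
      rw [split_symm_succ, blocksMap_apply]
      refine (congrArg Fin.val (split_symm_succ s' i ((τ i.succ).toEquiv j)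
        (congrArg ColorSeq.len (concat_succ s')))).trans ?_
      refine Eq.trans ?_ (congrArg Fin.val (blockSum_natAdd _ _ _).symm)
      exact congrArg (fun l => ((Fin.natAdd _ l : Fin _) : ℕ)) 
        (blocksMap_apply (fun i => τ i.succ) i j).symm

/-- The bijection of the entries of the blocks along a morphism of `S(S(D))`. -/
def entriesEquiv {S S' : ColorSeq (ColorSeq D)} (f : S ⟶ S') :
    ((i : Fin S.len) × Fin (S.color i).len) ≃ ((i : Fin S'.len) × Fin (S'.color i).len) :=
  Equiv.sigmaCongr f.toEquiv fun i => finCongr (congrArg ColorSeq.len (f.color_eq i).symm)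

theorem entriesEquiv_apply {S S' : ColorSeq (ColorSeq D)} (f : S ⟶ S') (i : Fin S.len)
    (j : Fin (S.color i).len) : entriesEquiv f ⟨i, j⟩ =
      ⟨f.toEquiv i, Fin.cast (congrArg ColorSeq.len (f.color_eq i).symm) j⟩ := rfl

theorem color_cast {s t : ColorSeq D} (h : s = t) (j : Fin t.len) :
    s.color (Fin.cast (congrArg ColorSeq.len h.symm) j) = t.color j := by
  subst h; rfl

/-- The permutation of the blocks of a concatenation along a morphism of `S(S(D))`. -/
def blockMap {S S' : ColorSeq (ColorSeq D)} (f : S ⟶ S') : concat S.color ⟶ concat S'.color :=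
  ⟨(split _).trans ((entriesEquiv f).trans (split _).symm), forall_concat fun i j => by
    rw [Equiv.trans_apply, Equiv.trans_apply, Equiv.apply_symm_apply, entriesEquiv_apply,
      color_concat, color_concat, color_cast (f.color_eq i)]⟩

theorem blockMap_apply {S S' : ColorSeq (ColorSeq D)} (f : S ⟶ S') (i : Fin S.len)
    (j : Fin (S.color i).len) : (blockMap f).toEquiv ((split _).symm ⟨i, j⟩) =
      (split _).symm ⟨f.toEquiv i, Fin.cast (congrArg ColorSeq.len (f.color_eq i).symm) j⟩ :=
  congrArg (fun x => (split S'.color).symm (entriesEquiv f x))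
    ((split S.color).apply_symm_apply ⟨i, j⟩)

theorem blockMap_apply_of_eq {S S' : ColorSeq (ColorSeq D)} (f : S ⟶ S') {i : Fin S.len}
    {j : Fin (S.color i).len} {i' : Fin S'.len} {j' : Fin (S'.color i').len} (h : f.toEquiv i = i')
    (h' : (j : ℕ) = j') : (blockMap f).toEquiv ((split _).symm ⟨i, j⟩) =
      (split _).symm ⟨i', j'⟩ := by
  subst h
  exact (blockMap_apply f i j).trans (congrArg (fun k => (split _).symm ⟨_, k⟩) (Fin.ext h'))

theorem blockMap_id (S : ColorSeq (ColorSeq D)) : blockMap (𝟙 S) = 𝟙 _ :=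
  hom_ext (forall_concat fun i j => blockMap_apply (𝟙 S) i j)

theorem blockMap_comp {S S' S'' : ColorSeq (ColorSeq D)} (f : S ⟶ S') (g : S' ⟶ S'') :
    blockMap (f ≫ g) = blockMap f ≫ blockMap g :=
  hom_ext (forall_concat fun i j => by
    refine (blockMap_apply (f ≫ g) i j).trans (Eq.symm ?_)
    exact (congrArg (blockMap g).toEquiv (blockMap_apply f i j)).trans (blockMap_apply g _ _))

/-- Positions in the block `s` are kept; all others are shifted by `s.len` on both sides. -/
theorem mk_blockMap_consMap (s : ColorSeq D) {S S' : ColorSeq (ColorSeq D)} (f : S ⟶ S') :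
    Arrow.mk (blockMap (consMap s f)) = Arrow.mk (𝟙 s ⊗ₘ blockMap f) := by
  refine mk_eq_mk (concat_succ (Fin.cons s S.color : Fin (S.len + 1) → _))
    (concat_succ (Fin.cons s S'.color : Fin (S'.len + 1) → _)) (forall_concat fun i j => ?_)
  induction i using Fin.cases with
  | zero =>
    change Fin s.len at j
    have e : Fin.cast (congrArg ColorSeq.len (concat_succ (Fin.cons s S.color :
        Fin (S.len + 1) → ColorSeq D))) ((split (cons s S).color).symm ⟨(0 : Fin (S.len + 1)), j⟩) =
          Fin.castAdd (concat S.color).len j := split_symm_zero (cons s S).color j _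
    refine Eq.trans ?_ (congrArg (fun l => (blockSum (Equiv.refl _) (blockMap f).toEquiv l : ℕ))
      e).symm
    refine (congrArg Fin.val (blockMap_apply_of_eq (consMap s f) (i' := (0 : Fin (S'.len + 1)))
      (j' := j) (extendZero_zero _) rfl)).trans ?_
    refine (split_symm_zero_val (Fin.cons s S'.color : Fin (S'.len + 1) → _) j).trans ?_
    exact (congrArg Fin.val
      (blockSum_castAdd (Equiv.refl (Fin s.len)) (blockMap f).toEquiv j)).symm
  | succ i =>
    change Fin (S.color i).len at j
    have e : Fin.cast (congrArg ColorSeq.len (concat_succ (Fin.cons s S.color :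
        Fin (S.len + 1) → ColorSeq D))) ((split (cons s S).color).symm ⟨i.succ, j⟩) =
          Fin.natAdd s.len ((split S.color).symm ⟨i, j⟩) := split_symm_succ (cons s S).color i j _
    refine Eq.trans ?_ (congrArg (fun l => (blockSum (Equiv.refl _) (blockMap f).toEquiv l : ℕ))
      e).symm
    refine (congrArg Fin.val (blockMap_apply_of_eq (consMap s f) (i := i.succ) (j := j)
      (i' := (f.toEquiv i).succ)
      (j' := Fin.cast (congrArg ColorSeq.len (f.color_eq i).symm) j)
      (extendZero_succ _ i) rfl)).trans ?_
    refine (split_symm_succ_val (Fin.cons s S'.color : Fin (S'.len + 1) → _) _ _).trans ?_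
    refine Eq.trans ?_ (congrArg Fin.val (blockSum_natAdd _ _ _).symm)
    exact congrArg (fun l : Fin (concat S'.color).len => s.len + (l : ℕ)) (blockMap_apply f i j).symm

theorem concat_cons_cons (s s' : ColorSeq D) (S : ColorSeq (ColorSeq D)) :
    concat (cons s (cons s' S)).color = (s ⊗ s') ⊗ concat S.color := by
  rw [IsStrictMonoidal.tensor_assoc]
  exact (concat_succ _).trans (congrArg (s ⊗ ·) (concat_succ _))

theorem mk_blockMap_swapMap (s s' : ColorSeq D) (S : ColorSeq (ColorSeq D)) :
    Arrow.mk (blockMap (swapMap s s' S)) = Arrow.mk ((β_ s s').hom ⊗ₘ 𝟙 (concat S.color)) := by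
  -- The three facts `h₀`, `h₁`, `h₂` give the offsets of the first, the second and the later
  -- blocks.
  have h₀ (s s' : ColorSeq D) (j : Fin s.len) : ((split (cons s (cons s' S)).color).symm
      ⟨(0 : Fin (S.len + 2)), j⟩ : ℕ) = j := split_symm_zero_val (cons s (cons s' S)).color j
  have h₁ (s s' : ColorSeq D) (j : Fin s'.len) : ((split (cons s (cons s' S)).color).symm
      ⟨Fin.succ (0 : Fin (S.len + 1)), j⟩ : ℕ) = s.len + j :=
    (split_symm_succ_val (cons s (cons s' S)).color (0 : Fin (S.len + 1)) j).trans
      (congrArg (s.len + ·) (split_symm_zero_val (cons s' S).color j))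
  have h₂ (s s' : ColorSeq D) (i : Fin S.len) (j : Fin (S.color i).len) :
      ((split (cons s (cons s' S)).color).symm ⟨i.succ.succ, j⟩ : ℕ) =
        s.len + (s'.len + (split S.color).symm ⟨i, j⟩) :=
    (split_symm_succ_val (cons s (cons s' S)).color i.succ j).trans
      (congrArg (s.len + ·) (split_symm_succ_val (cons s' S).color i j))
  refine mk_eq_mk (concat_cons_cons s s' S) (concat_cons_cons s' s S) (forall_concat fun i j => ?_)
  induction i using Fin.cases with
  | zero =>
    refine (congrArg Fin.val (blockMap_apply_of_eq (swapMap s s' S)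
      (i' := Fin.succ (0 : Fin (S.len + 1))) (j' := j) (Equiv.swap_apply_left _ _) rfl)).trans ?_
    refine (h₁ s' s j).trans ?_
    have e : Fin.cast (congrArg ColorSeq.len (concat_cons_cons s s' S))
        ((split (cons s (cons s' S)).color).symm ⟨(0 : Fin (S.len + 2)), j⟩) =
          Fin.castAdd (concat S.color).len (Fin.castAdd s'.len j) := Fin.ext (h₀ s s' j)
    refine Eq.trans ?_ (congrArg (fun l => (blockSum (blockSwap s.len s'.len) (Equiv.refl _) l : ℕ))
      e).symm
    exact congrArg Fin.val ((blockSum_castAdd _ _ _).trans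
      (congrArg (Fin.castAdd _) (blockSwap_castAdd _ _ j))).symm
  | succ i =>
  induction i using Fin.cases with
  | zero =>
    refine (congrArg Fin.val (blockMap_apply_of_eq (swapMap s s' S)
      (i' := (0 : Fin (S.len + 2))) (j' := j) (Equiv.swap_apply_right _ _) rfl)).trans ?_
    refine (h₀ s' s j).trans ?_
    have e : Fin.cast (congrArg ColorSeq.len (concat_cons_cons s s' S))
        ((split (cons s (cons s' S)).color).symm ⟨Fin.succ (0 : Fin (S.len + 1)), j⟩) =
          Fin.castAdd (concat S.color).len (Fin.natAdd s.len j) := Fin.ext (h₁ s s' j)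
    refine Eq.trans ?_ (congrArg (fun l => (blockSum (blockSwap s.len s'.len) (Equiv.refl _) l : ℕ))
      e).symm
    exact congrArg Fin.val ((blockSum_castAdd _ _ _).trans
      (congrArg (Fin.castAdd _) (blockSwap_natAdd _ _ j))).symm
  | succ i =>
    refine (congrArg Fin.val (blockMap_apply_of_eq (swapMap s s' S)
      (i' := i.succ.succ) (j' := j) (swap_zero_one_succ_succ i) rfl)).trans ?_
    refine (h₂ s' s i j).trans ?_
    have e : Fin.cast (congrArg ColorSeq.len (concat_cons_cons s s' S))
        ((split (cons s (cons s' S)).color).symm ⟨i.succ.succ, j⟩) =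
          Fin.natAdd (s.len + s'.len) ((split S.color).symm ⟨i, j⟩) :=
      Fin.ext ((h₂ s s' i j).trans (Nat.add_assoc _ _ _).symm)
    refine Eq.trans ?_ (congrArg (fun l => (blockSum (blockSwap s.len s'.len) (Equiv.refl _) l : ℕ))
      e).symm
    exact (Nat.add_assoc _ _ _).symm.trans (congrArg Fin.val (blockSum_natAdd
      (blockSwap s.len s'.len) (Equiv.refl (Fin (concat S.color).len))
      ((split S.color).symm ⟨i, j⟩))).symm

/-- Both sides respect identities and composition and agree on extensions and transpositions.
Stating it for all morphisms of `S(S(D))`, and not only for `blockPerm`, is what makes induction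
over generators possible. -/
theorem mk_blockMap {S S' : ColorSeq (ColorSeq D)} (f : S ⟶ S') :
    Arrow.mk (blockMap f) = Arrow.mk (SSMC.permTensor f) := by
  induction f using hom_induction with
  | id S => rw [blockMap_id, SSMC.permTensor_id, concat_eq_tensorFam]
  | comp f g hf hg =>
    rw [blockMap_comp, SSMC.permTensor_comp]
    exact Arrow.mk_comp_congr hf hg
  | cons s f hf =>
    rw [mk_blockMap_consMap, SSMC.permTensor_consMap, Arrow.mk_tensor, hf]
    exact (Arrow.mk_whiskerLeft_eq_mul _ _).symm
  | swap s s' S =>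
    rw [mk_blockMap_swapMap, SSMC.permTensor_swapMap, concat_eq_tensorFam]
    exact ((Arrow.mk_associator_inv_comp _).trans ((Arrow.mk_comp_associator_hom _).trans
        (Arrow.mk_whiskerRight_eq_mul _ _))).symm

theorem isStrictSymmetric_map {C C' : Type u} (g : C → C') : IsStrictSymmetric (map g) :=
  IsStrictSymmetric.of_mk (NetMod.mapUnit_eq g).1.symm
    (fun {X Y X' Y'} _ _ => mk_eq_mk (NetMod.mapTensor_eq g X X').1.symm
      (NetMod.mapTensor_eq g Y Y').1.symm fun _ => rfl)
    fun X Y => mk_eq_mk (NetMod.mapTensor_eq g X Y).1.symm (NetMod.mapTensor_eq g Y X).1.symm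
      fun _ => rfl

end ColorSeq

/-! ### The operad axioms for `Op(C)`. -/

namespace SSMC

section

variable {C : Type*} [Category* C] {D : Type*} [Category* D] {G : C ⥤ D}

theorem eqToHom_comp_comp {a a' b b' c : D} (h₁ : a = a') (h₂ : b = b') (p : a' ⟶ b')
    (q : b' ⟶ c) :
    eqToHom h₁ ≫ p ≫ q = (eqToHom h₁ ≫ p ≫ eqToHom h₂.symm) ≫ eqToHom h₂ ≫ q := by
  simp

theorem eqToHom_comp_map_eqToHom_comp {a b b' c : C} {a₁ a₂ b₁ c₁ : D} (h₀ : a₁ = G.obj a)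
    (h : a = b) (h₁ : G.obj b = b₁) (h₂ : G.obj b' = c₁) (h₃ : a₁ = a₂) (h₄ : a₂ = b₁)
    {p : b ⟶ b'} {p' : b₁ ⟶ c₁} {k : a₂ ⟶ c₁} (hp : G.map p = eqToHom h₁ ≫ p' ≫ eqToHom h₂.symm)
    (hk : k = eqToHom h₄ ≫ p') (f : b' ⟶ c) :
    eqToHom h₀ ≫ G.map (eqToHom h ≫ p ≫ f) =
      eqToHom h₃ ≫ k ≫ eqToHom h₂.symm ≫ G.map f := by
  subst h h₁ h₂ h₃ hk
  simp [hp]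

end

section

variable {C : Type u} [Category.{v} C] [MonoidalCategory C]

theorem tensorFamHom_comp {n : ℕ} {r s t : Fin n → C} (f : ∀ i, r i ⟶ s i) (g : ∀ i, s i ⟶ t i) :
    tensorFamHom f ≫ tensorFamHom g = tensorFamHom fun i => f i ≫ g i := by
  induction n with
  | zero => exact Category.comp_id _
  | succ n ih =>
    exact (tensorHom_comp_tensorHom _ _ _ _).trans (congrArg (_ ⊗ₘ ·) (ih _ _))

theorem tensorFamHom_eqToHom {n : ℕ} {s t : Fin n → C} (h : ∀ i, s i = t i) :
    tensorFamHom (fun i => eqToHom (h i)) = eqToHom (congrArg tensorFam (funext h)) := by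
  obtain rfl : s = t := funext h
  exact tensorFamHom_id s

/-- In the monoid of arrows, both sides are products over a list, flattened or grouped into blocks.
-/
theorem mk_tensorFamHom_split [IsStrictMonoidal C] {n : ℕ} {s : Fin n → ColorSeq C}
    {r : (x : (i : Fin n) × Fin (s i).len) → C} (h : ∀ x, r x ⟶ (s x.1).color x.2) :
    Arrow.mk (tensorFamHom (s := fun l => r (ColorSeq.split s l))
        (t := (ColorSeq.concat s).color) fun l => h (ColorSeq.split s l)) =
      Arrow.mk (tensorFamHom fun i => tensorFamHom fun j => h ⟨i, j⟩) := by
  refine (Arrow.mk_tensorFamHom (t := (ColorSeq.concat s).color)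
    fun l => h (ColorSeq.split s l)).trans ((congrArg List.prod
      (ofFn_sigma (fun i => (s i).len) fun x => Arrow.mk (h x))).trans ?_)
  refine Eq.trans ?_ (Arrow.mk_tensorFamHom fun i => tensorFamHom fun j => h ⟨i, j⟩).symm
  refine List.prod_flatten.trans (congrArg List.prod ?_)
  refine List.map_ofFn.trans (congrArg List.ofFn (funext fun i => ?_))
  exact (Arrow.mk_tensorFamHom fun j => h ⟨i, j⟩).symm

variable [SymmetricCategory C]

theorem permTensor_eqToHom {s t : ColorSeq C} (h : s = t) :
    permTensor (eqToHom h) = eqToHom (by rw [h]) := by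
  subst h
  exact permTensor_id s

theorem permTensor_permHom (t : ColorSeq C) (σ : Equiv.Perm (Fin t.len)) :
    permTensor (ColorSeq.permHom t σ) = permFactors σ t.color :=
  Category.id_comp _

variable [IsStrictMonoidal C]

/-- Permuting blocks of factors is permuting the tensor products of the blocks. It follows from
uniqueness of strict symmetric monoidal functors on `S(S(C))`, since concatenating before tensoring
and tensoring blockwise agree on single blocks. -/
theorem mk_permTensor_blockPerm {n : ℕ} (s : Fin n → ColorSeq C) (σ : Equiv.Perm (Fin n)) :
    Arrow.mk (permTensor (ColorSeq.blockPerm s σ)) =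
      Arrow.mk (permFactors σ fun i => tensorFam (s i).color) := by
  have h₁ := Arrow.mk_map_congr (tensorFunctor C)
    (ColorSeq.mk_blockMap (ColorSeq.permHom ⟨n, s⟩ σ))
  have h₂ := ColorSeq.mk_map_eq_mk_map
    ((isStrictSymmetric_tensorFunctor (C := ColorSeq C)).comp
      (isStrictSymmetric_tensorFunctor (C := C)))
    ((ColorSeq.isStrictSymmetric_map (tensorFunctor C).obj).comp
      (isStrictSymmetric_tensorFunctor (C := C)))
    (fun s => congrArg (tensorFunctor C).obj (tensorFam_single s) |>.trans
      (tensorFam_single (tensorFam s.color)).symm) (ColorSeq.permHom ⟨n, s⟩ σ)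
  -- `blockPerm s σ` unfolds to `blockMap` of `permHom ⟨n, s⟩ σ`, and the cast in `permTensor` is an
  -- identity here.
  exact h₁.trans (h₂.trans (congrArg Arrow.mk (Category.id_comp _)))

theorem mk_permTensor_blocksMap {n : ℕ} {s s' : Fin n → ColorSeq C} (τ : ∀ i, s i ⟶ s' i) :
    Arrow.mk (permTensor (ColorSeq.blocksMap τ)) =
      Arrow.mk (tensorFamHom fun i => permTensor (τ i)) :=
  (Arrow.mk_map_congr (tensorFunctor C) (ColorSeq.mk_blocksMap τ)).trans
    (isStrictSymmetric_tensorFunctor.mk_map_tensorFamHom τ)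

theorem one_comp_eq {t : ColorSeq C} {c : C} (f : tensorFam t.color ⟶ c) :
    eqToHom (tensorFam_concat fun _ : Fin 1 => t) ≫ tensorFamHom (fun _ : Fin 1 => f) ≫
        eqToHom (tensorFam_single c) =
      permTensor (eqToHom (ColorSeq.concat_one t)) ≫ f := by
  rw [permTensor_eqToHom]
  refine (Arrow.mk_inj _ _).1 ?_
  refine (Arrow.arrow_mk_eqToHom_comp _ _).trans ((Arrow.arrow_mk_comp_eqToHom _ _).trans
    (Eq.trans ?_ (Arrow.arrow_mk_eqToHom_comp _ _).symm))
  exact (Arrow.mk_tensorFamHom fun _ : Fin 1 => f).trans (by simp)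

theorem comp_one_eq {t : ColorSeq C} {c : C} (f : tensorFam t.color ⟶ c) :
    eqToHom (tensorFam_concat fun i => ColorSeq.single (t.color i)) ≫
        tensorFamHom (fun i => eqToHom (tensorFam_single (t.color i))) ≫ f =
      permTensor (eqToHom (ColorSeq.concat_single t)) ≫ f := by
  rw [permTensor_eqToHom, tensorFamHom_eqToHom, eqToHom_trans_assoc]

theorem comp_assoc_eq {t : ColorSeq C} {c : C} (f : tensorFam t.color ⟶ c)
    {s : Fin t.len → ColorSeq C} (g : ∀ i, tensorFam (s i).color ⟶ t.color i)
    {r : (x : (i : Fin t.len) × Fin (s i).len) → ColorSeq C}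
    (h : ∀ x, tensorFam (r x).color ⟶ (s x.1).color x.2) :
    eqToHom (tensorFam_concat fun l => r (ColorSeq.split s l)) ≫
        tensorFamHom (s := fun l => tensorFam (r (ColorSeq.split s l)).color)
          (t := (ColorSeq.concat s).color) (fun l => h (ColorSeq.split s l)) ≫
        eqToHom (tensorFam_concat s) ≫ tensorFamHom g ≫ f =
      permTensor (eqToHom (ColorSeq.concat_concat s r)) ≫
        eqToHom (tensorFam_concat fun i => ColorSeq.concat fun j => r ⟨i, j⟩) ≫
        tensorFamHom (fun i => eqToHom (tensorFam_concat fun j => r ⟨i, j⟩) ≫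
          tensorFamHom (fun j => h ⟨i, j⟩) ≫ g i) ≫ f := by
  obtain ⟨h₁, h₂, h₃⟩ := (Arrow.mk_eq_mk_iff _ _).1 (mk_tensorFamHom_split h)
  have h₄ : tensorFamHom (fun i => eqToHom (tensorFam_concat fun j => r ⟨i, j⟩) ≫
      tensorFamHom (fun j => h ⟨i, j⟩) ≫ g i) = eqToHom (congrArg tensorFam
        (funext fun i => tensorFam_concat fun j => r ⟨i, j⟩)) ≫
        tensorFamHom (fun i => tensorFamHom fun j => h ⟨i, j⟩) ≫ tensorFamHom g := by
    rw [tensorFamHom_comp, ← tensorFamHom_eqToHom, tensorFamHom_comp]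
  rw [permTensor_eqToHom, h₃, h₄]
  simp

/-- `permFactors_natural` moves the permutation in front of the family `g`, and
`mk_permTensor_blockPerm` recognises the result as a block permutation. -/
theorem comp_act_left_eq {t : ColorSeq C} {c : C} (f : tensorFam t.color ⟶ c)
    (σ : Equiv.Perm (Fin t.len)) {s : Fin t.len → ColorSeq C}
    (g : ∀ i, tensorFam (s i).color ⟶ t.color i) :
    eqToHom (tensorFam_concat fun i => s (σ i)) ≫
        tensorFamHom (t := t.color ∘ σ) (fun i => g (σ i)) ≫
        permTensor (ColorSeq.permHom t σ) ≫ f =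
      permTensor (ColorSeq.blockPerm s σ) ≫ eqToHom (tensorFam_concat s) ≫
        tensorFamHom g ≫ f := by
  obtain ⟨h₁, h₂, h₃⟩ := (Arrow.mk_eq_mk_iff _ _).1 (mk_permTensor_blockPerm s σ)
  have h₄ : tensorFamHom (t := t.color ∘ σ) (fun i => g (σ i)) ≫
      permTensor (ColorSeq.permHom t σ) ≫ f =
      permFactors σ (fun i => tensorFam (s i).color) ≫ tensorFamHom g ≫ f := by
    rw [permTensor_permHom, ← Category.assoc, ← Category.assoc]
    exact congrArg (· ≫ f) (permFactors_natural g σ)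
  rw [h₄, h₃]
  simp

theorem comp_act_right_eq {t : ColorSeq C} {c : C} (f : tensorFam t.color ⟶ c)
    {s s' : Fin t.len → ColorSeq C} (τ : ∀ i, s i ⟶ s' i)
    (g : ∀ i, tensorFam (s' i).color ⟶ t.color i) :
    eqToHom (tensorFam_concat s) ≫ tensorFamHom (fun i => permTensor (τ i) ≫ g i) ≫ f =
      permTensor (ColorSeq.blocksMap τ) ≫ eqToHom (tensorFam_concat s') ≫
        tensorFamHom g ≫ f := by
  obtain ⟨h₁, h₂, h₃⟩ := (Arrow.mk_eq_mk_iff _ _).1 (mk_permTensor_blocksMap τ)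
  rw [← tensorFamHom_comp, h₃]
  simp

end

theorem endoStruct_isOperad (C : SSMC.{u}) : (endoStruct C).IsOperad where
  act_id {t _} f := (congrArg (· ≫ f) (permTensor_id (C := C.carrier) t)).trans
    (Category.id_comp (obj := C.carrier) f)
  act_comp σ τ f := (congrArg (· ≫ f) (permTensor_comp (C := C.carrier) σ τ)).trans
    (Category.assoc (obj := C.carrier) _ _ f)
  one_comp f := one_comp_eq (C := C.carrier) f
  comp_one f := comp_one_eq (C := C.carrier) f
  comp_assoc f _ g _ h := comp_assoc_eq (C := C.carrier) f g h
  act_comp_left f σ _ g := comp_act_left_eq (C := C.carrier) f σ g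
  act_comp_right f _ _ τ g := comp_act_right_eq (C := C.carrier) f τ g

/-! ### Strict functors induce morphisms of operads. -/

section

variable {C D : Type u} [Category.{v} C] [MonoidalCategory C] [SymmetricCategory C]
  [IsStrictMonoidal C] [Category.{v} D] [MonoidalCategory D] [SymmetricCategory D]
  [IsStrictMonoidal D] {G : C ⥤ D}

/-- The functors `S(C) ⥤ D` which apply `G` before or after tensoring are strict symmetric monoidal
and agree on single entries, so they agree on `σ`. -/
theorem map_permTensor_comp (hG : IsStrictSymmetric G) {s t : ColorSeq C} {c : C} (σ : s ⟶ t)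
    (f : tensorFam t.color ⟶ c) :
    eqToHom (obj_tensorFam hG s.color) ≫ G.map (permTensor σ ≫ f) =
      permTensor ((ColorSeq.map G.obj).map σ) ≫ eqToHom (obj_tensorFam hG t.color) ≫
        G.map f := by
  have h := ColorSeq.mk_map_eq_mk_map
    ((ColorSeq.isStrictSymmetric_map G.obj).comp (isStrictSymmetric_tensorFunctor (C := D)))
    ((isStrictSymmetric_tensorFunctor (C := C)).comp hG)
    (fun c => (tensorFam_single (G.obj c)).trans
      (congrArg G.obj (tensorFam_single c)).symm) σ
  have h' : Arrow.mk (permTensor ((ColorSeq.map G.obj).map σ)) =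
    Arrow.mk (G.map (permTensor σ)) := h
  obtain ⟨h₁, h₂, h₃⟩ := (Arrow.mk_eq_mk_iff _ _).1 h'
  exact (congrArg (_ ≫ ·) (G.map_comp _ f)).trans
    ((eqToHom_comp_comp h₁ h₂ _ _).trans (congrArg (· ≫ _) h₃.symm))

theorem map_eqToHom_comp_tensorFamHom_comp (hG : IsStrictSymmetric G) {t : ColorSeq C} {c : C}
    (f : tensorFam t.color ⟶ c) {s : Fin t.len → ColorSeq C}
    (g : ∀ i, tensorFam (s i).color ⟶ t.color i) :
    eqToHom (obj_tensorFam hG (ColorSeq.concat s).color) ≫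
        G.map (eqToHom (tensorFam_concat s) ≫ tensorFamHom g ≫ f) =
      eqToHom (tensorFam_concat fun i => (ColorSeq.map G.obj).obj (s i)) ≫
        tensorFamHom (t := G.obj ∘ t.color)
          (fun i => eqToHom (obj_tensorFam hG (s i).color) ≫ G.map (g i)) ≫
        eqToHom (obj_tensorFam hG t.color) ≫ G.map f := by
  obtain ⟨h₁, h₂, h₃⟩ := (Arrow.mk_eq_mk_iff _ _).1 (hG.mk_map_tensorFamHom g)
  have h₄ : tensorFamHom (t := G.obj ∘ t.color)
      (fun i => eqToHom (obj_tensorFam hG (s i).color) ≫ G.map (g i)) =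
      eqToHom (congrArg tensorFam (funext fun i => obj_tensorFam hG (s i).color)) ≫
        tensorFamHom fun i => G.map (g i) := by
    rw [← tensorFamHom_eqToHom (fun i => obj_tensorFam hG (s i).color)]
    exact (tensorFamHom_comp _ _).symm
  exact eqToHom_comp_map_eqToHom_comp _ _ h₁ h₂ _ _ h₃ h₄ f

end

theorem endoMap_isMorphism {C D : SSMC.{u}} (G : C ⟶ D) : (endoMap G).IsMorphism where
  map_act σ f := map_permTensor_comp (Hom.isStrict G) σ f
  map_one c := (congrArg (eqToHom (obj_tensorFam (Hom.isStrict G) _) ≫ ·) (eqToHom_map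
    (Hom.functor G) (tensorFam_single (C := C.carrier) c))).trans (eqToHom_trans _ _)
  map_comp f _ g := map_eqToHom_comp_tensorFamHom_comp (Hom.isStrict G) f g

end SSMC

/-! ### Functors with prescribed values, and functoriality of `∫`. -/

theorem IsGivenBy.unique {A B : Type*} [Category* A] [Category* B] {K K' : A ⥤ B} {obj : A → B}
    {map : ∀ {X Y : A}, (X ⟶ Y) → (obj X ⟶ obj Y)} (h : IsGivenBy K obj map)
    (h' : IsGivenBy K' obj map) : K = K' := by
  obtain ⟨e, he⟩ := h
  obtain ⟨e', he'⟩ := h'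
  exact CategoryTheory.Functor.ext (fun X => (e X).trans (e' X).symm) fun X Y f => by
    simp [he, he']

theorem IsGivenBy.of_rfl {A B : Type*} [Category* A] [Category* B] (K : A ⥤ B) :
    IsGivenBy K K.obj K.map :=
  ⟨fun _ => rfl, fun f => by simp⟩

namespace MonGroth

universe v₁ u₁ v₂ u₂ v₃ u₃ v₄ u₄

variable {C : Type u₁} [Category.{v₁} C] {C' : Type u₃} [Category.{v₃} C']
  {C'' : Type u₄} [Category.{v₄} C'']
  {F : C ⥤ Cat.{v₂, u₂}} {F' : C' ⥤ Cat.{v₂, u₂}} {F'' : C'' ⥤ Cat.{v₂, u₂}}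
  {G : C ⥤ C'} {G' : C' ⥤ C''} (g : F ⟶ G ⋙ F') (g' : F' ⟶ G' ⋙ F'')

theorem hatMap_hatMap {c d : C} {x : F.obj c} {y : F.obj d} (f : c ⟶ d) (a : push F f x ⟶ y) :
    hatMap g' (G.map f) (eqToHom (push_app g f x) ≫ appHom g a) =
      mk ((G ⋙ G').map f) (eqToHom ((push_app g' (G.map f) (app g x)).trans
        (congrArg (app g') (push_app g f x))) ≫ appHom g' (appHom g a)) := by
  rw [hatMap]
  exact mk_congr rfl (by simp [appHom_comp, appHom_eqToHom])

theorem hat_hat_map {X Y : Grothendieck F} (p : X ⟶ Y) :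
    (hat (G := G ⋙ G') (g ≫ Functor.whiskerLeft G g')).map p = (hat g').map ((hat g).map p) :=
  (hatMap_hatMap g g' p.base p.fiber).symm

theorem hat_comp :
    hat (G := G ⋙ G') (g ≫ Functor.whiskerLeft G g') = hat g ⋙ hat g' :=
  -- The values on objects agree definitionally, so heterogeneous equality of morphisms is plain
  -- equality.
  CategoryTheory.Functor.hext (fun _ => rfl) fun _ _ p => heq_of_eq (hat_hat_map g g' p)

theorem hat_id_map {X Y : Grothendieck F} (p : X ⟶ Y) :
    (hat (G := 𝟭 C) (𝟙 F)).map p = p :=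
  mk_congr rfl rfl

theorem hat_id : hat (G := 𝟭 C) (𝟙 F) = 𝟭 (Grothendieck F) :=
  CategoryTheory.Functor.hext (fun _ => rfl) fun _ _ p => heq_of_eq (hat_id_map p)

end MonGroth

namespace NetMod

theorem integralMap_id (F : NetMod.{u}) : integralMap (𝟙 F) = 𝟙 (integral F) :=
  SSMC.Hom.ext MonGroth.hat_id

theorem integralMap_comp {F F' F'' : NetMod.{u}} (p : F ⟶ F') (q : F' ⟶ F'') :
    integralMap (p ≫ q) = integralMap p ≫ integralMap q :=
  SSMC.Hom.ext (MonGroth.hat_comp p.trans q.trans)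

/-- The functor `F ↦ ∫ F`. -/
def integralFunctor : NetMod.{u} ⥤ SSMC.{u} where
  obj := integral
  map := integralMap
  map_id := integralMap_id
  map_comp := integralMap_comp

end NetMod

/-! ### Functoriality of `Op`, and the theorem. -/

namespace SSMC

/-- The endomorphism operad of a strict symmetric monoidal category. -/
def endoOperad (C : SSMC.{u}) : Operad.{u} := ⟨endoStruct C, endoStruct_isOperad C⟩

/-- The morphism of endomorphism operads of a strict symmetric monoidal functor. -/
def endoOperadMap {C D : SSMC.{u}} (G : C ⟶ D) : endoOperad C ⟶ endoOperad D :=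
  ⟨endoMap G, endoMap_isMorphism G⟩

theorem endoOperadMap_id (C : SSMC.{u}) : endoOperadMap (𝟙 C) = 𝟙 (endoOperad C) := by
  refine Operad.Hom.ext rfl (heq_of_eq ?_)
  funext t c f
  -- For the identity functor the comparison `obj_tensorFam` relates an object to itself, so its
  -- cast is an identity.
  exact Category.id_comp (obj := C.carrier) f

theorem endoOperadMap_comp {C D E : SSMC.{u}} (G : C ⟶ D) (H : D ⟶ E) :
    endoOperadMap (G ≫ H) = endoOperadMap G ≫ endoOperadMap H := by
  refine Operad.Hom.ext rfl (heq_of_eq ?_)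
  funext t c f
  have h : eqToHom (obj_tensorFam ((Hom.isStrict G).comp (Hom.isStrict H)) t.color) ≫
      (Hom.functor H).map ((Hom.functor G).map f) =
      eqToHom (obj_tensorFam (Hom.isStrict H) ((Hom.functor G).obj ∘ t.color)) ≫
        (Hom.functor H).map (eqToHom (obj_tensorFam (Hom.isStrict G) t.color) ≫
          (Hom.functor G).map f) := by
    rw [Functor.map_comp, eqToHom_map, eqToHom_trans_assoc]
  exact h

/-- The functor `C ↦ Op(C)`. -/
def endoFunctor : SSMC.{u} ⥤ Operad.{u} where
  obj := endoOperad
  map := endoOperadMap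
  map_id := endoOperadMap_id
  map_comp := endoOperadMap_comp

end SSMC

theorem mainTheorem1 :
    ∃ (isOperad : ∀ C : SSMC.{u}, (SSMC.endoStruct C).IsOperad)
      (isMorphism : ∀ {C D : SSMC.{u}} (G : C ⟶ D), (SSMC.endoMap G).IsMorphism),
      (∃! O : NetMod.{u} ⥤ Operad.{u},
        IsGivenBy O (fun F => ⟨SSMC.endoStruct F.integral, isOperad F.integral⟩)
          (fun p => ⟨SSMC.endoMap (NetMod.integralMap p), isMorphism (NetMod.integralMap p)⟩)) ∧
      ∃ (I : NetMod.{u} ⥤ SSMC.{u}) (E : SSMC.{u} ⥤ Operad.{u}),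
        IsGivenBy I NetMod.integral NetMod.integralMap ∧
        IsGivenBy E (fun C => ⟨SSMC.endoStruct C, isOperad C⟩)
          (fun G => ⟨SSMC.endoMap G, isMorphism G⟩) ∧
        ∀ O : NetMod.{u} ⥤ Operad.{u},
          IsGivenBy O (fun F => ⟨SSMC.endoStruct F.integral, isOperad F.integral⟩)
            (fun p => ⟨SSMC.endoMap (NetMod.integralMap p),
              isMorphism (NetMod.integralMap p)⟩) → O = I ⋙ E := by
  -- The prescribed values are those of the composite by unfolding. Uniqueness then gives both `∃!`
  -- and the factorization of every such functor.
  have h := IsGivenBy.of_rfl (NetMod.integralFunctor.{u} ⋙ SSMC.endoFunctor.{u})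
  exact ⟨SSMC.endoStruct_isOperad, SSMC.endoMap_isMorphism,
    ⟨NetMod.integralFunctor ⋙ SSMC.endoFunctor, h, fun O hO => hO.unique h⟩,
    NetMod.integralFunctor, SSMC.endoFunctor, IsGivenBy.of_rfl _, IsGivenBy.of_rfl _,
    fun O hO => hO.unique h⟩
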